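/- Let $\mathbb R^{2,1}$ be $\mathbb R^3$ with the form $\langle (x,y,z),(x',y',z')\rangle = xx'+yy'-zz'$, let $\mathbb S^1=\mathbb R/2\pi\mathbb Z$, write $|\theta-\theta'|$ for the distance in $\mathbb R/2\pi\mathbb Z$, and put $\vec\theta=(\cos\theta,\sin\theta,1)$. A convex entire spacelike surface is the graph $\Sigma$ of a convex $C^2$ function $f:\mathbb R^2\to\mathbb R$ all of whose tangent planes are spacelike (equivalently, $\|Df\|<1$ everywhere); its curvature is $K=-\det B$, where $B$ is its shape operator, and its null support function is $\theta\mapsto\sup_{p\in\Sigma}\langle p,\vec\theta\rangle\in\mathbb R\cup\{+\infty\}$. The surface $\Sigma$ is complete if its intrinsic distance is complete. If its null support function is $\phi$, then $\Sigma$ is called incomplete at $\theta$ if $\phi(\theta)<+\infty$ and there is a geodesic $\gamma:[0,T)\to\Sigma$ of finite length, proper as a map to $\Sigma$, with $\langle\gamma(t),\vec\theta\rangle\to\phi(\theta)$ as $t\to T$; otherwise $\Sigma$ is called complete at $\theta$. Theorem. Let $\phi:\mathbb S^1\to\mathbb R\cup\{+\infty\}$ be lower semicontinuous and finite on at least three points.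 (1) Let $\theta_0\in\mathbb S^1$ be such that $\phi(\theta_0)<+\infty$ and there exist $M>0$ and a sequence $\theta_i\to\theta_0$ with $$\phi(\theta_i)<\phi(\theta_0)+M|\theta_i-\theta_0|\quad\text{for all } i.$$ Then every convex entire spacelike surface in $\mathbb R^{2,1}$ with curvature bounded below and null support function $\phi$ is complete at $\theta_0$. (2) If the condition in (1) holds at every $\theta_0\in\mathbb S^1$ at which $\phi$ is finite (with $M$ and the sequence allowed to depend on $\theta_0$), then every convex entire spacelike surface in $\mathbb R^{2,1}$ with curvature bounded below and null support function $\phi$ is complete. -/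

import Mathlib

open Set Filter Topology

noncomputable section

/-- The horizontal plane with its Euclidean norm. -/
abbrev Plane := EuclideanSpace ℝ (Fin 2)

/-- The vector space underlying Minkowski three-space; only its topology and linear structure are
used, together with `minkForm`. -/
abbrev Mink := EuclideanSpace ℝ (Fin 3)

/-- The Lorentzian inner product `x x' + y y' - z z'`. -/
def minkForm (u v : Mink) : ℝ := u 0 * v 0 + u 1 * v 1 - u 2 * v 2

/-- The null vector `(cos θ, sin θ, 1)`, for `θ` in the circle `ℝ / 2πℤ`. -/
def nullVec (θ : Real.Angle) : Mink := !₂[θ.cos, θ.sin, 1]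

/-- The parametrization `(x, y) ↦ (x, y, f (x, y))` of the graph of `f`. -/
def graphMap (f : Plane → ℝ) (p : Plane) : Mink := !₂[p 0, p 1, f p]

/-- The tangent vector to the graph of `f` above `p` in the coordinate direction `v`. -/
def tangentVec (f : Plane → ℝ) (p v : Plane) : Mink := fderiv ℝ (graphMap f) p v

/-- The first fundamental form of the graph of `f`, in the coordinates of the plane. -/
def firstForm (f : Plane → ℝ) (p v w : Plane) : ℝ :=
  minkForm (tangentVec f p v) (tangentVec f p w)

/-- `f` is a function whose graph is a convex entire spacelike surface of class `C²`: it is defined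
on the whole plane, convex and `C²`, and every nonzero tangent vector of the graph is spacelike. -/
structure IsConvexEntireSpacelike (f : Plane → ℝ) : Prop where
  contDiff : ContDiff ℝ 2 f
  convex : ConvexOn ℝ univ f
  spacelike : ∀ p v : Plane, v ≠ 0 → 0 < firstForm f p v v

/-- The Gauss map: the future unit normal `(∂ₓf, ∂_yf, 1) / √(1 - |∇f|²)` to the graph of `f`. -/
def gaussMap (f : Plane → ℝ) (p : Plane) : Mink :=
  (√(1 - ‖gradient f p‖ ^ 2))⁻¹ • !₂[gradient f p 0, gradient f p 1, 1]

/-- The second fundamental form `II(v, w) = I(B v, w)`, where the shape operator `B` is the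
differential of the Gauss map. -/
def secondForm (f : Plane → ℝ) (p v w : Plane) : ℝ :=
  minkForm (fderiv ℝ (gaussMap f) p v) (tangentVec f p w)

/-- The Gram matrix of a bilinear form on the plane, in the standard basis. -/
def gram (b : Plane → Plane → ℝ) : Matrix (Fin 2) (Fin 2) ℝ :=
  Matrix.of fun i j => b (EuclideanSpace.single i 1) (EuclideanSpace.single j 1)

/-- The curvature `K = - det B` of the first fundamental form (Gauss equation in Minkowski space),
where `det B = det II / det I`. -/
def curvature (f : Plane → ℝ) (p : Plane) : ℝ :=
  -((gram (secondForm f p)).det / (gram (firstForm f p)).det)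

/-- The curvature of the graph of `f` is bounded below. -/
def CurvatureBoundedBelow (f : Plane → ℝ) : Prop := ∃ k : ℝ, ∀ p : Plane, k ≤ curvature f p

/-- The null support function of the graph of `f`: the supremum of `⟨·, (cos θ, sin θ, 1)⟩` over
the graph. -/
def nullSupport (f : Plane → ℝ) (θ : Real.Angle) : EReal :=
  ⨆ p : Plane, ((minkForm (graphMap f p) (nullVec θ) : ℝ) : EReal)

/-- The length, for the first fundamental form, of the curve over `c` restricted to `[0, 1]`. -/
def curveLength (f : Plane → ℝ) (c : ℝ → Plane) : ℝ :=
  ∫ t in (0 : ℝ)..1, √(firstForm f (c t) (deriv c t) (deriv c t))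

/-- The intrinsic distance on the graph of `f` between the points above `p` and `q`: the infimum of
the lengths of the `C¹` curves joining them. -/
def intrinsicDist (f : Plane → ℝ) (p q : Plane) : ℝ :=
  sInf {l : ℝ | ∃ c : ℝ → Plane, ContDiff ℝ 1 c ∧ c 0 = p ∧ c 1 = q ∧ l = curveLength f c}

/-- The graph of `f` is complete: every Cauchy sequence for the intrinsic distance converges. -/
def IsCompleteSurface (f : Plane → ℝ) : Prop :=
  ∀ u : ℕ → Plane,
    (∀ ε : ℝ, 0 < ε → ∃ N : ℕ, ∀ m n : ℕ, N ≤ m → N ≤ n → intrinsicDist f (u m) (u n) < ε) →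
    ∃ q : Plane, Tendsto (fun n => intrinsicDist f (u n) q) atTop (𝓝 0)

/-- The curve `graphMap f ∘ c` is an (affinely parametrized) geodesic of the graph of `f` on the set
`I` of times: its acceleration is orthogonal to the surface. -/
def IsGeodesicOn (f : Plane → ℝ) (c : ℝ → Plane) (I : Set ℝ) : Prop :=
  ∃ v a : ℝ → Mink, ∀ t ∈ I,
    HasDerivWithinAt (fun s => graphMap f (c s)) (v t) I t ∧ HasDerivWithinAt v (a t) I t ∧
      ∀ w : Plane, minkForm (a t) (tangentVec f (c t) w) = 0

/-- The graph of `f` is incomplete at `θ`: it has a null support plane `⟨·, (cos θ, sin θ, 1)⟩ = h`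
in the direction `θ`, and a proper geodesic of finite length that is asymptotic to this plane. As
geodesics have constant speed, and a constant one is not proper, those of finite length are the
geodesics on a half-open interval `[0, T)` with `T` finite. -/
def IncompleteAt (f : Plane → ℝ) (θ : Real.Angle) : Prop :=
  ∃ h : ℝ, nullSupport f θ = (h : EReal) ∧
    ∃ T : ℝ, 0 < T ∧ ∃ c : ℝ → Plane, IsGeodesicOn f c (Ico 0 T) ∧
      Tendsto c (𝓝[<] T) (cocompact Plane) ∧
      Tendsto (fun t => minkForm (graphMap f (c t)) (nullVec θ)) (𝓝[<] T) (𝓝 h)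

/-- The graph of `f` is complete at `θ`. -/
def CompleteAt (f : Plane → ℝ) (θ : Real.Angle) : Prop := ¬ IncompleteAt f θ

/-- The sequentially sublinear condition on `φ` at `θ₀`. The distance on `Real.Angle` is the
quotient distance of `ℝ / 2πℤ`. -/
def SeqSublinearAt (φ : Real.Angle → EReal) (θ₀ : Real.Angle) : Prop :=
  ∃ M : ℝ, 0 < M ∧ ∃ θ : ℕ → Real.Angle, Tendsto θ atTop (𝓝 θ₀) ∧
    ∀ i : ℕ, φ (θ i) < φ θ₀ + ((M * dist (θ i) θ₀ : ℝ) : EReal)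

end

noncomputable section

/-! Fix a direction `θ₀` with finite value `h` and write `(a, b)` for its cosine and sine. Use the
light-cone coordinates `u = f - (a x + b y) + h`, `v = f + (a x + b y) + h` and the transverse
coordinate `-b x + a y`. In these coordinates the Minkowski square of a difference is (transverse
difference)² minus the product of the `u`- and `v`-differences, and the surface lies in `u ≥ 0`.

The surface side. The planes supporting the surface in the directions `θᵢ`, together with the
sublinear bound on `φ`, put the surface above null planes with parameter `s = tan (|θᵢ - θ₀| / 2) →
0`, all tilted to the same side after passing to a subsequence
(`SeqSublinearAt.exists_null_planes`). A lower curvature bound says `det D²f ≤ C (1 - |Df|²)²`. The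
barrier `s v = ε exp (α y + β (1 - u/s)²)` is too curved to be touched from above by such a surface
once `8 C β < α²`, whatever `s` and `ε` are (`not_isLocalMin_barrierGap`). Comparison on a box,
where the null planes handle one face, gives a constant `c` with `s v ≥ c` at `u = s/2`, along `s →
0` and for bounded transverse coordinate (`exists_le_mul_of_curvature`). So `u v` does not tend to
`0` there.

The curve side. The acceleration of a geodesic is normal to the surface and, by convexity, future
directed, so the geodesic is convex for the causal order. If it escapes in finite time along `u →
0`, its transverse coordinate stays bounded. Convexity gives `u ≤ -(T - t) u'`, bounded speed gives
`-u' v' ≤ L²`, and together they give `u v → 0` (`mul_lt_of_tendsto_zero`). The two sides are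
incompatible, which proves (1).

For (2) the curve argument is made for a weaker object, `IsConvexRay`, which needs only a velocity
supporting the curve in the causal order. Such a ray always turns towards a null direction and is
asymptotic to a null support plane, so under the hypothesis of (2) no ray exists. Rays replace the
minimizing geodesics of Hopf-Rinow. Three null support planes make a function `f - ⟨α, ·⟩` proper.
Polygons minimizing energy in its sublevel sets are convex for the causal order and have almost
constant speed (`exists_polygon`). If an intrinsic ball of radius 1 were unbounded, such polygons
would converge to a ray (`exists_isConvexRay`). Hence unit balls are bounded, and completeness
follows from the comparison of intrinsic and Euclidean distances on bounded sets. -/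

theorem fderiv_apply_eq_gradient (f : Plane → ℝ) (p v : Plane) :
    fderiv ℝ f p v = gradient f p 0 * v 0 + gradient f p 1 * v 1 := by
  rw [← inner_gradient_left]
  simp only [PiLp.inner_apply, Fin.sum_univ_two, RCLike.inner_apply, conj_trivial]
  ring

theorem Plane.norm_sq (v : Plane) : ‖v‖ ^ 2 = v 0 ^ 2 + v 1 ^ 2 := by
  simp [EuclideanSpace.norm_sq_eq, Fin.sum_univ_two]

theorem hasFDerivAt_euclidean {ι H : Type*} [Fintype ι] [NormedAddCommGroup H] [NormedSpace ℝ H]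
    {g : H → EuclideanSpace ℝ ι} {g' : H →L[ℝ] EuclideanSpace ℝ ι} {y : H} :
    HasFDerivAt g g' y ↔ ∀ i, HasFDerivAt (fun x => g x i) (PiLp.proj _ _ i ∘L g') y := by
  simp_rw [← hasFDerivWithinAt_univ]
  exact hasFDerivWithinAt_euclidean

theorem hasFDerivAt_graphMap {f : Plane → ℝ} {p : Plane} (hf : DifferentiableAt ℝ f p) :
    HasFDerivAt (graphMap f) ((PiLp.continuousLinearEquiv 2 ℝ (fun _ : Fin 3 => ℝ)).symm.toContinuousLinearMap.comp
      (ContinuousLinearMap.pi ![EuclideanSpace.proj 0, EuclideanSpace.proj 1, fderiv ℝ f p])) p := by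
  rw [hasFDerivAt_euclidean]
  intro i
  fin_cases i
  · exact (EuclideanSpace.proj (0 : Fin 2) : Plane →L[ℝ] ℝ).hasFDerivAt
  · exact (EuclideanSpace.proj (1 : Fin 2) : Plane →L[ℝ] ℝ).hasFDerivAt
  · exact hf.hasFDerivAt

theorem tangentVec_eq {f : Plane → ℝ} {p : Plane} (hf : DifferentiableAt ℝ f p) (v : Plane) :
    tangentVec f p v = !₂[v 0, v 1, fderiv ℝ f p v] := by
  unfold tangentVec
  rw [(hasFDerivAt_graphMap hf).fderiv]
  ext i
  fin_cases i <;> rfl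

theorem firstForm_eq {f : Plane → ℝ} {p : Plane} (hf : DifferentiableAt ℝ f p) (v w : Plane) :
    firstForm f p v w = v 0 * w 0 + v 1 * w 1 - fderiv ℝ f p v * fderiv ℝ f p w := by
  simp [firstForm, tangentVec_eq hf, minkForm]

/-! ### Slope bounds, second-order bounds and the curvature of an entire graph. -/

namespace IsConvexEntireSpacelike

variable {f : Plane → ℝ} (hf : IsConvexEntireSpacelike f)

include hf

theorem differentiable : Differentiable ℝ f := hf.contDiff.differentiable (by norm_num)

theorem continuous : Continuous f := hf.contDiff.continuous

theorem continuous_graphMap : Continuous (graphMap f) := by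
  have := hf.differentiable
  exact continuous_iff_continuousAt.2 fun p => (hasFDerivAt_graphMap (this p)).continuousAt

theorem continuous_fderiv : Continuous (fderiv ℝ f) := hf.contDiff.continuous_fderiv (by norm_num)

theorem differentiable_fderiv : Differentiable ℝ (fderiv ℝ f) :=
  (hf.contDiff.fderiv_right (m := 1) (by norm_num)).differentiable (by norm_num)

theorem fderiv_sq_lt {p v : Plane} (hv : v ≠ 0) : fderiv ℝ f p v ^ 2 < ‖v‖ ^ 2 := by
  have := hf.spacelike p v hv
  rw [firstForm_eq (hf.differentiable p)] at this
  rw [Plane.norm_sq]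
  nlinarith

theorem abs_fderiv_le (p v : Plane) : |fderiv ℝ f p v| ≤ ‖v‖ := by
  by_cases hv : v = 0
  · simp [hv]
  · exact abs_le_of_sq_le_sq (hf.fderiv_sq_lt hv).le (norm_nonneg _)

theorem norm_gradient_lt (p : Plane) : ‖gradient f p‖ < 1 := by
  by_cases h : gradient f p = 0
  · simp [h]
  have h1 := hf.fderiv_sq_lt (p := p) h
  have h2 : fderiv ℝ f p (gradient f p) = ‖gradient f p‖ ^ 2 := by
    rw [← inner_gradient_left, real_inner_self_eq_norm_sq]
  rw [h2] at h1
  have h3 : 0 < ‖gradient f p‖ := norm_pos_iff.2 h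
  have : ‖gradient f p‖ ^ 2 < 1 := by
    by_contra h4
    push Not at h4
    nlinarith [sq_nonneg (‖gradient f p‖)]
  nlinarith

theorem norm_fderiv_lt (p : Plane) : ‖fderiv ℝ f p‖ < 1 := by
  simpa [gradient] using hf.norm_gradient_lt p

theorem fderiv_le_sub (x y : Plane) : fderiv ℝ f x (y - x) ≤ f y - f x := by
  have h1 : HasDerivAt (fun t : ℝ => f (x + t • (y - x))) (fderiv ℝ f x (y - x)) 0 := by
    have h0 : HasFDerivAt f (fderiv ℝ f x) (x + (0:ℝ) • (y - x)) := by
      simpa using (hf.differentiable x).hasFDerivAt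
    have h1 : HasDerivAt (fun t : ℝ => x + t • (y - x)) (y - x) 0 := by
      simpa using ((hasDerivAt_id (0:ℝ)).smul_const (y - x)).const_add x
    exact h0.comp_hasDerivAt (0:ℝ) h1
  have h2 : ConvexOn ℝ univ (fun t : ℝ => f (x + t • (y - x))) := by
    have := hf.convex.comp_affineMap (AffineMap.lineMap x y : ℝ →ᵃ[ℝ] Plane)
    rw [preimage_univ] at this
    refine this.congr fun t _ => ?_
    simp [AffineMap.lineMap_apply, add_comm]
  have := h2.le_slope_of_hasDerivAt (mem_univ 0) (mem_univ 1) zero_lt_one h1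
  simpa [slope] using this

theorem exists_fderiv_eq_sub (x y : Plane) :
    ∃ z ∈ segment ℝ x y, f y - f x = fderiv ℝ f z (y - x) := by
  obtain ⟨z, hz, h⟩ := domain_mvt (f := f) (s := univ) (f' := fderiv ℝ f)
    (fun x _ => (hf.differentiable x).hasFDerivAt.hasFDerivWithinAt) convex_univ (mem_univ x) (mem_univ y)
  exact ⟨z, hz, h⟩

theorem abs_sub_lt {x y : Plane} (h : x ≠ y) : |f y - f x| < ‖y - x‖ := by
  obtain ⟨z, -, hz⟩ := hf.exists_fderiv_eq_sub x y
  rw [hz]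
  exact abs_lt_of_sq_lt_sq (hf.fderiv_sq_lt (sub_ne_zero.2 h.symm)) (norm_nonneg _)

theorem abs_sub_le (x y : Plane) : |f y - f x| ≤ ‖y - x‖ := by
  by_cases h : x = y
  · simp [h]
  · exact (hf.abs_sub_lt h).le

/-- On a compact set the slope of the surface is bounded away from `1`. -/
theorem exists_norm_fderiv_le {K : Set Plane} (hK : IsCompact K) :
    ∃ ρ : ℝ, 0 < ρ ∧ ρ < 1 ∧ ∀ x ∈ K, ‖fderiv ℝ f x‖ ≤ ρ := by
  rcases K.eq_empty_or_nonempty with rfl | hne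
  · exact ⟨1/2, by norm_num, by norm_num, by simp⟩
  obtain ⟨x, -, hx⟩ := hK.exists_isMaxOn hne hf.continuous_fderiv.norm.continuousOn
  refine ⟨max (1/2) ‖fderiv ℝ f x‖, by positivity, max_lt (by norm_num) (hf.norm_fderiv_lt x), ?_⟩
  intro y hy
  exact (hx hy).trans (le_max_right _ _)

theorem exists_abs_sub_le {K : Set Plane} (hK : IsCompact K) (hc : Convex ℝ K) :
    ∃ ρ : ℝ, 0 < ρ ∧ ρ < 1 ∧ (∀ x ∈ K, ‖fderiv ℝ f x‖ ≤ ρ) ∧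
      ∀ x ∈ K, ∀ y ∈ K, |f y - f x| ≤ ρ * ‖y - x‖ := by
  obtain ⟨ρ, h0, h1, h⟩ := hf.exists_norm_fderiv_le hK
  refine ⟨ρ, h0, h1, h, fun x hx y hy => ?_⟩
  exact hc.norm_image_sub_le_of_norm_fderiv_le (fun x _ => hf.differentiable x) h hx hy

/-- The Taylor estimate for a `C²` function. It is what makes the defects in `abs_chordSq_sub_le`
quadratic in the edge lengths. -/
theorem exists_sub_le_sq {K : Set Plane} (hK : IsCompact K) (hc : Convex ℝ K) :
    ∃ D : ℝ, 0 < D ∧ ∀ x ∈ K, ∀ y ∈ K,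
      f y - f x - fderiv ℝ f x (y - x) ≤ D * ‖y - x‖ ^ 2 := by
  have hcont : Continuous (fderiv ℝ (fderiv ℝ f)) :=
    (hf.contDiff.fderiv_right (m := 1) (by norm_num)).continuous_fderiv (by norm_num)
  obtain ⟨D, hD⟩ : ∃ D, ∀ x ∈ K, ‖fderiv ℝ (fderiv ℝ f) x‖ ≤ D := by
    rcases K.eq_empty_or_nonempty with rfl | hne
    · exact ⟨0, by simp⟩
    obtain ⟨x, -, hx⟩ := hK.exists_isMaxOn hne
      (Continuous.norm (E := Plane →L[ℝ] Plane →L[ℝ] ℝ) hcont).continuousOn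
    exact ⟨_, fun y hy => hx hy⟩
  refine ⟨max D 1, by positivity, fun x hx y hy => ?_⟩
  have hseg : segment ℝ x y ⊆ K := hc.segment_subset hx hy
  have hL : ∀ z ∈ segment ℝ x y, ‖fderiv ℝ f z - fderiv ℝ f x‖ ≤ max D 1 * ‖y - x‖ := by
    intro z hz
    have h1 := hc.norm_image_sub_le_of_norm_fderiv_le (fun x _ => hf.differentiable_fderiv x) hD
      hx (hseg hz)
    refine h1.trans ?_
    have h2 : ‖z - x‖ ≤ ‖y - x‖ := by
      rw [segment_eq_image'] at hz
      obtain ⟨t, ht, rfl⟩ := hz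
      simp only [add_sub_cancel_left, norm_smul, Real.norm_eq_abs, abs_of_nonneg ht.1]
      exact mul_le_of_le_one_left (norm_nonneg _) ht.2
    exact mul_le_mul (le_max_left _ _) h2 (norm_nonneg _) (by positivity)
  have := (convex_segment x y).norm_image_sub_le_of_norm_fderiv_le'
    (fun x _ => hf.differentiable x) hL (left_mem_segment ℝ x y) (right_mem_segment ℝ x y)
  rw [Real.norm_eq_abs] at this
  calc _ ≤ _ := le_abs_self _
    _ ≤ _ := this
    _ = _ := by ring

/-- The derivative of the normalizing factor `lam` contributes a multiple of the normal, which is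
orthogonal to tangent vectors. Hence the second fundamental form is `lam` times the Hessian of `f`,
while `det I = 1 - |∇f|² = lam⁻²`. -/
theorem curvature_eq (p : Plane) :
    curvature f p = -((fderiv ℝ (fderiv ℝ f) p (EuclideanSpace.single 0 1) (EuclideanSpace.single 0 1) *
      fderiv ℝ (fderiv ℝ f) p (EuclideanSpace.single 1 1) (EuclideanSpace.single 1 1) -
      fderiv ℝ (fderiv ℝ f) p (EuclideanSpace.single 0 1) (EuclideanSpace.single 1 1) *
      fderiv ℝ (fderiv ℝ f) p (EuclideanSpace.single 1 1) (EuclideanSpace.single 0 1)) /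
        (1 - ‖gradient f p‖ ^ 2) ^ 2) := by
  have hd := hf.differentiable
  have hg : ∀ (i : Fin 2) (q : Plane), gradient f q i = fderiv ℝ f q (EuclideanSpace.single i 1) := by
    intro i q
    rw [fderiv_apply_eq_gradient]
    fin_cases i <;> simp
  have hn := hf.norm_gradient_lt p
  have hpos : 0 < 1 - ‖gradient f p‖ ^ 2 := by nlinarith [norm_nonneg (gradient f p)]
  have hgd : ∀ i : Fin 2, HasFDerivAt (fun q => gradient f q i)
      ((fderiv ℝ (fderiv ℝ f) p).flip (EuclideanSpace.single i 1)) p := by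
    intro i
    simp_rw [hg]
    have := (hf.differentiable_fderiv p).hasFDerivAt.clm_apply
      (hasFDerivAt_const (EuclideanSpace.single i (1:ℝ) : Plane) p)
    refine this.congr_fderiv ?_
    ext v; simp
  have hlam : DifferentiableAt ℝ (fun q => (√(1 - ‖gradient f q‖ ^ 2))⁻¹) p := by
    have h1 : DifferentiableAt ℝ (fun q => 1 - ‖gradient f q‖ ^ 2) p := by
      simp_rw [Plane.norm_sq]
      exact ((((hgd 0).differentiableAt.pow 2).add ((hgd 1).differentiableAt.pow 2)).const_sub 1)
    exact (h1.sqrt hpos.ne').inv (Real.sqrt_pos.2 hpos).ne'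
  set lam : Plane → ℝ := fun q => (√(1 - ‖gradient f q‖ ^ 2))⁻¹ with hlamdef
  have hcomp : ∀ v : Plane, fderiv ℝ (gaussMap f) p v =
      !₂[lam p * fderiv ℝ (fderiv ℝ f) p v (EuclideanSpace.single 0 1) + fderiv ℝ lam p v * gradient f p 0,
        lam p * fderiv ℝ (fderiv ℝ f) p v (EuclideanSpace.single 1 1) + fderiv ℝ lam p v * gradient f p 1,
        fderiv ℝ lam p v] := by
    intro v
    have h : HasFDerivAt (gaussMap f)
      ((PiLp.continuousLinearEquiv 2 ℝ (fun _ : Fin 3 => ℝ)).symm.toContinuousLinearMap.comp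
      (ContinuousLinearMap.pi
        ![lam p • ((fderiv ℝ (fderiv ℝ f) p).flip (EuclideanSpace.single 0 1)) + (gradient f p 0) • fderiv ℝ lam p,
        lam p • ((fderiv ℝ (fderiv ℝ f) p).flip (EuclideanSpace.single 1 1)) + (gradient f p 1) • fderiv ℝ lam p,
        fderiv ℝ lam p])) p := by
      rw [hasFDerivAt_euclidean]
      intro i
      fin_cases i
      · exact hlam.hasFDerivAt.mul (hgd 0)
      · exact hlam.hasFDerivAt.mul (hgd 1)
      · have : (fun x => gaussMap f x 2) = lam := by
          ext x; simp [gaussMap, hlamdef]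
        show HasFDerivAt (fun x => gaussMap f x 2) (fderiv ℝ lam p) p
        rw [this]
        exact hlam.hasFDerivAt
    rw [h.fderiv]
    ext i
    fin_cases i
    · simp; ring
    · simp; ring
    · simp
  have hII : ∀ v w : Plane, secondForm f p v w = lam p * (
      fderiv ℝ (fderiv ℝ f) p v (EuclideanSpace.single 0 1) * w 0 +
      fderiv ℝ (fderiv ℝ f) p v (EuclideanSpace.single 1 1) * w 1) := by
    intro v w
    simp only [secondForm, hcomp, tangentVec_eq (hd p), minkForm, fderiv_apply_eq_gradient]
    simp
    ring
  have hlam2 : lam p ^ 2 = (1 - ‖gradient f p‖ ^ 2)⁻¹ := by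
    simp only [hlamdef, inv_pow, Real.sq_sqrt hpos.le]
  have hdet1 : (gram (firstForm f p)).det = 1 - ‖gradient f p‖ ^ 2 := by
    rw [Matrix.det_fin_two]
    simp [gram, firstForm_eq (hd p), Plane.norm_sq, hg]
    ring
  have hdet2 : (gram (secondForm f p)).det = lam p ^ 2 *
      (fderiv ℝ (fderiv ℝ f) p (EuclideanSpace.single 0 1) (EuclideanSpace.single 0 1) *
      fderiv ℝ (fderiv ℝ f) p (EuclideanSpace.single 1 1) (EuclideanSpace.single 1 1) -
      fderiv ℝ (fderiv ℝ f) p (EuclideanSpace.single 0 1) (EuclideanSpace.single 1 1) *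
      fderiv ℝ (fderiv ℝ f) p (EuclideanSpace.single 1 1) (EuclideanSpace.single 0 1)) := by
    rw [Matrix.det_fin_two]
    simp [gram, hII]
    ring
  rw [curvature, hdet1, hdet2, hlam2]
  field_simp

end IsConvexEntireSpacelike

/-! ### The barrier: second-order conditions at a point of contact. -/

theorem IsLocalMin.second_deriv_nonneg {ψ ψ' : ℝ → ℝ} {d t₀ : ℝ} (h : IsLocalMin ψ t₀)
    (h1 : ∀ᶠ t in 𝓝 t₀, HasDerivAt ψ (ψ' t) t) (h2 : HasDerivAt ψ' d t₀) : 0 ≤ d := by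
  by_contra! hd
  have h0 : ψ' t₀ = 0 := h.hasDerivAt_eq_zero h1.self_of_nhds
  have he : deriv ψ =ᶠ[𝓝 t₀] ψ' := h1.mono fun t ht => ht.deriv
  have hdd : deriv (deriv ψ) t₀ = d := by rw [he.deriv_eq, h2.deriv]
  -- With `d < 0` the minimum is also a local maximum, so `ψ` is locally constant and `d = 0`.
  have hmax : IsLocalMax ψ t₀ := isLocalMax_of_deriv_deriv_neg (by rwa [hdd])
    (by rw [he.self_of_nhds, h0]) h1.self_of_nhds.continuousAt
  have hc : ψ =ᶠ[𝓝 t₀] fun _ => ψ t₀ := by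
    filter_upwards [h, hmax] with t h3 h4 using le_antisymm h4 h3
  have : deriv (deriv ψ) t₀ = 0 := by
    rw [hc.deriv.deriv_eq]; simp
  linarith

theorem det_nonneg_of_quadratic_nonneg {A B D : ℝ}
    (h : ∀ x y : ℝ, 0 ≤ A * x ^ 2 + 2 * B * (x * y) + D * y ^ 2) : 0 ≤ A * D - B ^ 2 := by
  have hA : 0 ≤ A := by simpa using h 1 0
  have hD : 0 ≤ D := by simpa using h 0 1
  have h1 := h B (-A)
  have h2 := h D (-B)
  rcases eq_or_lt_of_le hA with h0 | h0
  · rcases eq_or_lt_of_le hD with h3 | h3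
    · have h4 := h 1 (-B)
      rw [← h0, ← h3] at *
      nlinarith
    · by_contra! h4
      nlinarith
  · by_contra! h4
    nlinarith

/-- Monotonicity of the determinant for a quadratic form that dominates a sum of two squares. -/
theorem sq_le_det_of_le {A B D p q r s : ℝ}
    (h : ∀ x y : ℝ, (p * x + q * y) ^ 2 + (r * x + s * y) ^ 2 ≤
      A * x ^ 2 + 2 * B * (x * y) + D * y ^ 2) :
    (p * s - q * r) ^ 2 ≤ A * D - B ^ 2 := by
  have h1 := det_nonneg_of_quadratic_nonneg (A := A - p ^ 2 - r ^ 2) (B := B - p * q - r * s)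
    (D := D - q ^ 2 - s ^ 2) (fun x y => by nlinarith [h x y])
  -- The difference of the two forms is positive semidefinite. The mixed terms in the expansion of
  -- the determinant are its values at `(q, -p)` and `(s, -r)`.
  have h2 := h q (-p)
  have h3 := h s (-r)
  nlinarith

/-- Since `K = -det D²f / (1 - |Df|²)²`, a lower bound on `K` is an upper bound on the Hessian
determinant. It is stated in an arbitrary orthonormal frame, of either orientation `σ = ±1`, so that
it can be used in the frame of the barrier. -/
theorem CurvatureBoundedBelow.exists_det_le {f : Plane → ℝ} (hf : IsConvexEntireSpacelike f)
    (hK : CurvatureBoundedBelow f) : ∃ C : ℝ, 0 < C ∧ ∀ (p e e' : Plane) (a b σ : ℝ),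
      a ^ 2 + b ^ 2 = 1 → σ ^ 2 = 1 → e = !₂[a, b] → e' = !₂[-σ * b, σ * a] →
      fderiv ℝ (fderiv ℝ f) p e e * fderiv ℝ (fderiv ℝ f) p e' e' -
        fderiv ℝ (fderiv ℝ f) p e e' ^ 2 ≤
        C * (1 - fderiv ℝ f p e ^ 2 - fderiv ℝ f p e' ^ 2) ^ 2 := by
  obtain ⟨k, hk⟩ := hK
  refine ⟨max 1 (-k), by positivity, fun p e e' a b σ hab hσ he he' => ?_⟩
  have h := hk p
  rw [hf.curvature_eq, le_neg, div_le_iff₀ (by have := hf.norm_gradient_lt p; have : 0 < 1 - ‖gradient f p‖ ^ 2 := (by nlinarith [norm_nonneg (gradient f p)]); positivity)] at h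
  have hsymm : ∀ v w : Plane, fderiv ℝ (fderiv ℝ f) p v w = fderiv ℝ (fderiv ℝ f) p w v :=
    fun v w => (hf.contDiff.contDiffAt.isSymmSndFDerivAt (by simp)).eq v w
  have he2 : e = a • EuclideanSpace.single 0 1 + b • EuclideanSpace.single 1 1 := by
    rw [he]; ext i; fin_cases i <;> simp
  have he2' : e' = (-σ * b) • EuclideanSpace.single 0 1 + (σ * a) • EuclideanSpace.single 1 1 := by
    rw [he']; ext i; fin_cases i <;> simp
  have hg : fderiv ℝ f p e ^ 2 + fderiv ℝ f p e' ^ 2 = ‖gradient f p‖ ^ 2 := by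
    rw [fderiv_apply_eq_gradient, fderiv_apply_eq_gradient, Plane.norm_sq, he, he']
    simp only [Matrix.cons_val_zero, Matrix.cons_val_one]
    linear_combination ((gradient f p) 0 ^ 2 * b ^ 2 + (gradient f p) 1 ^ 2 * a ^ 2
      - 2 * a * b * (gradient f p) 0 * (gradient f p) 1) * hσ
      + ((gradient f p) 0 ^ 2 + (gradient f p) 1 ^ 2) * hab
  rw [sub_sub, hg]
  have hdet : fderiv ℝ (fderiv ℝ f) p e e * fderiv ℝ (fderiv ℝ f) p e' e' -
        fderiv ℝ (fderiv ℝ f) p e e' ^ 2 =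
      fderiv ℝ (fderiv ℝ f) p (EuclideanSpace.single 0 1) (EuclideanSpace.single 0 1) *
      fderiv ℝ (fderiv ℝ f) p (EuclideanSpace.single 1 1) (EuclideanSpace.single 1 1) -
      fderiv ℝ (fderiv ℝ f) p (EuclideanSpace.single 0 1) (EuclideanSpace.single 1 1) *
      fderiv ℝ (fderiv ℝ f) p (EuclideanSpace.single 1 1) (EuclideanSpace.single 0 1) := by
    rw [he2, he2']
    simp only [map_add, map_smul, add_apply, smul_apply, smul_eq_mul]
    rw [hsymm (EuclideanSpace.single 1 1) (EuclideanSpace.single 0 1)]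
    generalize fderiv ℝ (fderiv ℝ f) p (EuclideanSpace.single 0 1) (EuclideanSpace.single 0 1) = A
    generalize fderiv ℝ (fderiv ℝ f) p (EuclideanSpace.single 1 1) (EuclideanSpace.single 1 1) = D
    generalize fderiv ℝ (fderiv ℝ f) p (EuclideanSpace.single 0 1) (EuclideanSpace.single 1 1) = B
    linear_combination (A * D - B ^ 2) * (a ^ 2 + b ^ 2) ^ 2 * hσ + (A * D - B ^ 2) * (a ^ 2 + b ^ 2 + 1) * hab
  rw [hdet]
  refine h.trans ?_
  exact mul_le_mul_of_nonneg_right (le_max_right _ _) (sq_nonneg _)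

/-- The function `s v - ε exp (α σ y + β (1 - u / s) ^ 2)` in light-cone coordinates `u`, `v`, `y`
adapted to the null direction `(a, b, 1)`, along the graph of `f`. -/
def barrierGap (f : Plane → ℝ) (a b h s σ ε α β : ℝ) (x : Plane) : ℝ :=
  s * (f x + (a * x 0 + b * x 1) + h) -
    ε * Real.exp (α * (σ * (-b * x 0 + a * x 1)) + β * (1 - (f x - (a * x 0 + b * x 1) + h) / s) ^ 2)

/-- The barrier gap restricted to a line: `φ` is `f` along the line, and `X`, `Y` are the slopes of
the two linear coordinates. In the second-order condition every occurrence of `φ''` is collected on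
the right, including the one coming from `u` inside the exponential. -/
theorem second_order_of_isLocalMin_sub_exp {φ φ' : ℝ → ℝ} {d X₀ X Y₀ Y h s ε α β : ℝ}
    (hφ : ∀ t, HasDerivAt φ (φ' t) t) (hφ' : HasDerivAt φ' d 0)
    (hmin : IsLocalMin (fun t => s * (φ t + (X₀ + t * X) + h) -
      ε * Real.exp (α * (Y₀ + t * Y) + β * (1 - (φ t - (X₀ + t * X) + h) / s) ^ 2)) 0) :
    s * (φ' 0 + X) = ε * Real.exp (α * Y₀ + β * (1 - (φ 0 - X₀ + h) / s) ^ 2) *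
        (α * Y - 2 * β * (1 - (φ 0 - X₀ + h) / s) * ((φ' 0 - X) / s)) ∧
      ε * Real.exp (α * Y₀ + β * (1 - (φ 0 - X₀ + h) / s) ^ 2) *
        ((α * Y - 2 * β * (1 - (φ 0 - X₀ + h) / s) * ((φ' 0 - X) / s)) ^ 2 +
          2 * β * ((φ' 0 - X) / s) ^ 2) ≤
      (s + 2 * β * (1 - (φ 0 - X₀ + h) / s) *
        (ε * Real.exp (α * Y₀ + β * (1 - (φ 0 - X₀ + h) / s) ^ 2)) / s) * d := by
  set U : ℝ → ℝ := fun t => 1 - (φ t - (X₀ + t * X) + h) / s with hU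
  set E : ℝ → ℝ := fun t => α * (Y₀ + t * Y) + β * U t ^ 2 with hE
  set E' : ℝ → ℝ := fun t => α * Y - 2 * β * U t * ((φ' t - X) / s) with hE'
  have hU0 : 1 - (φ 0 - X₀ + h) / s = U 0 := by simp [hU]
  have hE0 : α * Y₀ + β * U 0 ^ 2 = E 0 := by simp [hE]
  rw [hU0, hE0]
  have hXt : ∀ t, HasDerivAt (fun t : ℝ => X₀ + t * X) X t := fun t => by
    simpa using ((hasDerivAt_id t).mul_const X).const_add X₀
  have hYt : ∀ t, HasDerivAt (fun t : ℝ => Y₀ + t * Y) Y t := fun t => by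
    simpa using ((hasDerivAt_id t).mul_const Y).const_add Y₀
  have hUt : ∀ t, HasDerivAt U (-((φ' t - X) / s)) t :=
    fun t => ((((hφ t).sub (hXt t)).add_const h).div_const s).const_sub 1
  have hEt : ∀ t, HasDerivAt E (E' t) t := fun t => by
    refine (((hYt t).const_mul α).add (((hUt t).pow 2).const_mul β)).congr_deriv ?_
    simp only [hE']; push_cast; ring
  have hψt : ∀ t, HasDerivAt (fun t => s * (φ t + (X₀ + t * X) + h) - ε * Real.exp (E t))
      (s * (φ' t + X) - ε * (Real.exp (E t) * E' t)) t := fun t =>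
    ((((hφ t).add (hXt t)).add_const h).const_mul s).sub ((hEt t).exp.const_mul ε)
  have hE't : HasDerivAt E' (2 * β * ((φ' 0 - X) / s) ^ 2 - 2 * β * U 0 * (d / s)) 0 := by
    refine ((((hUt 0).const_mul (2 * β)).mul ((hφ'.sub_const X).div_const s)).const_sub
      (α * Y)).congr_deriv ?_
    ring
  have hψ't : HasDerivAt (fun t => s * (φ' t + X) - ε * (Real.exp (E t) * E' t))
      (s * d - ε * (Real.exp (E 0) * E' 0 * E' 0 + Real.exp (E 0) *
        (2 * β * ((φ' 0 - X) / s) ^ 2 - 2 * β * U 0 * (d / s)))) 0 :=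
    ((hφ'.add_const X).const_mul s).sub (((hEt 0).exp.mul hE't).const_mul ε)
  have hfirst := hmin.hasDerivAt_eq_zero (hψt 0)
  have hsecond := hmin.second_deriv_nonneg (Eventually.of_forall hψt) hψ't
  constructor
  · simp only [hE'] at hfirst
    linarith
  · have h1 : α * Y - 2 * β * U 0 * ((φ' 0 - X) / s) = E' 0 := rfl
    rw [h1]
    have h2 : (s + 2 * β * U 0 * (ε * Real.exp (E 0)) / s) * d =
      s * d + ε * Real.exp (E 0) * (2 * β * U 0 * (d / s)) := by ring
    rw [h2]
    linarith

theorem IsConvexEntireSpacelike.hasFDerivAt_fderiv_apply {f : Plane → ℝ}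
    (hf : IsConvexEntireSpacelike f) (p w : Plane) :
    HasFDerivAt (fun q => fderiv ℝ f q w) ((fderiv ℝ (fderiv ℝ f) p).flip w) p := by
  have := (hf.differentiable_fderiv p).hasFDerivAt.clm_apply (hasFDerivAt_const w p)
  refine this.congr_fderiv ?_
  ext v; simp

theorem IsConvexEntireSpacelike.second_order_of_isLocalMin_barrierGap {f : Plane → ℝ}
    (hf : IsConvexEntireSpacelike f) {a b h s σ ε α β m G : ℝ} {x₀ : Plane}
    (hm : m = 1 - (f x₀ - (a * x₀ 0 + b * x₀ 1) + h) / s)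
    (hG : G = ε * Real.exp (α * (σ * (-b * x₀ 0 + a * x₀ 1)) + β * m ^ 2))
    (hmin : IsLocalMin (barrierGap f a b h s σ ε α β) x₀) (w : Plane) :
      s * (fderiv ℝ f x₀ w + (a * w 0 + b * w 1)) = G * (α * (σ * (-b * w 0 + a * w 1)) -
        2 * β * m * ((fderiv ℝ f x₀ w - (a * w 0 + b * w 1)) / s)) ∧
      G * ((α * (σ * (-b * w 0 + a * w 1)) -
        2 * β * m * ((fderiv ℝ f x₀ w - (a * w 0 + b * w 1)) / s)) ^ 2 +
        2 * β * ((fderiv ℝ f x₀ w - (a * w 0 + b * w 1)) / s) ^ 2) ≤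
      (s + 2 * β * m * G / s) * fderiv ℝ (fderiv ℝ f) x₀ w w := by
  subst hm hG
  have hline : ∀ t : ℝ, HasDerivAt (fun t : ℝ => x₀ + t • w) w t := fun t => by
    simpa using ((hasDerivAt_id t).smul_const w).const_add x₀
  have hφ : ∀ t : ℝ, HasDerivAt (fun t : ℝ => f (x₀ + t • w)) (fderiv ℝ f (x₀ + t • w) w) t :=
    fun t => (hf.differentiable _).hasFDerivAt.comp_hasDerivAt t (hline t)
  have hφ' : HasDerivAt (fun t : ℝ => fderiv ℝ f (x₀ + t • w) w)
      (fderiv ℝ (fderiv ℝ f) x₀ w w) 0 := by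
    have h1 := (hf.hasFDerivAt_fderiv_apply (x₀ + (0:ℝ) • w) w).comp_hasDerivAt (0:ℝ) (hline 0)
    rw [zero_smul, add_zero] at h1
    exact h1
  have hcomp : IsLocalMin (barrierGap f a b h s σ ε α β ∘ fun t : ℝ => x₀ + t • w) 0 := by
    have h2 : Tendsto (fun t : ℝ => x₀ + t • w) (𝓝 0) (𝓝 x₀) := by
      have := (hline 0).continuousAt.tendsto
      rwa [zero_smul, add_zero] at this
    have h4 := h2.eventually hmin
    filter_upwards [h4] with t ht
    simp only [Function.comp, zero_smul, add_zero]
    exact ht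
  have h5 := second_order_of_isLocalMin_sub_exp (X₀ := a * x₀ 0 + b * x₀ 1) (X := a * w 0 + b * w 1)
    (Y₀ := σ * (-b * x₀ 0 + a * x₀ 1)) (Y := σ * (-b * w 0 + a * w 1)) (h := h) (s := s) (ε := ε)
    (α := α) (β := β) hφ hφ' (by
      convert hcomp using 1
      ext t
      simp only [barrierGap, Function.comp, PiLp.add_apply, PiLp.smul_apply, smul_eq_mul]
      ring_nf)
  simp only [zero_smul, add_zero] at h5
  exact h5

/-- In the determinant on the left of `hd` all terms containing `m` cancel, leaving `2 β α² (1 - p)²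
/ s²`. The first-order condition `h1` and `m ≤ 1` bound `G` from below by `s² (1 + p) / (2 β (1 -
p))`, and then `s` and `G` both drop out. -/
theorem sq_mul_le_of_barrier_det {s p r α β m G A Δ : ℝ} (hs : 0 < s) (hG0 : 0 < G) (hβ : 0 < β)
    (hp0 : -1 < p) (hp1 : p < 1) (hm1 : m ≤ 1)
    (h1 : s ^ 2 * (1 + p) = 2 * β * m * G * (1 - p)) (hA : A * (1 - p) = 2 * s)
    (hd : ((-2 * β * m * ((p - 1) / s)) * (√(2 * β) * (r / s)) -
      (α - 2 * β * m * (r / s)) * (√(2 * β) * ((p - 1) / s))) ^ 2 ≤ (A / G) ^ 2 * Δ) :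
    α ^ 2 * (1 - p ^ 2) ^ 2 ≤ 8 * β * Δ := by
  have h2b : √(2 * β) ^ 2 = 2 * β := Real.sq_sqrt (by positivity)
  have hq : 0 < 1 - p := by linarith
  have hAeq : A = 2 * s / (1 - p) := by
    rw [eq_div_iff hq.ne']; exact hA
  have hl : ((-2 * β * m * ((p - 1) / s)) * (√(2 * β) * (r / s)) -
      (α - 2 * β * m * (r / s)) * (√(2 * β) * ((p - 1) / s))) ^ 2 =
      2 * β * α ^ 2 * (1 - p) ^ 2 / s ^ 2 := by
    generalize √(2 * β) = q at h2b
    calc _ = q ^ 2 * α ^ 2 * (1 - p) ^ 2 / s ^ 2 := by ring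
      _ = _ := by rw [h2b]
  have hr : (A / G) ^ 2 * Δ = (4 * s ^ 2 * Δ) / ((1 - p) ^ 2 * G ^ 2) := by
    rw [hAeq]; field_simp; try ring
  rw [hl, hr, div_le_div_iff₀ (by positivity) (by positivity)] at hd
  have hGle : s ^ 2 * (1 + p) ≤ 2 * β * G * (1 - p) := by
    rw [h1]
    have : 0 ≤ 2 * β * G * (1 - p) := by positivity
    calc 2 * β * m * G * (1 - p) = m * (2 * β * G * (1 - p)) := by ring
      _ ≤ 1 * (2 * β * G * (1 - p)) := by gcongr
      _ = _ := one_mul _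
  have hp' : 0 < 1 + p := by linarith
  have h2 : s ^ 4 * (α ^ 2 * (1 - p ^ 2) ^ 2) ≤ s ^ 4 * (8 * β * Δ) := by
    calc s ^ 4 * (α ^ 2 * (1 - p ^ 2) ^ 2)
        = α ^ 2 * (1 - p) ^ 2 * (s ^ 2 * (1 + p)) ^ 2 := by ring
      _ ≤ α ^ 2 * (1 - p) ^ 2 * (2 * β * G * (1 - p)) ^ 2 := by gcongr
      _ = 2 * β * (2 * β * α ^ 2 * (1 - p) ^ 2 * ((1 - p) ^ 2 * G ^ 2)) := by ring
      _ ≤ 2 * β * (4 * s ^ 2 * Δ * s ^ 2) := by gcongr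
      _ = _ := by ring
  exact le_of_mul_le_mul_left h2 (by positivity)

/-- Here `p`, `r` are the slopes of `f` along the null direction and across it, and `M`, `N`, `P`
are the Hessian entries. Contact gives `α² (1 - p²)² ≤ 8 β (M P - N²)`. The curvature bound gives at
most `8 C β (1 - p²)²` for the right side, against `8 C β < α²`. -/
theorem barrier_contradiction {a b s p r α β σ m G C M N P : ℝ} (hab : a ^ 2 + b ^ 2 = 1) (hs : 0 < s)
    (hG0 : 0 < G) (hβ : 0 < β) (hC0 : 0 < C) (hαβ : 8 * C * β < α ^ 2) (hm1 : m ≤ 1)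
    (hp : p ^ 2 < 1) (hv : ∀ x y : ℝ, (x * p + y * r) ^ 2 ≤ x ^ 2 + y ^ 2)
    (k1 : s * (p + (a * a + b * b)) =
      G * (α * (σ * (-b * a + a * b)) - 2 * β * m * ((p - (a * a + b * b)) / s)))
    (k2 : ∀ x y : ℝ, G * ((α * y - 2 * β * m * ((x * p + y * r - x) / s)) ^ 2 +
        2 * β * ((x * p + y * r - x) / s) ^ 2) ≤
      (s + 2 * β * m * G / s) * (x ^ 2 * M + 2 * (x * y) * N + y ^ 2 * P))
    (hdet : M * P - N ^ 2 ≤ C * (1 - p ^ 2 - r ^ 2) ^ 2) : False := by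
  have hp1 : -1 < p ∧ p < 1 := abs_lt.1 ((sq_lt_one_iff_abs_lt_one p).1 hp)
  have k1' : s ^ 2 * (1 + p) = 2 * β * m * G * (1 - p) := by
    have h1 : a * a + b * b = 1 := by linarith
    have h2 : -b * a + a * b = 0 := by ring
    rw [h1, h2] at k1
    field_simp at k1
    linarith
  obtain ⟨A, hA⟩ : ∃ A, A = s + 2 * β * m * G / s := ⟨_, rfl⟩
  rw [← hA] at k2
  have hA' : A * (1 - p) = 2 * s := by
    rw [hA]; field_simp; linarith
  have h2b : √(2 * β) ^ 2 = 2 * β := Real.sq_sqrt (by positivity)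
  -- The barrier contributes a sum of two squares: the derivative of its exponent, and the term from
  -- the convexity of `β (1 - u/s)²`, whose weight is absorbed as `√(2 β)`.
  have hquad : ∀ x y : ℝ,
      ((-2 * β * m * ((p - 1) / s)) * x + (α - 2 * β * m * (r / s)) * y) ^ 2 +
        ((√(2 * β) * ((p - 1) / s)) * x + (√(2 * β) * (r / s)) * y) ^ 2 ≤
      (A / G * M) * x ^ 2 + 2 * (A / G * N) * (x * y) + (A / G * P) * y ^ 2 := by
    intro x y
    have k2 := k2 x y
    rw [← le_div_iff₀' hG0] at k2
    refine le_trans (le_of_eq ?_) (k2.trans (le_of_eq (by ring)))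
    generalize √(2 * β) = q at *
    trans (α * y - 2 * β * m * ((x * p + y * r - x) / s)) ^ 2 + q ^ 2 * ((x * p + y * r - x) / s) ^ 2
    · ring
    · rw [h2b]
  have hd := sq_le_det_of_le hquad
  have hd4 : α ^ 2 * (1 - p ^ 2) ^ 2 ≤ 8 * β * (M * P - N ^ 2) :=
    sq_mul_le_of_barrier_det hs hG0 hβ hp1.1 hp1.2 hm1 k1' hA' (hd.trans (le_of_eq (by ring)))
  -- Testing the slope bound on the gradient `(p, r)` itself gives `(p² + r²)² ≤ p² + r²`.
  have hr1 : 0 ≤ 1 - p ^ 2 - r ^ 2 := by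
    have := hv p r
    by_contra! h5
    nlinarith [sq_nonneg p, sq_nonneg r]
  have hfin : (1 - p ^ 2 - r ^ 2) ^ 2 ≤ (1 - p ^ 2) ^ 2 := by
    have : 1 - p ^ 2 - r ^ 2 ≤ 1 - p ^ 2 := by nlinarith [sq_nonneg r]
    gcongr
  have hp2 : 0 < (1 - p ^ 2) ^ 2 := by
    have : 0 < 1 - p ^ 2 := by linarith
    positivity
  have : 8 * β * (M * P - N ^ 2) ≤ 8 * C * β * (1 - p ^ 2) ^ 2 := by
    calc 8 * β * (M * P - N ^ 2) ≤ 8 * β * (C * (1 - p ^ 2 - r ^ 2) ^ 2) := by gcongr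
      _ ≤ 8 * β * (C * (1 - p ^ 2) ^ 2) := by gcongr
      _ = _ := by ring
  nlinarith

/-- At a local minimum the Hessian of `f` dominates the quadratic form of the barrier, so its
determinant is too large for the curvature bound. The condition `8 C β < α²` involves neither `s`
nor `ε`, which is what permits `s → 0` with the other constants fixed. -/
theorem IsConvexEntireSpacelike.not_isLocalMin_barrierGap {f : Plane → ℝ}
    (hf : IsConvexEntireSpacelike f) {C : ℝ}
    (hC : ∀ (p e e' : Plane) (a b σ : ℝ),
      a ^ 2 + b ^ 2 = 1 → σ ^ 2 = 1 → e = !₂[a, b] → e' = !₂[-σ * b, σ * a] →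
      fderiv ℝ (fderiv ℝ f) p e e * fderiv ℝ (fderiv ℝ f) p e' e' -
        fderiv ℝ (fderiv ℝ f) p e e' ^ 2 ≤
        C * (1 - fderiv ℝ f p e ^ 2 - fderiv ℝ f p e' ^ 2) ^ 2)
    {a b h s σ ε α β : ℝ} (hab : a ^ 2 + b ^ 2 = 1) (hσ : σ ^ 2 = 1) (hs : 0 < s) (hε : 0 < ε)
    (hβ : 0 < β) (hC0 : 0 < C) (hαβ : 8 * C * β < α ^ 2) {x₀ : Plane}
    (hu0 : 0 ≤ f x₀ - (a * x₀ 0 + b * x₀ 1) + h) :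
    ¬ IsLocalMin (barrierGap f a b h s σ ε α β) x₀ := by
  intro hmin
  obtain ⟨m, hm⟩ : ∃ m, m = 1 - (f x₀ - (a * x₀ 0 + b * x₀ 1) + h) / s := ⟨_, rfl⟩
  have hm1 : m ≤ 1 := by rw [hm]; linarith [div_nonneg hu0 hs.le]
  obtain ⟨G, hG⟩ : ∃ G, G = ε * Real.exp (α * (σ * (-b * x₀ 0 + a * x₀ 1)) + β * m ^ 2) := ⟨_, rfl⟩
  have hG0 : 0 < G := by rw [hG]; positivity
  have key := hf.second_order_of_isLocalMin_barrierGap hm hG hmin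
  clear hmin hm hG hu0
  obtain ⟨e, he⟩ : ∃ e : Plane, e = !₂[a, b] := ⟨_, rfl⟩
  obtain ⟨e', he'⟩ : ∃ e : Plane, e = !₂[-σ * b, σ * a] := ⟨_, rfl⟩
  have hdet := hC x₀ e e' a b σ hab hσ he he'
  have e0 : e 0 = a := by simp [he]
  have e1 : e 1 = b := by simp [he]
  have e'0 : e' 0 = -σ * b := by simp [he']
  have e'1 : e' 1 = σ * a := by simp [he']
  have hsymm : fderiv ℝ (fderiv ℝ f) x₀ e' e = fderiv ℝ (fderiv ℝ f) x₀ e e' :=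
    (hf.contDiff.contDiffAt.isSymmSndFDerivAt (by simp)).eq e' e
  have hn : ∀ x y : ℝ, ‖x • e + y • e'‖ ^ 2 = x ^ 2 + y ^ 2 := fun x y => by
    rw [Plane.norm_sq]
    simp only [PiLp.add_apply, PiLp.smul_apply, smul_eq_mul, e0, e1, e'0, e'1]
    linear_combination (x ^ 2 + y ^ 2) * hab + y ^ 2 * (a ^ 2 + b ^ 2) * hσ
  have hv : ∀ x y : ℝ, (x * fderiv ℝ f x₀ e + y * fderiv ℝ f x₀ e') ^ 2 ≤ x ^ 2 + y ^ 2 := fun x y => by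
    have h1 := hf.abs_fderiv_le x₀ (x • e + y • e')
    rw [← hn]
    refine sq_le_sq' ?_ ?_ <;>
    · rw [map_add, map_smul, map_smul, smul_eq_mul, smul_eq_mul, abs_le] at h1
      linarith [h1.1, h1.2]
  have k1 := (key e).1
  have k2 : ∀ x y : ℝ, G * ((α * y -
      2 * β * m * ((x * fderiv ℝ f x₀ e + y * fderiv ℝ f x₀ e' - x) / s)) ^ 2 +
        2 * β * ((x * fderiv ℝ f x₀ e + y * fderiv ℝ f x₀ e' - x) / s) ^ 2) ≤
      (s + 2 * β * m * G / s) * (x ^ 2 * fderiv ℝ (fderiv ℝ f) x₀ e e +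
        2 * (x * y) * fderiv ℝ (fderiv ℝ f) x₀ e e' + y ^ 2 * fderiv ℝ (fderiv ℝ f) x₀ e' e') := by
    intro x y
    have k2 := (key (x • e + y • e')).2
    simp only [map_add, map_smul, add_apply, smul_apply,
      smul_eq_mul, PiLp.add_apply, PiLp.smul_apply, e0, e1, e'0, e'1, hsymm] at k2
    have hs1 : a * (x * a + y * (-σ * b)) + b * (x * b + y * (σ * a)) = x := by
      linear_combination x * hab
    have hs2 : σ * (-b * (x * a + y * (-σ * b)) + a * (x * b + y * (σ * a))) = y := by
      linear_combination y * (a ^ 2 + b ^ 2) * hσ + y * hab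
    rw [hs1, hs2] at k2
    refine k2.trans (le_of_eq ?_)
    ring
  have hp1 : fderiv ℝ f x₀ e ^ 2 < 1 := by
    have hne : e ≠ 0 := by
      intro h0
      have := hn 1 0
      rw [h0] at this; simp at this
    have h1 := hf.fderiv_sq_lt (p := x₀) hne
    have := hn 1 0
    simp only [one_smul, zero_smul, add_zero] at this
    linarith
  rw [e0, e1] at k1
  clear key hC hsymm hn he he' e0 e1 e'0 e'1
  generalize fderiv ℝ (fderiv ℝ f) x₀ e e = M at *
  generalize fderiv ℝ (fderiv ℝ f) x₀ e e' = N at *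
  generalize fderiv ℝ (fderiv ℝ f) x₀ e' e' = P at *
  generalize fderiv ℝ f x₀ e = p at *
  generalize fderiv ℝ f x₀ e' = r at *
  exact barrier_contradiction hab hs hG0 hβ hC0 hαβ hm1 hp1 hv k1 k2 hdet

/-! ### Comparison of the surface with the barrier on a box. -/

/-- A set on which two orthonormal coordinates are bounded is bounded. -/
theorem Plane.norm_le_of_coords {a b : ℝ} (hab : a ^ 2 + b ^ 2 = 1) (x : Plane) :
    ‖x‖ ≤ |a * x 0 + b * x 1| + |-b * x 0 + a * x 1| := by
  refine abs_le_of_sq_le_sq' ?_ (by positivity) |>.2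
  rw [Plane.norm_sq]
  have h1 : x 0 ^ 2 + x 1 ^ 2 = (a * x 0 + b * x 1) ^ 2 + (-b * x 0 + a * x 1) ^ 2 := by
    linear_combination -(x 0 ^ 2 + x 1 ^ 2) * hab
  rw [h1, ← sq_abs (a * x 0 + b * x 1), ← sq_abs (-b * x 0 + a * x 1)]
  nlinarith [mul_nonneg (abs_nonneg (a * x 0 + b * x 1)) (abs_nonneg (-b * x 0 + a * x 1))]

theorem continuous_plane_apply (i : Fin 2) : Continuous (fun x : Plane => x i) :=
  (EuclideanSpace.proj i : Plane →L[ℝ] ℝ).continuous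

set_option maxHeartbeats 1000000 in
/-- Comparison with the barrier: if the graph of `f` lies above the null planes
`s v = 2 σ y - M - u / s` for arbitrarily small `s`, and has curvature bounded below, then for
bounded `y` the product `u v` is bounded below by a positive constant along a sequence `u → 0`. -/
theorem IsConvexEntireSpacelike.exists_le_mul_of_curvature {f : Plane → ℝ}
    (hf : IsConvexEntireSpacelike f) (hK : CurvatureBoundedBelow f)
    {a b h σ M : ℝ} (hab : a ^ 2 + b ^ 2 = 1) (hσ : σ ^ 2 = 1)
    (hu : ∀ x : Plane, 0 ≤ f x - (a * x 0 + b * x 1) + h)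
    (hseq : ∀ δ : ℝ, 0 < δ → ∃ s : ℝ, 0 < s ∧ s < δ ∧ ∀ x : Plane,
      2 * (σ * (-b * x 0 + a * x 1)) - M - (f x - (a * x 0 + b * x 1) + h) / s ≤
        s * (f x + (a * x 0 + b * x 1) + h)) {Y : ℝ} (hY : 0 ≤ Y) :
    ∃ c : ℝ, 0 < c ∧ ∀ δ : ℝ, 0 < δ → ∃ s : ℝ, 0 < s ∧ s < δ ∧ ∀ x : Plane,
      |-b * x 0 + a * x 1| ≤ Y → f x - (a * x 0 + b * x 1) + h = s / 2 →
        c ≤ s * (f x + (a * x 0 + b * x 1) + h) := by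
  obtain ⟨C, hC0, hC⟩ := hK.exists_det_le hf
  obtain ⟨u, hudef⟩ : ∃ u : Plane → ℝ, u = fun x => f x - (a * x 0 + b * x 1) + h := ⟨_, rfl⟩
  obtain ⟨v, hvdef⟩ : ∃ v : Plane → ℝ, v = fun x => f x + (a * x 0 + b * x 1) + h := ⟨_, rfl⟩
  obtain ⟨y, hydef⟩ : ∃ y : Plane → ℝ, y = fun x => σ * (-b * x 0 + a * x 1) := ⟨_, rfl⟩
  have hσ' : |σ| = 1 := by rw [← Real.sqrt_sq_eq_abs, hσ, Real.sqrt_one]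
  have hyabs : ∀ x : Plane, |-b * x 0 + a * x 1| = |y x| := fun x => by
    rw [hydef, abs_mul, hσ', one_mul]
  have hux : ∀ x : Plane, f x - (a * x 0 + b * x 1) + h = u x := fun x => by rw [hudef]
  have hvx : ∀ x : Plane, f x + (a * x 0 + b * x 1) + h = v x := fun x => by rw [hvdef]
  have hyx : ∀ x : Plane, σ * (-b * x 0 + a * x 1) = y x := fun x => by rw [hydef]
  have hgap : ∀ (s ε α β : ℝ) (x : Plane), barrierGap f a b h s σ ε α β x =
      s * v x - ε * Real.exp (α * y x + β * (1 - u x / s) ^ 2) := fun s ε α β x => by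
    rw [hudef, hvdef, hydef]; rfl
  have hc0 := continuous_plane_apply 0
  have hc1 := continuous_plane_apply 1
  have hcf := hf.continuous
  have huc : Continuous u := by rw [hudef]; fun_prop
  have hvc : Continuous v := by rw [hvdef]; fun_prop
  have hyc : Continuous y := by rw [hydef]; fun_prop
  have huv : ∀ x : Plane, a * x 0 + b * x 1 = (v x - u x) / 2 := fun x => by
    rw [hudef, hvdef]; ring
  simp only [hux, hvx, hyx, hyabs] at hu hseq ⊢
  clear hvx hyx hudef hvdef hydef
  obtain ⟨s₁, hs₁, -, hv₁⟩ := hseq 1 one_pos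
  -- Large enough that on the face `y = y₁`, `u ≤ s`, the null plane gives `s v ≥ 2 y₁ - M - 1 > 1`,
  -- above the barrier.
  set y₁ := Y + |M| + 2 with hy₁
  have hM := abs_nonneg M
  have hM' := le_abs_self M
  have hM'' := neg_abs_le M
  set R := y₁ + Y with hR
  have hR0 : 0 < R := by rw [hR, hy₁]; linarith
  -- These choices give `8 C β = α² / 2` and `β = 4 (R + 1) α`. At `u = s/2` the term `β / 4 = (R +
  -- 1) α` then outweighs the variation of `α y` between `-Y` and `y₁`, with `α` to spare.
  set α := 64 * C * (R + 1) with hα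
  have hα0 : 0 < α := by positivity
  set β := α ^ 2 / (16 * C) with hβ
  have hβ0 : 0 < β := by positivity
  have hαβ : 8 * C * β < α ^ 2 := by
    have : 8 * C * β = α ^ 2 / 2 := by rw [hβ]; field_simp; norm_num
    rw [this]; linarith [pow_pos hα0 2]
  have hβα : β = 4 * (R + 1) * α := by
    rw [hβ, div_eq_iff (by positivity), hα]; ring
  -- Defined by `α y₀ + β = α y₁`, so that the barrier is at most `ε k` on the face `y = y₀`.
  set y₀ := y₁ - 4 * (R + 1) with hy₀
  set k := Real.exp (α * y₁) with hk
  have hk0 : 0 < k := Real.exp_pos _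
  -- Normalizes the barrier to be at most `1` on the box.
  set ε := (Real.exp (α * y₁ + β))⁻¹ with hε
  have hε0 : 0 < ε := by positivity
  -- A single null plane, with `s₁` fixed, bounds `v` below on the box uniformly in the small
  -- parameter `s`.
  set C₁ := (2 * |y₀| + |M| + 1 / s₁) / s₁ with hC₁
  have hC₁0 : 0 < C₁ := by positivity
  have hy₀₁ : y₁ ≤ |y₀| := by
    refine le_trans ?_ (neg_le_abs y₀)
    rw [hy₀, hR, hy₁]; linarith
  have hvlow : ∀ x, u x ≤ 1 → y₀ ≤ y x → y x ≤ y₁ → -C₁ ≤ v x := by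
    intro x h1 h2 h3
    have h4 := hv₁ x
    have h5 : u x / s₁ ≤ 1 / s₁ := by gcongr
    have h6 : -|y₀| ≤ y x := (neg_abs_le y₀).trans h2
    rw [hC₁, ← neg_div, div_le_iff₀ hs₁]
    linarith
  have hexp_le : ∀ s x, 0 < s → u x ≤ s → y x ≤ y₁ →
      ε * Real.exp (α * y x + β * (1 - u x / s) ^ 2) ≤ 1 := by
    intro s x hs h1 h2
    have h3 : u x / s ≤ 1 := by rw [div_le_one hs]; exact h1
    have h4 : 0 ≤ u x / s := div_nonneg (hu x) hs.le
    have h5 : (1 - u x / s) ^ 2 ≤ 1 := by nlinarith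
    rw [hε, inv_mul_le_iff₀ (Real.exp_pos _), mul_one]
    apply Real.exp_le_exp.2
    have h6 := mul_le_mul_of_nonneg_left h2 hα0.le
    have h7 := mul_le_mul_of_nonneg_left h5 hβ0.le
    linarith
  have main : ∀ s, 0 < s → s < 1 → (∀ x, 2 * y x - M - u x / s ≤ s * v x) →
      ∀ x, u x ≤ s → y₀ ≤ y x → y x ≤ y₁ →
        -(ε * k) - s * C₁ ≤ s * v x - ε * Real.exp (α * y x + β * (1 - u x / s) ^ 2) := by
    intro s hs hs1 hsv x hx1 hx2 hx3
    by_contra! hlt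
    -- Truncating at `s v ≤ 1` makes the box compact. There is no face at `u = 0` because `u ≥ 0` on
    -- the whole surface. A minimizer with value below the claimed bound lies off every face, so it
    -- is a local minimum of the gap.
    set S : Set Plane := {x | u x ≤ s ∧ y₀ ≤ y x ∧ y x ≤ y₁ ∧ s * v x ≤ 1} with hS
    have hSclosed : IsClosed S := by
      refine (isClosed_le huc continuous_const).inter ((isClosed_le continuous_const hyc).inter
        ((isClosed_le hyc continuous_const).inter (isClosed_le (hvc.const_mul s) continuous_const)))
    have hSbdd : Bornology.IsBounded S := by
      rw [isBounded_iff_forall_norm_le]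
      refine ⟨(C₁ + 1 / s + 1) / 2 + |y₀|, fun z hz => ?_⟩
      obtain ⟨hz1, hz2, hz3, hz4⟩ := hz
      have h0 := hvlow z (hz1.trans hs1.le) hz2 hz3
      have h1 : v z ≤ 1 / s := by rw [le_div_iff₀' hs]; exact hz4
      have h3 := hu z
      have h4 : 0 < 1 / s := by positivity
      refine (Plane.norm_le_of_coords hab z).trans (add_le_add ?_ ?_)
      · rw [huv, abs_le]; constructor <;> linarith
      · rw [hyabs, abs_le]
        exact ⟨(neg_abs_le y₀).trans hz2, hz3.trans hy₀₁⟩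
    have hScomp : IsCompact S := Metric.isCompact_of_isClosed_isBounded hSclosed hSbdd
    have hcont : Continuous (barrierGap f a b h s σ ε α β) := by
      have : barrierGap f a b h s σ ε α β =
          fun x => s * v x - ε * Real.exp (α * y x + β * (1 - u x / s) ^ 2) := funext (hgap s ε α β)
      rw [this]; fun_prop
    have hneg : -(ε * k) - s * C₁ < 0 := by nlinarith [mul_pos hε0 hk0, mul_pos hs hC₁0]
    have hxS : x ∈ S := by
      refine ⟨hx1, hx2, hx3, ?_⟩
      linarith [hexp_le s x hs hx1 hx3]
    obtain ⟨z, hz, hzmin⟩ := hScomp.exists_isMinOn ⟨x, hxS⟩ hcont.continuousOn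
    have hzlt : s * v z - ε * Real.exp (α * y z + β * (1 - u z / s) ^ 2) < -(ε * k) - s * C₁ := by
      have := hzmin hxS
      simp only [mem_ofPred_eq, hgap] at this
      linarith
    obtain ⟨hz1, hz2, hz3, hz4⟩ := hz
    have hzv := hvlow z (hz1.trans hs1.le) hz2 hz3
    have hzsv : -(s * C₁) ≤ s * v z := by
      have := mul_le_mul_of_nonneg_left hzv hs.le
      linarith
    have hz1' : u z < s := by
      refine lt_of_le_of_ne hz1 fun h1 => ?_
      rw [h1, div_self hs.ne'] at hzlt
      have : Real.exp (α * y z + β * (1 - 1) ^ 2) ≤ k := by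
        apply Real.exp_le_exp.2
        have := mul_le_mul_of_nonneg_left hz3 hα0.le
        linarith
      have := mul_le_mul_of_nonneg_left this hε0.le
      linarith
    have hz2' : y₀ < y z := by
      refine lt_of_le_of_ne hz2 fun h1 => ?_
      have h3 : u z / s ≤ 1 := by rw [div_le_one hs]; exact hz1
      have h4 : 0 ≤ u z / s := div_nonneg (hu z) hs.le
      have h5 : (1 - u z / s) ^ 2 ≤ 1 := by nlinarith
      have : Real.exp (α * y z + β * (1 - u z / s) ^ 2) ≤ k := by
        apply Real.exp_le_exp.2
        rw [← h1, hy₀, hβα]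
        have : 4 * (R + 1) * α * (1 - u z / s) ^ 2 ≤ 4 * (R + 1) * α * 1 := by gcongr
        linarith
      have := mul_le_mul_of_nonneg_left this hε0.le
      linarith
    have hz3' : y z < y₁ := by
      refine lt_of_le_of_ne hz3 fun h1 => ?_
      have h3 : u z / s ≤ 1 := by rw [div_le_one hs]; exact hz1
      have h4 := hsv z
      have h5 := hexp_le s z hs hz1 hz3
      rw [h1] at h4
      linarith
    have hz4' : s * v z < 1 := by
      linarith [hexp_le s z hs hz1 hz3]
    have hnhds : S ∈ 𝓝 z := by
      filter_upwards [huc.continuousAt.eventually_lt continuousAt_const hz1',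
        continuousAt_const.eventually_lt hyc.continuousAt hz2',
        hyc.continuousAt.eventually_lt continuousAt_const hz3',
        (hvc.const_mul s).continuousAt.eventually_lt continuousAt_const hz4'] with w h1 h2 h3 h4
      exact ⟨h1.le, h2.le, h3.le, h4.le⟩
    refine hf.not_isLocalMin_barrierGap hC hab hσ hs hε0 hβ0 hC0 hαβ (x₀ := z) ?_
      (hzmin.isLocalMin hnhds)
    rw [hux]; exact hu z
  set k' := Real.exp (α * (y₁ + 1)) - k with hk'
  have hk'0 : 0 < k' := by
    rw [hk', sub_pos]; apply Real.exp_lt_exp.2; nlinarith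
  refine ⟨ε * k' / 2, by positivity, fun δ hδ => ?_⟩
  -- On the middle slice the barrier exceeds `ε k` by at least `ε k'`. Taking `s` small makes the
  -- loss `s C₁` less than half of that gain.
  obtain ⟨s, hs, hsδ, hsv⟩ := hseq (min δ (min 1 (ε * k' / (2 * C₁)))) (by positivity)
  rw [lt_min_iff, lt_min_iff] at hsδ
  refine ⟨s, hs, hsδ.1, fun x hx1 hx2 => ?_⟩
  rw [abs_le] at hx1
  have h1 := main s hs hsδ.2.1 hsv x (by linarith) (by rw [hy₀, hR, hy₁]; linarith)
    (by rw [hy₁]; linarith)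
  have h2 : u x / s = 1 / 2 := by rw [hx2]; field_simp
  have h3 : Real.exp (α * (y₁ + 1)) ≤ Real.exp (α * y x + β * (1 - u x / s) ^ 2) := by
    apply Real.exp_le_exp.2
    rw [h2, hβα]
    have h4 : α * (-Y) ≤ α * y x := by gcongr; exact hx1.1
    have h5 : α * (y₁ + 1) = α * (-Y) + 4 * (R + 1) * α * (1 - 1 / 2) ^ 2 := by rw [hR]; ring
    rw [h5]; linarith
  have h4 : s * C₁ < ε * k' / 2 := by
    have := hsδ.2.2
    rw [lt_div_iff₀ (by positivity)] at this
    linarith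
  have h5 : ε * Real.exp (α * (y₁ + 1)) = ε * k + ε * k' := by rw [hk']; ring
  have h6 := mul_le_mul_of_nonneg_left h3 hε0.le
  linarith

/-! ### The causal order. -/

/-- The closed future cone: the vectors whose product with every future null vector is `≤ 0`. -/
def futureCone : Set Mink := {w | ∀ a b : ℝ, a ^ 2 + b ^ 2 = 1 → a * w 0 + b * w 1 ≤ w 2}

theorem futureCone_zero : (0 : Mink) ∈ futureCone := fun a b _ => by simp

theorem futureCone_add {v w : Mink} (hv : v ∈ futureCone) (hw : w ∈ futureCone) :
    v + w ∈ futureCone := fun a b h => by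
  have h1 := hv a b h
  have h2 := hw a b h
  simp only [PiLp.add_apply]
  linarith

theorem futureCone_smul {w : Mink} {r : ℝ} (hr : 0 ≤ r) (hw : w ∈ futureCone) :
    r • w ∈ futureCone := fun a b h => by
  have h1 := mul_le_mul_of_nonneg_left (hw a b h) hr
  simp only [PiLp.smul_apply, smul_eq_mul]
  linarith

theorem isClosed_futureCone : IsClosed futureCone := by
  have : futureCone = ⋂ (a : ℝ) (b : ℝ) (_ : a ^ 2 + b ^ 2 = 1),
      {w : Mink | a * w 0 + b * w 1 ≤ w 2} := by
    ext w; simp [futureCone]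
  rw [this]
  have hc : ∀ i : Fin 3, Continuous (fun w : Mink => w i) := fun i =>
    (EuclideanSpace.proj i : Mink →L[ℝ] ℝ).continuous
  have h0 := hc 0
  have h1 := hc 1
  have h2 := hc 2
  exact isClosed_iInter fun a => isClosed_iInter fun b => isClosed_iInter fun _ =>
    isClosed_le (by fun_prop) h2

theorem mem_futureCone_of_sq_le {w : Mink} (h : w 0 ^ 2 + w 1 ^ 2 ≤ w 2 ^ 2) (h2 : 0 ≤ w 2) :
    w ∈ futureCone := fun a b hab => by
  refine abs_le_of_sq_le_sq' ?_ h2 |>.2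
  nlinarith [sq_nonneg (a * w 1 - b * w 0)]

theorem futureCone_time_nonneg {w : Mink} (hw : w ∈ futureCone) : 0 ≤ w 2 := by
  have h1 := hw 1 0 (by norm_num)
  have h2 := hw (-1) 0 (by norm_num)
  linarith

theorem futureCone_sq_le {w : Mink} (hw : w ∈ futureCone) : w 0 ^ 2 + w 1 ^ 2 ≤ w 2 ^ 2 := by
  by_cases h : w 0 ^ 2 + w 1 ^ 2 = 0
  · rw [h]; positivity
  have hpos : 0 < w 0 ^ 2 + w 1 ^ 2 := lt_of_le_of_ne (by positivity) (Ne.symm h)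
  obtain ⟨r, hr⟩ : ∃ r, r = √(w 0 ^ 2 + w 1 ^ 2) := ⟨_, rfl⟩
  have hr0 : 0 < r := by rw [hr]; exact Real.sqrt_pos.2 hpos
  have hr2 : r ^ 2 = w 0 ^ 2 + w 1 ^ 2 := by rw [hr]; exact Real.sq_sqrt hpos.le
  have h1 := hw (w 0 / r) (w 1 / r) (by
    rw [div_pow, div_pow, ← add_div, hr2, div_self h])
  have h2 : w 0 / r * w 0 + w 1 / r * w 1 = r := by
    field_simp; linarith
  rw [h2] at h1
  rw [← hr2]
  gcongr

theorem futureCone_minkForm_self_nonpos {w : Mink} (hw : w ∈ futureCone) : minkForm w w ≤ 0 := by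
  have := futureCone_sq_le hw
  simp only [minkForm]
  nlinarith

/-! ### Convex curves in light-cone coordinates. -/

/-- Light-cone coordinates of a family of vectors along a convex curve: `U'`, `V'`, `Y'` are the
components of a velocity whose causal future supports the curve. -/
structure ConvexNullCoords (U V Y U' V' Y' : ℝ → ℝ) (T L : ℝ) : Prop where
  pos : 0 < T
  nonneg : 0 ≤ L
  u_le : ∀ s ∈ Ico 0 T, ∀ t ∈ Ico 0 T, 0 ≤ U t - U s - (t - s) * U' s
  v_le : ∀ s ∈ Ico 0 T, ∀ t ∈ Ico 0 T, 0 ≤ V t - V s - (t - s) * V' s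
  y_sq_le : ∀ s ∈ Ico 0 T, ∀ t ∈ Ico 0 T, (Y t - Y s - (t - s) * Y' s) ^ 2 ≤
    (U t - U s - (t - s) * U' s) * (V t - V s - (t - s) * V' s)
  speed_le : ∀ t ∈ Ico 0 T, Y' t ^ 2 - U' t * V' t ≤ L ^ 2

theorem monotoneOn_of_subgradient {U U' : ℝ → ℝ} {I : Set ℝ}
    (h : ∀ s ∈ I, ∀ t ∈ I, 0 ≤ U t - U s - (t - s) * U' s) : MonotoneOn U' I := by
  intro s hs t ht hst
  rcases eq_or_lt_of_le hst with rfl | hlt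
  · exact le_rfl
  have h1 := h s hs t ht
  have h2 := h t ht s hs
  by_contra! h3
  nlinarith

/-- Cut `[p, q]` into `n + 1` equal pieces. The errors telescope to `W q - W p` and carry the factor
`(q - p) / (n + 1)`, so they vanish in the limit. -/
theorem abs_sub_le_of_almost_lipschitz {Y W : ℝ → ℝ} {p q L : ℝ} (hpq : p ≤ q)
    (h : ∀ s ∈ Icc p q, ∀ t ∈ Icc p q, s ≤ t → |Y t - Y s| ≤ (t - s) * (L + (W t - W s))) :
    |Y q - Y p| ≤ (q - p) * L := by
  have key : ∀ n : ℕ, |Y q - Y p| ≤ (q - p) * L + (q - p) * (W q - W p) / (n + 1 : ℝ) := by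
    intro n
    obtain ⟨d, hd⟩ : ∃ d, d = (q - p) / (n + 1 : ℝ) := ⟨_, rfl⟩
    have hd0 : 0 ≤ d := by rw [hd]; have := sub_nonneg.2 hpq; positivity
    have hdn : (n + 1 : ℝ) * d = q - p := by rw [hd]; field_simp
    have hmem : ∀ i : ℕ, i ≤ n + 1 → p + i * d ∈ Icc p q := fun i hi => by
      have h1 : (i : ℝ) ≤ n + 1 := by exact_mod_cast hi
      constructor
      · have : 0 ≤ (i : ℝ) * d := by positivity
        linarith
      · have := mul_le_mul_of_nonneg_right h1 hd0
        linarith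
    have hsum : Y q - Y p = ∑ i ∈ Finset.range (n + 1), (Y (p + (i + 1 : ℕ) * d) - Y (p + i * d)) := by
      rw [Finset.sum_range_sub (fun i : ℕ => Y (p + i * d))]
      push_cast
      rw [hdn]; simp
    have hsum' : W q - W p = ∑ i ∈ Finset.range (n + 1), (W (p + (i + 1 : ℕ) * d) - W (p + i * d)) := by
      rw [Finset.sum_range_sub (fun i : ℕ => W (p + i * d))]
      push_cast
      rw [hdn]; simp
    rw [hsum]
    refine (Finset.abs_sum_le_sum_abs _ _).trans ?_
    calc ∑ i ∈ Finset.range (n + 1), |Y (p + (i + 1 : ℕ) * d) - Y (p + i * d)|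
        ≤ ∑ i ∈ Finset.range (n + 1), d * (L + (W (p + (i + 1 : ℕ) * d) - W (p + i * d))) := by
          refine Finset.sum_le_sum fun i hi => ?_
          rw [Finset.mem_range] at hi
          have := h _ (hmem i hi.le) _ (hmem (i + 1) hi) (by push_cast; linarith)
          refine this.trans (le_of_eq ?_)
          push_cast; ring
      _ = (n + 1 : ℝ) * d * L + d * (W q - W p) := by
          rw [← Finset.mul_sum, Finset.sum_add_distrib, ← hsum']; simp; ring
      _ = _ := by rw [hdn, hd]; ring
  have hlim : Tendsto (fun n : ℕ => (q - p) * L + (q - p) * (W q - W p) / (n + 1 : ℝ)) atTop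
      (𝓝 ((q - p) * L + 0)) := by
    refine tendsto_const_nhds.add ?_
    have h1 : Tendsto (fun n : ℕ => ((n : ℝ) + 1)) atTop atTop :=
      tendsto_atTop_add_const_right _ _ tendsto_natCast_atTop_atTop
    exact h1.const_div_atTop _
  rw [add_zero] at hlim
  exact ge_of_tendsto' hlim key

namespace ConvexNullCoords

variable {U V Y U' V' Y' : ℝ → ℝ} {T L : ℝ} (hc : ConvexNullCoords U V Y U' V' Y' T L)

include hc

theorem monotone_u : MonotoneOn U' (Ico 0 T) := monotoneOn_of_subgradient hc.u_le

theorem monotone_v : MonotoneOn V' (Ico 0 T) := monotoneOn_of_subgradient hc.v_le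

theorem zero_mem : (0 : ℝ) ∈ Ico 0 T := ⟨le_rfl, hc.pos⟩

/-- The transverse coordinate has no subgradient inequality of its own. Its deviation from linearity
is at most the mean of those of `U` and `V`, because the supporting vector is causal. Both of these
are bounded by the increments of the monotone functions `U'` and `V'`. -/
theorem abs_y_sub_le {p q B : ℝ} (hp : p ∈ Ico 0 T) (hq : q ∈ Ico 0 T) (hpq : p ≤ q)
    (hB : ∀ t ∈ Icc p q, |Y' t| ≤ B) : |Y q - Y p| ≤ (q - p) * B := by
  have hsub : Icc p q ⊆ Ico 0 T := fun t ht => ⟨hp.1.trans ht.1, ht.2.trans_lt hq.2⟩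
  refine abs_sub_le_of_almost_lipschitz (W := fun t => (U' t + V' t) / 2) hpq ?_
  intro s hs t ht hst
  have h1 := hc.u_le s (hsub hs) t (hsub ht)
  have h2 := hc.v_le s (hsub hs) t (hsub ht)
  have h3 := hc.y_sq_le s (hsub hs) t (hsub ht)
  have h4 := hc.u_le t (hsub ht) s (hsub hs)
  have h5 := hc.v_le t (hsub ht) s (hsub hs)
  have h6 : |Y t - Y s - (t - s) * Y' s| ≤
      ((U t - U s - (t - s) * U' s) + (V t - V s - (t - s) * V' s)) / 2 := by
    refine abs_le_of_sq_le_sq ?_ (by linarith)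
    nlinarith [sq_nonneg ((U t - U s - (t - s) * U' s) - (V t - V s - (t - s) * V' s))]
  have h7 : |(t - s) * Y' s| ≤ (t - s) * B := by
    rw [abs_mul, abs_of_nonneg (sub_nonneg.2 hst)]
    exact mul_le_mul_of_nonneg_left (hB s hs) (sub_nonneg.2 hst)
  have h8 : |Y t - Y s| ≤ |Y t - Y s - (t - s) * Y' s| + |(t - s) * Y' s| := by
    have := abs_add_le (Y t - Y s - (t - s) * Y' s) ((t - s) * Y' s)
    simpa using this
  linarith

/-- If the velocities are bounded above on `[0, q]` then so are the coordinates. -/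
theorem bounded_of_velocity_le {J : Set ℝ} (hJ : J ⊆ Ico 0 T) (hJ' : ∀ q ∈ J, Icc 0 q ⊆ J) {B : ℝ}
    (hU : ∀ t ∈ J, U' t ≤ B) (hV : ∀ t ∈ J, V' t ≤ B) :
    ∃ R, ∀ t ∈ J, |U t| ≤ R ∧ |V t| ≤ R ∧ |Y t| ≤ R := by
  obtain ⟨D, hD⟩ : ∃ D, D = |B| + |U' 0| + |V' 0| := ⟨_, rfl⟩
  have hD0 : 0 ≤ D := by rw [hD]; positivity
  have a1 := le_abs_self B
  have a2 := neg_abs_le (U' 0)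
  have a3 := neg_abs_le (V' 0)
  have a4 := abs_nonneg B
  have a5 := abs_nonneg (U' 0)
  have a6 := abs_nonneg (V' 0)
  have hU2 : ∀ t ∈ J, |U' t| ≤ D := fun t ht => by
    have := hc.monotone_u hc.zero_mem (hJ ht) (hJ ht).1
    have := hU t ht
    rw [abs_le]; constructor <;> linarith
  have hV2 : ∀ t ∈ J, |V' t| ≤ D := fun t ht => by
    have := hc.monotone_v hc.zero_mem (hJ ht) (hJ ht).1
    have := hV t ht
    rw [abs_le]; constructor <;> linarith
  have hY2 : ∀ t ∈ J, |Y' t| ≤ L + D := fun t ht => by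
    have h1 := hc.speed_le t (hJ ht)
    have h2 : U' t * V' t ≤ D * D := by
      calc U' t * V' t ≤ |U' t * V' t| := le_abs_self _
        _ = |U' t| * |V' t| := abs_mul _ _
        _ ≤ _ := mul_le_mul (hU2 t ht) (hV2 t ht) (abs_nonneg _) hD0
    refine abs_le_of_sq_le_sq ?_ (by linarith [hc.nonneg])
    nlinarith [mul_nonneg hc.nonneg hD0]
  have hT := hc.pos
  have hLip : ∀ (F F' : ℝ → ℝ), (∀ s ∈ Ico 0 T, ∀ t ∈ Ico 0 T, 0 ≤ F t - F s - (t - s) * F' s) →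
      (∀ t ∈ J, |F' t| ≤ D) → ∀ t ∈ J, |F t| ≤ |F 0| + T * D := by
    intro F F' h1 h2 t ht
    have h3 := h1 0 hc.zero_mem t (hJ ht)
    have h4 := h1 t (hJ ht) 0 hc.zero_mem
    have h5 := h2 t ht
    have h6 := h2 0 (hJ' t ht ⟨le_rfl, (hJ ht).1⟩)
    have h7 := (hJ ht).2
    have h8 := (hJ ht).1
    have h9 : |t * F' t| ≤ T * D := by
      rw [abs_mul, abs_of_nonneg h8]; exact mul_le_mul h7.le h5 (abs_nonneg _) hT.le
    have h10 : |t * F' 0| ≤ T * D := by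
      rw [abs_mul, abs_of_nonneg h8]; exact mul_le_mul h7.le h6 (abs_nonneg _) hT.le
    rw [abs_le] at h9 h10 ⊢
    have h11 := le_abs_self (F 0)
    have h12 := neg_abs_le (F 0)
    constructor <;> linarith
  refine ⟨|U 0| + |V 0| + |Y 0| + T * D + T * (L + D), fun t ht => ?_⟩
  have b1 := abs_nonneg (U 0)
  have b2 := abs_nonneg (V 0)
  have b3 := abs_nonneg (Y 0)
  have b4 : 0 ≤ T * D := by positivity
  have b5 : 0 ≤ T * (L + D) := mul_nonneg hT.le (by linarith [hc.nonneg])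
  refine ⟨?_, ?_, ?_⟩
  · have := hLip U U' hc.u_le hU2 t ht; linarith
  · have := hLip V V' hc.v_le hV2 t ht; linarith
  · have h1 := hc.abs_y_sub_le hc.zero_mem (hJ ht) (hJ ht).1 (fun s hs => hY2 s (hJ' t ht hs))
    have h2 : (t - 0) * (L + D) ≤ T * (L + D) :=
      mul_le_mul_of_nonneg_right (by linarith [(hJ ht).2]) (by linarith [hc.nonneg])
    have h3 := abs_sub_abs_le_abs_sub (Y t) (Y 0)
    linarith

/-- Along an unbounded curve on which `u` is nonincreasing, `v` tends to infinity while `y` stays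
bounded. -/
theorem unbounded_v (hU : ∀ t ∈ Ico 0 T, U' t ≤ 0)
    (hub : ¬ ∃ R, ∀ t ∈ Ico 0 T, |U t| ≤ R ∧ |V t| ≤ R ∧ |Y t| ≤ R) :
    ∃ t₁ ∈ Ico 0 T, (∀ t ∈ Ico t₁ T, 0 ≤ V' t) ∧ (∃ R, ∀ t ∈ Ico 0 T, |Y t| ≤ R) ∧
      ∀ B : ℝ, ∃ t₂ ∈ Ico t₁ T, ∀ t ∈ Ico t₂ T, B ≤ V t := by
  -- If `V'` stayed negative, both velocities would be bounded above and the curve would be bounded.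
  obtain ⟨t₁, ht₁, hV₁⟩ : ∃ t₁ ∈ Ico 0 T, 0 ≤ V' t₁ := by
    by_contra! h
    exact hub (hc.bounded_of_velocity_le subset_rfl
      (fun q hq t ht => ⟨ht.1, ht.2.trans_lt hq.2⟩) hU (fun t ht => (h t ht).le))
  have hV : ∀ t ∈ Ico t₁ T, 0 ≤ V' t := fun t ht =>
    hV₁.trans (hc.monotone_v ht₁ ⟨ht₁.1.trans ht.1, ht.2⟩ ht.1)
  have hsub : Icc 0 t₁ ⊆ Ico 0 T := fun t ht => ⟨ht.1, ht.2.trans_lt ht₁.2⟩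
  obtain ⟨R, hR⟩ := hc.bounded_of_velocity_le (J := Icc 0 t₁) (B := |V' t₁|) hsub
    (fun q hq t ht => ⟨ht.1, ht.2.trans hq.2⟩)
    (fun t ht => (hU t (hsub ht)).trans (abs_nonneg _))
    (fun t ht => (hc.monotone_v (hsub ht) ht₁ ht.2).trans (le_abs_self _))
  have ht₁' : t₁ ∈ Icc 0 t₁ := ⟨ht₁.1, le_rfl⟩
  -- Once `U' ≤ 0 ≤ V'`, the speed bound `Y'² ≤ L² + U' V'` no longer sees the null components.
  have hY' : ∀ t ∈ Ico t₁ T, |Y' t| ≤ L := fun t ht => by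
    have ht' : t ∈ Ico 0 T := ⟨ht₁.1.trans ht.1, ht.2⟩
    refine abs_le_of_sq_le_sq ?_ hc.nonneg
    have := hc.speed_le t ht'
    nlinarith [mul_nonneg (neg_nonneg.2 (hU t ht')) (hV t ht)]
  have hY : ∀ t ∈ Ico 0 T, |Y t| ≤ R + T * L := fun t ht => by
    have hTL : 0 ≤ T * L := mul_nonneg hc.pos.le hc.nonneg
    rcases le_total t t₁ with h | h
    · linarith [(hR t ⟨ht.1, h⟩).2.2]
    · have h1 := hc.abs_y_sub_le ht₁ ht h (fun s hs => hY' s ⟨hs.1, hs.2.trans_lt ht.2⟩)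
      have h2 : (t - t₁) * L ≤ T * L :=
        mul_le_mul_of_nonneg_right (by linarith [ht.2, ht₁.1]) hc.nonneg
      have h3 := abs_sub_abs_le_abs_sub (Y t) (Y t₁)
      linarith [(hR t₁ ht₁').2.2]
  refine ⟨t₁, ht₁, hV, ⟨_, hY⟩, fun B => ?_⟩
  have hmono : ∀ s ∈ Ico t₁ T, ∀ t ∈ Ico t₁ T, s ≤ t → V s ≤ V t := fun s hs t ht hst => by
    have h1 := hc.v_le s ⟨ht₁.1.trans hs.1, hs.2⟩ t ⟨ht₁.1.trans ht.1, ht.2⟩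
    nlinarith [mul_nonneg (sub_nonneg.2 hst) (hV s hs)]
  by_contra! hB
  have hVB : ∀ t ∈ Ico t₁ T, V t ≤ B := fun t ht => by
    obtain ⟨s, hs, hsB⟩ := hB t ht
    exact (hmono t ht s ⟨ht.1.trans hs.1, hs.2⟩ hs.1).trans hsB.le
  refine hub ⟨|B| + R + T * L + |U 0| + T * |U' 0|, fun t ht => ?_⟩
  have c0 := abs_nonneg B
  have c1 := abs_nonneg (U 0)
  have c2 : 0 ≤ T * |U' 0| := mul_nonneg hc.pos.le (abs_nonneg _)
  have c3 : 0 ≤ R := (abs_nonneg _).trans (hR t₁ ht₁').1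
  have c4 : 0 ≤ T * L := mul_nonneg hc.pos.le hc.nonneg
  refine ⟨?_, ?_, ?_⟩
  · have h1 := hc.u_le 0 hc.zero_mem t ht
    have h2 := hc.u_le t ht 0 hc.zero_mem
    have h3 := hU t ht
    have h4 : -(T * |U' 0|) ≤ t * U' 0 := by
      have h5 : |t * U' 0| ≤ T * |U' 0| := by
        rw [abs_mul, abs_of_nonneg ht.1]; exact mul_le_mul_of_nonneg_right ht.2.le (abs_nonneg _)
      exact (abs_le.1 h5).1
    have h5 := le_abs_self (U 0)
    have h6 := neg_abs_le (U 0)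
    have h7 : t * U' t ≤ 0 := mul_nonpos_of_nonneg_of_nonpos ht.1 h3
    rw [abs_le]; constructor <;> linarith
  · rcases le_total t t₁ with h | h
    · linarith [(hR t ⟨ht.1, h⟩).2.1]
    · have h1 := hVB t ⟨h, ht.2⟩
      have h2 := hmono t₁ ⟨le_rfl, ht₁.2⟩ t ⟨h, ht.2⟩ h
      have h3 := (abs_le.1 (hR t₁ ht₁').2.1).1
      have h4 := le_abs_self B
      rw [abs_le]; constructor <;> linarith
  · linarith [hY t ht]

/-- Along a curve on which `u` decreases to `0`, the product `u v` tends to `0`. -/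
theorem mul_lt_of_tendsto_zero (hU0 : ∀ t ∈ Ico 0 T, 0 ≤ U t) (hlim : Tendsto U (𝓝[<] T) (𝓝 0))
    {t₁ : ℝ} (ht₁ : t₁ ∈ Ico 0 T) (hV : ∀ t ∈ Ico t₁ T, 0 ≤ V' t) {c : ℝ} (hc0 : 0 < c) :
    ∃ t₂ ∈ Ico t₁ T, ∀ t ∈ Ico t₂ T, U t * V t < c := by
  -- The tangent line at `t` lies below `U`, and `U → 0` at time `T`.
  have hlast : ∀ t ∈ Ico 0 T, U t + (T - t) * U' t ≤ 0 := fun t ht => by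
    have h1 : Tendsto (fun s => U t + (s - t) * U' t) (𝓝[<] T) (𝓝 (U t + (T - t) * U' t)) := by
      have : Continuous (fun s : ℝ => U t + (s - t) * U' t) := by fun_prop
      exact this.continuousAt.tendsto.mono_left nhdsWithin_le_nhds
    refine le_of_tendsto_of_tendsto h1 hlim ?_
    have : Ioo t T ∈ 𝓝[<] T := Ioo_mem_nhdsLT ht.2
    filter_upwards [this] with s hs
    have := hc.u_le t ht s ⟨ht.1.trans hs.1.le, hs.2⟩
    linarith
  -- Convexity of `V` replaces `V t` by `V t₁ + (t - t₁) V' t`, and `U V' ≤ (T - t) (-U' V') ≤ (T -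
  -- t) L²`.
  have hbound : ∀ t ∈ Ico t₁ T, U t * V t ≤ U t * V t₁ + T * L ^ 2 * (T - t) := fun t ht => by
    have ht' : t ∈ Ico 0 T := ⟨ht₁.1.trans ht.1, ht.2⟩
    have h1 := hc.v_le t ht' t₁ ht₁
    have h2 := hU0 t ht'
    have h3 := hlast t ht'
    have h4 := hV t ht
    have h5 := hc.speed_le t ht'
    have h6 : U t * V t ≤ U t * (V t₁ + (t - t₁) * V' t) :=
      mul_le_mul_of_nonneg_left (by linarith) h2
    have h7 : U t * V' t ≤ (T - t) * L ^ 2 := by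
      calc U t * V' t ≤ (-((T - t) * U' t)) * V' t := mul_le_mul_of_nonneg_right (by linarith) h4
        _ = (T - t) * (-(U' t * V' t)) := by ring
        _ ≤ (T - t) * L ^ 2 :=
          mul_le_mul_of_nonneg_left (by nlinarith [sq_nonneg (Y' t)]) (by linarith [ht.2])
    have h8 : (t - t₁) * (U t * V' t) ≤ T * ((T - t) * L ^ 2) := by
      have h9 : 0 ≤ (T - t) * L ^ 2 := mul_nonneg (by linarith [ht.2]) (sq_nonneg _)
      calc (t - t₁) * (U t * V' t) ≤ (t - t₁) * ((T - t) * L ^ 2) :=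
            mul_le_mul_of_nonneg_left h7 (by linarith [ht.1])
        _ ≤ _ := mul_le_mul_of_nonneg_right (by linarith [ht.2, ht₁.1]) h9
    linarith
  have hlim2 : Tendsto (fun t => U t * V t₁ + T * L ^ 2 * (T - t)) (𝓝[<] T) (𝓝 0) := by
    have h1 : Tendsto (fun t => T * L ^ 2 * (T - t)) (𝓝[<] T) (𝓝 (T * L ^ 2 * (T - T))) := by
      have : Continuous (fun t : ℝ => T * L ^ 2 * (T - t)) := by fun_prop
      exact this.continuousAt.tendsto.mono_left nhdsWithin_le_nhds
    simpa using (hlim.mul_const (V t₁)).add h1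
  obtain ⟨t₂, ht₂, h⟩ := mem_nhdsLT_iff_exists_Ico_subset.1
    (inter_mem (Ico_mem_nhdsLT ht₁.2) (hlim2.eventually_lt_const hc0))
  refine ⟨max t₁ t₂, ⟨le_max_left _ _, max_lt ht₁.2 ht₂⟩, fun t ht => ?_⟩
  have := h ⟨(le_max_right _ _).trans ht.1, ht.2⟩
  exact (hbound t this.1).trans_lt this.2

end ConvexNullCoords

/-! ### Convex rays and their asymptotic null planes. -/

/-- A curve `c` over `[0, T)` that leaves every compact set and is supported from below, in the causal
order, by its velocities `b`, whose Minkowski norms are bounded by `L`. -/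
structure IsConvexRay (f : Plane → ℝ) (c : ℝ → Plane) (b : ℝ → Mink) (T L : ℝ) : Prop where
  pos : 0 < T
  nonneg : 0 ≤ L
  support : ∀ s ∈ Ico 0 T, ∀ t ∈ Ico 0 T,
    graphMap f (c t) - graphMap f (c s) - (t - s) • b s ∈ futureCone
  speed_nonneg : ∀ t ∈ Ico 0 T, 0 ≤ minkForm (b t) (b t)
  speed_le : ∀ t ∈ Ico 0 T, minkForm (b t) (b t) ≤ L ^ 2
  unbounded : ¬ ∃ R, ∀ t ∈ Ico 0 T, ‖c t‖ ≤ R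

theorem minkForm_eq_null_coords {p q : ℝ} (hpq : p ^ 2 + q ^ 2 = 1) (w : Mink) :
    minkForm w w = (-q * w 0 + p * w 1) ^ 2 -
      (w 2 - (p * w 0 + q * w 1)) * (w 2 + (p * w 0 + q * w 1)) := by
  simp only [minkForm]
  linear_combination (-(w 0) ^ 2 - w 1 ^ 2) * hpq

theorem minkForm_sub_nonneg {f : Plane → ℝ} (hf : IsConvexEntireSpacelike f) (x y : Plane) :
    0 ≤ minkForm (graphMap f x - graphMap f y) (graphMap f x - graphMap f y) := by
  have h1 := hf.abs_sub_le y x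
  have h2 : (f x - f y) ^ 2 ≤ ‖x - y‖ ^ 2 := sq_le_sq' (by linarith [(abs_le.1 h1).1]) (abs_le.1 h1).2
  rw [Plane.norm_sq] at h2
  simp only [minkForm, graphMap, PiLp.sub_apply] at h2 ⊢
  simp
  nlinarith

namespace IsConvexRay

variable {f : Plane → ℝ} {c : ℝ → Plane} {b : ℝ → Mink} {T L : ℝ} (hr : IsConvexRay f c b T L)

include hr

theorem nullCoords {p q : ℝ} (hpq : p ^ 2 + q ^ 2 = 1) (h : ℝ) :
    ConvexNullCoords (fun t => f (c t) - (p * c t 0 + q * c t 1) + h)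
      (fun t => f (c t) + (p * c t 0 + q * c t 1) + h) (fun t => -q * c t 0 + p * c t 1)
      (fun t => b t 2 - (p * b t 0 + q * b t 1)) (fun t => b t 2 + (p * b t 0 + q * b t 1))
      (fun t => -q * b t 0 + p * b t 1) T L where
  pos := hr.pos
  nonneg := hr.nonneg
  u_le s hs t ht := by
    have := hr.support s hs t ht p q hpq
    simp [graphMap] at this
    linarith
  v_le s hs t ht := by
    have := hr.support s hs t ht (-p) (-q) (by simpa using hpq)
    simp [graphMap] at this
    linarith
  y_sq_le s hs t ht := by
    have h1 := futureCone_minkForm_self_nonpos (hr.support s hs t ht)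
    rw [minkForm_eq_null_coords hpq] at h1
    simp [graphMap] at h1
    linarith
  speed_le t ht := by
    have := hr.speed_le t ht
    rw [minkForm_eq_null_coords hpq] at this
    exact this

theorem not_bounded {p q : ℝ} (hpq : p ^ 2 + q ^ 2 = 1) (h : ℝ) :
    ¬ ∃ R, ∀ t ∈ Ico 0 T, |f (c t) - (p * c t 0 + q * c t 1) + h| ≤ R ∧
      |f (c t) + (p * c t 0 + q * c t 1) + h| ≤ R ∧ |-q * c t 0 + p * c t 1| ≤ R := by
  rintro ⟨R, hR⟩
  refine hr.unbounded ⟨R + R, fun t ht => (Plane.norm_le_of_coords hpq _).trans ?_⟩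
  obtain ⟨h1, h2, h3⟩ := hR t ht
  rw [abs_le] at h1 h2
  refine add_le_add ?_ h3
  rw [abs_le]; constructor <;> linarith

/-- Along a ray the velocity turns towards a null direction `(p, q, 1)`, in which `u` decreases. -/
theorem exists_null_direction : ∃ p q : ℝ, p ^ 2 + q ^ 2 = 1 ∧
    ∀ t ∈ Ico 0 T, b t 2 - (p * b t 0 + q * b t 1) ≤ 0 := by
  have hc := hr.nullCoords (p := 1) (q := 0) (by norm_num) 0
  -- The two null components of the velocity are nondecreasing and add up to twice its time
  -- component. If the latter were bounded above, so would both be, and the ray would be bounded.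
  have hz : ∀ n : ℕ, ∃ t ∈ Ico 0 T, (n + 1 : ℝ) ≤ b t 2 := by
    by_contra! hn
    obtain ⟨n, hn⟩ := hn
    refine hr.not_bounded (p := 1) (q := 0) (by norm_num) 0 (hc.bounded_of_velocity_le
      (B := 2 * (n + 1) + |b 0 2 - (1 * b 0 0 + 0 * b 0 1)| + |b 0 2 + (1 * b 0 0 + 0 * b 0 1)|)
      subset_rfl (fun q hq t ht => ⟨ht.1, ht.2.trans_lt hq.2⟩) ?_ ?_)
    · intro t ht
      have h1 := hc.monotone_v hc.zero_mem ht ht.1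
      have h2 := hn t ht
      have h3 := neg_abs_le (b 0 2 + (1 * b 0 0 + 0 * b 0 1))
      have h4 := abs_nonneg (b 0 2 - (1 * b 0 0 + 0 * b 0 1))
      simp only at h1 ⊢
      linarith
    · intro t ht
      have h1 := hc.monotone_u hc.zero_mem ht ht.1
      have h2 := hn t ht
      have h3 := neg_abs_le (b 0 2 - (1 * b 0 0 + 0 * b 0 1))
      have h4 := abs_nonneg (b 0 2 + (1 * b 0 0 + 0 * b 0 1))
      simp only at h1 ⊢
      linarith
  choose τ hτ hτz using hz
  have hnull : ∀ n, b (τ n) 2 ^ 2 ≤ b (τ n) 0 ^ 2 + b (τ n) 1 ^ 2 := fun n => by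
    have := hr.speed_nonneg _ (hτ n)
    simp only [minkForm] at this
    nlinarith
  have hzpos : ∀ n, (0:ℝ) < b (τ n) 2 := fun n => lt_of_lt_of_le (by positivity) (hτz n)
  have hrpos : ∀ n, 0 < b (τ n) 0 ^ 2 + b (τ n) 1 ^ 2 := fun n =>
    lt_of_lt_of_le (pow_pos (hzpos n) 2) (hnull n)
  obtain ⟨r, hrdef⟩ : ∃ r : ℕ → ℝ, r = fun n => √(b (τ n) 0 ^ 2 + b (τ n) 1 ^ 2) := ⟨_, rfl⟩
  have hr0 : ∀ n, 0 < r n := fun n => by rw [hrdef]; exact Real.sqrt_pos.2 (hrpos n)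
  have hr2 : ∀ n, r n ^ 2 = b (τ n) 0 ^ 2 + b (τ n) 1 ^ 2 := fun n => by
    rw [hrdef]; exact Real.sq_sqrt (hrpos n).le
  let e : ℕ → ℝ × ℝ := fun n => (b (τ n) 0 / r n, b (τ n) 1 / r n)
  have he1 : ∀ n, (e n).1 ^ 2 + (e n).2 ^ 2 = 1 := fun n => by
    simp only [e, div_pow]
    rw [← add_div, hr2, div_self (hrpos n).ne']
  have hK : IsCompact (Icc (-1 : ℝ) 1 ×ˢ Icc (-1 : ℝ) 1) := isCompact_Icc.prod isCompact_Icc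
  obtain ⟨⟨p, q⟩, -, φ, hφ, hlim⟩ := hK.tendsto_subseq (x := e) (fun n => by
    have := he1 n
    refine ⟨abs_le.1 ((sq_le_one_iff_abs_le_one _).1 (by nlinarith [sq_nonneg (e n).2])),
      abs_le.1 ((sq_le_one_iff_abs_le_one _).1 (by nlinarith [sq_nonneg (e n).1]))⟩)
  have hlim1 : Tendsto (fun n => (e (φ n)).1) atTop (𝓝 p) := (continuous_fst.tendsto _).comp hlim
  have hlim2 : Tendsto (fun n => (e (φ n)).2) atTop (𝓝 q) := (continuous_snd.tendsto _).comp hlim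
  -- The Minkowski norms are bounded while the time components tend to infinity, so the rescaled
  -- velocities become null.
  have hratio : Tendsto (fun n => b (τ n) 2 / r n) atTop (𝓝 1) := by
    have hle : ∀ n, |b (τ n) 2 / r n - 1| ≤ L ^ 2 / (n + 1 : ℝ) := fun n => by
      have h1 : b (τ n) 2 ≤ r n := by
        refine abs_le_of_sq_le_sq' ?_ (hr0 n).le |>.2
        rw [hr2]; exact hnull n
      have h2 := hr.speed_le _ (hτ n)
      have h3 : r n ^ 2 - b (τ n) 2 ^ 2 ≤ L ^ 2 := by
        rw [hr2]; simp only [minkForm] at h2; nlinarith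
      have h4 := hτz n
      have h5 : (1 : ℝ) ≤ n + 1 := by linarith [Nat.cast_nonneg (α := ℝ) n]
      have h6 : (r n - b (τ n) 2) * (n + 1 : ℝ) ≤ L ^ 2 := by
        calc (r n - b (τ n) 2) * (n + 1 : ℝ) ≤ (r n - b (τ n) 2) * (r n + b (τ n) 2) :=
              mul_le_mul_of_nonneg_left (by linarith [hzpos n]) (by linarith)
          _ = r n ^ 2 - b (τ n) 2 ^ 2 := by ring
          _ ≤ _ := h3
      have h7 : b (τ n) 2 / r n - 1 = -((r n - b (τ n) 2) / r n) := by
        field_simp [(hr0 n).ne']; ring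
      rw [h7, abs_neg, abs_of_nonneg (div_nonneg (by linarith) (hr0 n).le)]
      have h8 : (r n - b (τ n) 2) / r n ≤ r n - b (τ n) 2 :=
        div_le_self (by linarith) (by linarith)
      refine h8.trans ?_
      rw [le_div_iff₀ (by linarith)]
      exact h6
    have h0 : Tendsto (fun n : ℕ => L ^ 2 / (n + 1 : ℝ)) atTop (𝓝 0) :=
      (tendsto_atTop_add_const_right _ _ tendsto_natCast_atTop_atTop).const_div_atTop _
    have h1 : Tendsto (fun n => b (τ n) 2 / r n - 1) atTop (𝓝 0) :=
      squeeze_zero_norm hle h0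
    simpa using h1.add_const 1
  refine ⟨p, q, ?_, fun t ht => ?_⟩
  · have h1 := (hlim1.pow 2).add (hlim2.pow 2)
    refine tendsto_nhds_unique h1 ?_
    simp only [he1]
    exact tendsto_const_nhds
  · have hpos : ∀ n, 0 ≤ b t 0 * (e n).1 + b t 1 * (e n).2 - b t 2 * (b (τ n) 2 / r n) := fun n => by
      -- Adding the support inequalities at the two times shows that the difference of the
      -- velocities is causal. Hence twice their product is at least the sum of their squares, which
      -- is nonnegative.
      have key : 0 ≤ minkForm (b t) (b (τ n)) := by
        rcases eq_or_ne t (τ n) with h | h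
        · rw [← h]; exact hr.speed_nonneg t ht
        wlog hlt : t < τ n with H
        · have hlt' : τ n < t := lt_of_le_of_ne (not_lt.1 hlt) h.symm
          have h1 := futureCone_add (hr.support t ht _ (hτ n)) (hr.support _ (hτ n) t ht)
          have h2 : graphMap f (c (τ n)) - graphMap f (c t) - (τ n - t) • b t +
              (graphMap f (c t) - graphMap f (c (τ n)) - (t - τ n) • b (τ n)) =
              (t - τ n) • (b t - b (τ n)) := by module
          rw [h2] at h1
          have h3 := futureCone_smul (inv_nonneg.2 (sub_pos.2 hlt').le) h1
          rw [smul_smul, inv_mul_cancel₀ (sub_pos.2 hlt').ne', one_smul] at h3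
          have h4 := futureCone_minkForm_self_nonpos h3
          have h5 := hr.speed_nonneg t ht
          have h6 := hr.speed_nonneg _ (hτ n)
          simp only [minkForm, PiLp.sub_apply] at *
          nlinarith
        · have h1 := futureCone_add (hr.support t ht _ (hτ n)) (hr.support _ (hτ n) t ht)
          have h2 : graphMap f (c (τ n)) - graphMap f (c t) - (τ n - t) • b t +
              (graphMap f (c t) - graphMap f (c (τ n)) - (t - τ n) • b (τ n)) =
              (τ n - t) • (b (τ n) - b t) := by module
          rw [h2] at h1
          have h3 := futureCone_smul (inv_nonneg.2 (sub_pos.2 hlt).le) h1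
          rw [smul_smul, inv_mul_cancel₀ (sub_pos.2 hlt).ne', one_smul] at h3
          have h4 := futureCone_minkForm_self_nonpos h3
          have h5 := hr.speed_nonneg t ht
          have h6 := hr.speed_nonneg _ (hτ n)
          simp only [minkForm, PiLp.sub_apply] at *
          nlinarith
      have : b t 0 * (e n).1 + b t 1 * (e n).2 - b t 2 * (b (τ n) 2 / r n) =
          minkForm (b t) (b (τ n)) / r n := by
        simp only [e, minkForm]; ring
      rw [this]
      exact div_nonneg key (hr0 n).le
    have hl := ((hlim1.const_mul (b t 0)).add (hlim2.const_mul (b t 1))).sub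
      ((hratio.comp hφ.tendsto_atTop).const_mul (b t 2))
    have := ge_of_tendsto' hl (fun n => hpos (φ n))
    linarith

end IsConvexRay

/-- A ray is asymptotic to a null support plane. -/
theorem IsConvexRay.exists_asymptotic {f : Plane → ℝ} {c : ℝ → Plane} {b : ℝ → Mink} {T L : ℝ}
    (hr : IsConvexRay f c b T L) (hf : IsConvexEntireSpacelike f) :
    ∃ p q h : ℝ, p ^ 2 + q ^ 2 = 1 ∧ (∀ x : Plane, 0 ≤ f x - (p * x 0 + q * x 1) + h) ∧
      Tendsto (fun t => f (c t) - (p * c t 0 + q * c t 1) + h) (𝓝[<] T) (𝓝 0) := by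
  obtain ⟨p, q, hpq, hle⟩ := hr.exists_null_direction
  have hc := hr.nullCoords hpq 0
  obtain ⟨t₁, ht₁, hV', ⟨R, hR⟩, hV⟩ := hc.unbounded_v hle (hr.not_bounded hpq 0)
  obtain ⟨U, hU⟩ : ∃ U : ℝ → ℝ, U = fun t => f (c t) - (p * c t 0 + q * c t 1) + 0 := ⟨_, rfl⟩
  rw [← hU] at hc
  have hanti : ∀ s ∈ Ico 0 T, ∀ t ∈ Ico 0 T, s ≤ t → U t ≤ U s := fun s hs t ht hst => by
    have h1 := hc.u_le t ht s hs
    have h2 := mul_nonneg (sub_nonneg.2 hst) (neg_nonneg.2 (hle t ht))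
    linarith
  have hbdd : BddBelow (U '' Ico 0 T) := by
    refine ⟨U 0 + T * (b 0 2 - (p * b 0 0 + q * b 0 1)), ?_⟩
    rintro _ ⟨t, ht, rfl⟩
    have h1 := hc.u_le 0 hc.zero_mem t ht
    have h2 := mul_nonneg (sub_nonneg.2 ht.2.le) (neg_nonneg.2 (hle 0 hc.zero_mem))
    linarith
  obtain ⟨ℓ, hℓ⟩ : ∃ ℓ, ℓ = sInf (U '' Ico 0 T) := ⟨_, rfl⟩
  have hℓle : ∀ t ∈ Ico 0 T, ℓ ≤ U t := fun t ht => by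
    rw [hℓ]; exact csInf_le hbdd ⟨t, ht, rfl⟩
  have hUx : ∀ t, f (c t) - (p * c t 0 + q * c t 1) = U t := fun t => by rw [hU]; simp
  refine ⟨p, q, -ℓ, hpq, fun x => ?_, ?_⟩
  · by_contra! hx
    obtain ⟨δ, hδ⟩ : ∃ δ, δ = ℓ - (f x - (p * x 0 + q * x 1)) := ⟨_, rfl⟩
    have hδ0 : 0 < δ := by linarith
    obtain ⟨S, hS⟩ : ∃ S, S = R + |-q * x 0 + p * x 1| := ⟨_, rfl⟩
    -- If `x` lay below the limiting plane by `δ`, the chord from `x` to the ray would have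
    -- `u`-component at least `δ`, bounded transverse component `≤ S`, and `v`-component at least
    -- `(S² + 1) / δ` at this time. It would be timelike, which is impossible between points of the
    -- graph.
    obtain ⟨t₂, ht₂, hB⟩ := hV (f x + (p * x 0 + q * x 1) + (S ^ 2 + 1) / δ)
    have h1 := hB t₂ ⟨le_rfl, ht₂.2⟩
    have ht₂' : t₂ ∈ Ico 0 T := ⟨ht₁.1.trans ht₂.1, ht₂.2⟩
    have h2 := minkForm_sub_nonneg hf (c t₂) x
    rw [minkForm_eq_null_coords hpq] at h2
    have h3 : |(-q * c t₂ 0 + p * c t₂ 1) - (-q * x 0 + p * x 1)| ≤ S := by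
      rw [hS]
      exact (abs_sub _ _).trans (add_le_add (hR t₂ ht₂') le_rfl)
    have h4 : ((-q * c t₂ 0 + p * c t₂ 1) - (-q * x 0 + p * x 1)) ^ 2 ≤ S ^ 2 := by
      rw [← sq_abs]; exact pow_le_pow_left₀ (abs_nonneg _) h3 2
    have h5 := hℓle t₂ ht₂'
    rw [← hUx] at h5
    have h6 : δ ≤ (f (c t₂) - f x) - (p * (c t₂ 0 - x 0) + q * (c t₂ 1 - x 1)) := by
      rw [hδ]; linarith
    have h7 : (S ^ 2 + 1) / δ ≤ (f (c t₂) - f x) + (p * (c t₂ 0 - x 0) + q * (c t₂ 1 - x 1)) := by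
      linarith
    have h8 : S ^ 2 + 1 ≤ ((f (c t₂) - f x) - (p * (c t₂ 0 - x 0) + q * (c t₂ 1 - x 1))) *
        ((f (c t₂) - f x) + (p * (c t₂ 0 - x 0) + q * (c t₂ 1 - x 1))) := by
      calc S ^ 2 + 1 = δ * ((S ^ 2 + 1) / δ) := by field_simp
        _ ≤ _ := mul_le_mul h6 h7 (by positivity) (by linarith)
    simp [graphMap] at h2
    have h9 : (-(q * (c t₂ 0 - x 0)) + p * (c t₂ 1 - x 1)) =
      ((-q * c t₂ 0 + p * c t₂ 1) - (-q * x 0 + p * x 1)) := by ring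
    rw [h9] at h2
    linarith
  · simp only [hUx]
    rw [Metric.tendsto_nhds]
    intro ε hε
    obtain ⟨_, ⟨t, ht, rfl⟩, htε⟩ := exists_lt_of_csInf_lt
      ((nonempty_of_mem hc.zero_mem).image U) (show sInf (U '' Ico 0 T) < ℓ + ε by linarith)
    filter_upwards [Ico_mem_nhdsLT ht.2] with s hs
    have hs' : s ∈ Ico 0 T := ⟨ht.1.trans hs.1, hs.2⟩
    have h1 := hanti t ht s hs' hs.1
    have h2 := hℓle s hs'
    rw [Real.dist_eq, abs_lt]; constructor <;> linarith

/-- There is no ray asymptotic to a null support plane that the surface approaches fast enough, if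
the curvature is bounded below. -/
theorem IsConvexRay.false_of_null_planes {f : Plane → ℝ} {c : ℝ → Plane} {b : ℝ → Mink} {T L : ℝ}
    (hr : IsConvexRay f c b T L) (hf : IsConvexEntireSpacelike f) (hK : CurvatureBoundedBelow f)
    {p q h σ M : ℝ} (hpq : p ^ 2 + q ^ 2 = 1) (hσ : σ ^ 2 = 1)
    (hu : ∀ x : Plane, 0 ≤ f x - (p * x 0 + q * x 1) + h)
    (hlim : Tendsto (fun t => f (c t) - (p * c t 0 + q * c t 1) + h) (𝓝[<] T) (𝓝 0))
    (hseq : ∀ δ : ℝ, 0 < δ → ∃ s : ℝ, 0 < s ∧ s < δ ∧ ∀ x : Plane,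
      2 * (σ * (-q * x 0 + p * x 1)) - M - (f x - (p * x 0 + q * x 1) + h) / s ≤
        s * (f x + (p * x 0 + q * x 1) + h)) : False := by
  have hc := hr.nullCoords hpq h
  obtain ⟨U, hU⟩ : ∃ U : ℝ → ℝ, U = fun t => f (c t) - (p * c t 0 + q * c t 1) + h := ⟨_, rfl⟩
  obtain ⟨U', hU'⟩ : ∃ U' : ℝ → ℝ, U' = fun t => b t 2 - (p * b t 0 + q * b t 1) := ⟨_, rfl⟩
  have hnb := hr.not_bounded hpq h
  have hUx : ∀ t, f (c t) - (p * c t 0 + q * c t 1) + h = U t := fun t => by rw [hU]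
  have hu' : ∀ t, 0 ≤ U t := fun t => by rw [← hUx]; exact hu _
  simp only [hUx] at hnb
  rw [← hU] at hlim hc
  rw [← hU'] at hc
  -- A positive slope at time `t` would persist by convexity and keep the limit of `U` above `U t ≥
  -- 0`.
  have hUneg : ∀ t ∈ Ico 0 T, U' t ≤ 0 := fun t ht => by
    by_contra! hpos
    have h1 : ∀ᶠ s in 𝓝[<] T, U t + (s - t) * U' t ≤ U s := by
      filter_upwards [Ioo_mem_nhdsLT ht.2] with s hs
      have := hc.u_le t ht s ⟨ht.1.trans hs.1.le, hs.2⟩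
      linarith
    have h2 : Tendsto (fun s => U t + (s - t) * U' t) (𝓝[<] T) (𝓝 (U t + (T - t) * U' t)) := by
      have : Continuous (fun s : ℝ => U t + (s - t) * U' t) := by fun_prop
      exact this.continuousAt.tendsto.mono_left nhdsWithin_le_nhds
    have h3 := le_of_tendsto_of_tendsto h2 hlim h1
    nlinarith [hu' t, mul_pos (sub_pos.2 ht.2) hpos]
  obtain ⟨t₁, ht₁, hV', ⟨R, hR⟩, -⟩ := hc.unbounded_v hUneg hnb
  have hR0 : 0 ≤ R := (abs_nonneg _).trans (hR 0 hc.zero_mem)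
  obtain ⟨k, hk, hbar⟩ := hf.exists_le_mul_of_curvature hK hpq hσ hu hseq hR0
  obtain ⟨t₂, ht₂, hlt⟩ := hc.mul_lt_of_tendsto_zero (fun t _ => hu' t) hlim ht₁ hV' (half_pos hk)
  have ht₂' : t₂ ∈ Ico 0 T := ⟨ht₁.1.trans ht₂.1, ht₂.2⟩
  -- If `u` vanished at a point, it would be negative one unit further in the direction `(p, q)`,
  -- since chords have slope less than `1`.
  have hpos : 0 < U t₂ := by
    refine lt_of_le_of_ne (hu' t₂) fun h0 => ?_
    let y : Plane := c t₂ + !₂[p, q]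
    have hy : y ≠ c t₂ := by
      intro h1
      have h2 : (!₂[p, q] : Plane) = 0 := by simpa [y] using h1
      have h3 := Plane.norm_sq (!₂[p, q] : Plane)
      rw [h2] at h3
      have h4 : p = 0 := by simpa using congrArg (fun v : Plane => v 0) h2
      have h5 : q = 0 := by simpa using congrArg (fun v : Plane => v 1) h2
      rw [h4, h5] at hpq; norm_num at hpq
    have h1 := hf.abs_sub_lt hy.symm
    have h2 : ‖y - c t₂‖ = 1 := by
      have h3 := Plane.norm_sq (!₂[p, q] : Plane)
      have h4 : y - c t₂ = !₂[p, q] := by simp [y]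
      rw [h4]
      simp at h3
      rw [hpq] at h3
      exact (pow_eq_one_iff_of_nonneg (norm_nonneg _) two_ne_zero).1 h3
    rw [h2] at h1
    have h3 := hu y
    have h4 : p * y 0 + q * y 1 = p * c t₂ 0 + q * c t₂ 1 + 1 := by
      simp [y]; linear_combination hpq
    have h5 := hUx t₂
    rw [h4] at h3
    linarith [(abs_lt.1 h1).2]
  -- Taking `s < U t₂` forces the ray to cross `u = s/2` after `t₂`. There the barrier gives `u v ≥
  -- k/2`, against `u v < k/2`.
  obtain ⟨s, hs, hsδ, hbs⟩ := hbar (U t₂) hpos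
  have hev : ∀ᶠ t in 𝓝[<] T, U t < s / 2 := hlim.eventually_lt_const (half_pos hs)
  obtain ⟨t₃, ⟨ht₃a, ht₃b⟩⟩ := (hev.and (Ioo_mem_nhdsLT ht₂.2)).exists
  have hcont : ContinuousOn U (Icc t₂ t₃) := by
    have hsub : Icc t₂ t₃ ⊆ Ico 0 T := fun t ht => ⟨ht₂'.1.trans ht.1, ht.2.trans_lt ht₃b.2⟩
    have hle : ∀ x ∈ Icc t₂ t₃, ∀ y ∈ Icc t₂ t₃, x ≤ y → |U x - U y| ≤ -U' 0 * |x - y| := by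
      intro x hx y hy hxy
      have h1 := hc.u_le x (hsub hx) y (hsub hy)
      have h2 := hc.u_le y (hsub hy) x (hsub hx)
      have h3 := hc.monotone_u hc.zero_mem (hsub hx) (hsub hx).1
      have h4 := mul_nonneg (sub_nonneg.2 hxy) (neg_nonneg.2 (hUneg y (hsub hy)))
      have h5 := mul_nonneg (sub_nonneg.2 hxy) (sub_nonneg.2 h3)
      have h6 := mul_nonneg (sub_nonneg.2 hxy) (neg_nonneg.2 (hUneg 0 hc.zero_mem))
      rw [abs_of_nonpos (sub_nonpos.2 hxy), abs_le]
      constructor <;> linarith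
    have hLip : LipschitzOnWith (Real.toNNReal (-U' 0)) U (Icc t₂ t₃) := by
      refine LipschitzOnWith.of_dist_le_mul fun x hx y hy => ?_
      rw [Real.coe_toNNReal _ (neg_nonneg.2 (hUneg 0 hc.zero_mem)), Real.dist_eq, Real.dist_eq]
      rcases le_total x y with h | h
      · exact hle x hx y hy h
      · rw [abs_sub_comm, abs_sub_comm x y]
        exact hle y hy x hx h
    exact hLip.continuousOn
  obtain ⟨t, ht, htU⟩ := intermediate_value_Icc' ht₃b.1.le hcont ⟨ht₃a.le, by linarith⟩
  have ht' : t ∈ Ico t₂ T := ⟨ht.1, ht.2.trans_lt ht₃b.2⟩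
  have h1 := hlt t ht'
  have h2 := hbs (c t) (hR t ⟨ht₂'.1.trans ht.1, ht'.2⟩) (by rw [hUx]; exact htU)
  rw [htU] at h1
  linarith

/-! ### From the null support function to null planes. -/

theorem minkForm_graphMap_nullVec (f : Plane → ℝ) (x : Plane) (θ : Real.Angle) :
    minkForm (graphMap f x) (nullVec θ) = θ.cos * x 0 + θ.sin * x 1 - f x := by
  simp [minkForm, graphMap, nullVec]; ring

theorem le_of_nullSupport_lt {f : Plane → ℝ} {θ : Real.Angle} {h : ℝ}
    (hφ : nullSupport f θ ≤ (h : EReal)) (x : Plane) : θ.cos * x 0 + θ.sin * x 1 - f x ≤ h := by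
  rw [← minkForm_graphMap_nullVec]
  exact EReal.coe_le_coe_iff.1 ((le_iSup (fun p : Plane =>
    ((minkForm (graphMap f p) (nullVec θ) : ℝ) : EReal)) x).trans hφ)

theorem Real.Angle.exists_cos_sin {p q : ℝ} (hpq : p ^ 2 + q ^ 2 = 1) :
    ∃ θ : Real.Angle, θ.cos = p ∧ θ.sin = q := by
  obtain ⟨z, hz⟩ : ∃ z : ℂ, z = ⟨p, q⟩ := ⟨_, rfl⟩
  have hn : ‖z‖ = 1 := by
    have : ‖z‖ ^ 2 = 1 := by
      rw [← Complex.normSq_eq_norm_sq, Complex.normSq_apply, hz]; simp only; linarith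
    exact (pow_eq_one_iff_of_nonneg (norm_nonneg _) two_ne_zero).1 this
  have hz0 : z ≠ 0 := by
    intro h; rw [h] at hn; simp at hn
  refine ⟨(z.arg : Real.Angle), ?_, ?_⟩
  · rw [Real.Angle.cos_coe, Complex.cos_arg hz0, hn, hz]; simp
  · rw [Real.Angle.sin_coe, Complex.sin_arg, hn, hz]; simp

/-- A null support plane in a nearby direction, in light-cone coordinates. -/
theorem null_plane_le {x₀ x₁ F a b h δ M σ s : ℝ} (hM : 0 ≤ M) (hδ0 : δ ≠ 0) (hδ : |δ| ≤ 1)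
    (hσ : σ * |δ| = δ) (hs : s = Real.tan (|δ| / 2))
    (hle : (a * Real.cos δ - b * Real.sin δ) * x₀ + (b * Real.cos δ + a * Real.sin δ) * x₁ - F ≤
      h + M * |δ|) :
    2 * (σ * (-b * x₀ + a * x₁)) - 8 * M - (F - (a * x₀ + b * x₁) + h) / s ≤
      s * (F + (a * x₀ + b * x₁) + h) := by
  obtain ⟨d, hd⟩ : ∃ d, d = |δ| / 2 := ⟨_, rfl⟩
  have hd0 : 0 < d := by rw [hd]; have := abs_pos.2 hδ0; positivity
  have hd1 : d ≤ 1 / 2 := by rw [hd]; linarith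
  have hσ2 : σ * σ = 1 := by
    have h1 : (σ * σ - 1) * (|δ| * |δ|) = 0 := by
      have : |δ| * |δ| = δ * δ := abs_mul_abs_self δ
      linear_combination σ * |δ| * hσ + δ * hσ - this
    rcases mul_eq_zero.1 h1 with h2 | h2
    · linarith
    · exact absurd (mul_self_eq_zero.1 h2) (abs_ne_zero.2 hδ0)
  have hcosδ : Real.cos δ = 2 * Real.cos d ^ 2 - 1 := by
    rw [← Real.cos_abs, ← Real.cos_two_mul, hd]; congr 1; ring
  have hsinδ : Real.sin δ = σ * (2 * Real.sin d * Real.cos d) := by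
    have h1 : Real.sin |δ| = 2 * Real.sin d * Real.cos d := by
      rw [← Real.sin_two_mul, hd]; congr 1; ring
    rw [← h1, ← hσ]
    rcases abs_choice δ with h2 | h2
    · have : σ = 1 := by
        have h3 : (σ - 1) * |δ| = 0 := by linear_combination hσ - h2
        rcases mul_eq_zero.1 h3 with h4 | h4
        · linarith
        · exact absurd h4 (abs_ne_zero.2 hδ0)
      rw [this]; simp
    · have : σ = -1 := by
        have h3 : (σ + 1) * |δ| = 0 := by linear_combination hσ + h2
        rcases mul_eq_zero.1 h3 with h4 | h4
        · linarith
        · exact absurd h4 (abs_ne_zero.2 hδ0)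
      rw [this]; simp
  have hpi := Real.pi_gt_three
  have hC : 0 < Real.cos d := Real.cos_pos_of_mem_Ioo ⟨by linarith, by linarith⟩
  have hS : 0 < Real.sin d := Real.sin_pos_of_pos_of_lt_pi hd0 (by linarith)
  have hC2 : 1 / 2 ≤ Real.cos d ^ 2 := by
    have h1 := Real.one_sub_sq_div_two_le_cos (x := d)
    have h2 : 7 / 8 ≤ Real.cos d := by nlinarith
    nlinarith
  have hsc := Real.sin_sq_add_cos_sq d
  have hst : s = Real.sin d / Real.cos d := by rw [hs, ← hd, Real.tan_eq_sin_div_cos]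
  have hs0 : 0 < s := by rw [hst]; positivity
  have hds : d ≤ s := by rw [hs, ← hd]; exact Real.le_tan hd0.le (by linarith)
  have hS' : Real.sin d = s * Real.cos d := by rw [hst]; field_simp
  have hδd : |δ| = 2 * d := by rw [hd]; ring
  rw [hcosδ, hsinδ, hδd, hS'] at hle
  rw [hS'] at hsc
  set c2 := Real.cos d ^ 2 with hc2
  -- In half-angle form the plane inequality is `cos² d` times an expression in `s = tan d`. The
  -- factor `8 M` comes from `cos² d ≥ 1/2` and `d ≤ s`, with room to spare.
  have key : c2 * (2 * (σ * (-b * x₀ + a * x₁)) * s - (F - (a * x₀ + b * x₁) + h) -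
      s ^ 2 * (F + (a * x₀ + b * x₁) + h)) ≤ 2 * M * d := by
    have h1 : s ^ 2 * c2 + c2 = 1 := by rw [hc2]; linarith
    have h2 : c2 * (2 * (σ * (-b * x₀ + a * x₁)) * s - (F - (a * x₀ + b * x₁) + h) -
      s ^ 2 * (F + (a * x₀ + b * x₁) + h)) =
      (a * (2 * c2 - 1) - b * (σ * (2 * (s * Real.cos d) * Real.cos d))) * x₀ +
      (b * (2 * c2 - 1) + a * (σ * (2 * (s * Real.cos d) * Real.cos d))) * x₁ - F - h := by
      rw [hc2] at h1 ⊢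
      linear_combination (-(F + h) - (a * x₀ + b * x₁)) * h1
    rw [h2]; linarith
  have h3 : 2 * M * d ≤ c2 * (8 * M * s) := by
    have h4 : M * d ≤ M * s := mul_le_mul_of_nonneg_left hds hM
    have h5 : 0 ≤ M * s := by positivity
    nlinarith
  have h4 := le_of_mul_le_mul_left (key.trans h3) (by linarith : 0 < c2)
  have h5 : (F - (a * x₀ + b * x₁) + h) / s * s = F - (a * x₀ + b * x₁) + h := by
    field_simp
  by_contra! h6
  have := mul_lt_mul_of_pos_right h6 hs0
  nlinarith

/-- Each `θᵢ` close to `θ₀` gives a plane with `s = tan (|θᵢ - θ₀| / 2)` and with `σ` the side on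
which `θᵢ` lies. One of the two sides occurs for arbitrarily small `s`, and that one is kept. -/
theorem SeqSublinearAt.exists_null_planes {f : Plane → ℝ} {θ₀ : Real.Angle} {h : ℝ}
    (hφ : nullSupport f θ₀ = (h : EReal)) (hs : SeqSublinearAt (nullSupport f) θ₀) :
    ∃ σ M : ℝ, σ ^ 2 = 1 ∧ ∀ δ : ℝ, 0 < δ → ∃ s : ℝ, 0 < s ∧ s < δ ∧ ∀ x : Plane,
      2 * (σ * (-θ₀.sin * x 0 + θ₀.cos * x 1)) - M -
        (f x - (θ₀.cos * x 0 + θ₀.sin * x 1) + h) / s ≤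
        s * (f x + (θ₀.cos * x 0 + θ₀.sin * x 1) + h) := by
  obtain ⟨M, hM, θ, hθ, hle⟩ := hs
  obtain ⟨δ, hδ⟩ : ∃ δ : ℕ → ℝ, δ = fun i => (θ i - θ₀).toReal := ⟨_, rfl⟩
  have hcoe : ∀ i, ((δ i : ℝ) : Real.Angle) = θ i - θ₀ := fun i => by
    rw [hδ]; exact Real.Angle.coe_toReal _
  have hdist : ∀ i, dist (θ i) θ₀ = |δ i| := fun i => by
    have h1 : |δ i| ≤ |2 * Real.pi| / 2 := by
      rw [abs_of_pos Real.two_pi_pos, hδ]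
      linarith [Real.Angle.abs_toReal_le_pi (θ i - θ₀)]
    rw [dist_eq_norm, ← hcoe]
    exact (AddCircle.norm_coe_eq_abs_iff (2 * Real.pi) Real.two_pi_pos.ne').2 h1
  have hδlim : Tendsto (fun i => |δ i|) atTop (𝓝 0) := by
    simp only [← hdist]
    exact tendsto_iff_dist_tendsto_zero.1 hθ
  -- The strict inequality in the hypothesis excludes `θᵢ = θ₀`.
  have hne : ∀ i, δ i ≠ 0 := fun i h0 => by
    have h1 := hcoe i
    rw [h0, Real.Angle.coe_zero, eq_comm, sub_eq_zero] at h1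
    have h2 := hle i
    rw [h1, dist_self, mul_zero, EReal.coe_zero, add_zero] at h2
    exact lt_irrefl _ h2
  have hplane : ∀ i (x : Plane), (θ₀.cos * Real.cos (δ i) - θ₀.sin * Real.sin (δ i)) * x 0 +
      (θ₀.sin * Real.cos (δ i) + θ₀.cos * Real.sin (δ i)) * x 1 - f x ≤ h + M * |δ i| := fun i x => by
    have h1 : θ i = θ₀ + ((δ i : ℝ) : Real.Angle) := by rw [hcoe]; abel
    have h2 : nullSupport f (θ i) ≤ ((h + M * dist (θ i) θ₀ : ℝ) : EReal) := by
      rw [EReal.coe_add, ← hφ]; exact (hle i).le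
    have h3 := le_of_nullSupport_lt h2 x
    rw [h1, Real.Angle.cos_add, Real.Angle.sin_add, Real.Angle.cos_coe, Real.Angle.sin_coe, ← h1, hdist] at h3
    linarith
  have htan : Tendsto (fun i => Real.tan (|δ i| / 2)) atTop (𝓝 0) := by
    have h1 : Tendsto (fun i => |δ i| / 2) atTop (𝓝 0) := by
      simpa using hδlim.div_const 2
    have h2 : ContinuousAt Real.tan 0 := Real.continuousAt_tan.2 (by simp)
    have := h2.tendsto.comp h1
    rw [Real.tan_zero] at this
    exact this
  have hex : ∀ ε : ℝ, 0 < ε → ∃ i, |δ i| ≤ 1 ∧ 0 < Real.tan (|δ i| / 2) ∧ Real.tan (|δ i| / 2) < ε := by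
    intro ε hε
    have h1 : ∀ᶠ i in atTop, |δ i| < 1 := hδlim.eventually_lt_const one_pos
    obtain ⟨i, hi1, hi2⟩ := (h1.and (htan.eventually_lt_const hε)).exists
    refine ⟨i, hi1.le, Real.tan_pos_of_pos_of_lt_pi_div_two ?_ ?_, hi2⟩
    · have := abs_pos.2 (hne i); positivity
    · have := Real.pi_gt_three; linarith
  have key : ∀ i, |δ i| ≤ 1 → ∃ σ : ℝ, (σ = 1 ∨ σ = -1) ∧ ∀ x : Plane,
      2 * (σ * (-θ₀.sin * x 0 + θ₀.cos * x 1)) - 8 * M -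
        (f x - (θ₀.cos * x 0 + θ₀.sin * x 1) + h) / Real.tan (|δ i| / 2) ≤
        Real.tan (|δ i| / 2) * (f x + (θ₀.cos * x 0 + θ₀.sin * x 1) + h) := by
    intro i hi
    rcases abs_choice (δ i) with h1 | h1
    · exact ⟨1, Or.inl rfl, fun x => null_plane_le hM.le (hne i) hi (by linarith) rfl (hplane i x)⟩
    · exact ⟨-1, Or.inr rfl, fun x => null_plane_le hM.le (hne i) hi (by linarith) rfl (hplane i x)⟩
  by_contra! hcon
  obtain ⟨δ₁, hδ₁, h1⟩ := hcon 1 (8 * M) (by norm_num)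
  obtain ⟨δ₂, hδ₂, h2⟩ := hcon (-1) (8 * M) (by norm_num)
  obtain ⟨i, hi1, hi2, hi3⟩ := hex (min δ₁ δ₂) (lt_min hδ₁ hδ₂)
  rw [lt_min_iff] at hi3
  obtain ⟨σ, rfl | rfl, hx⟩ := key i hi1
  · obtain ⟨x, hx'⟩ := h1 _ hi2 hi3.1
    exact absurd (hx x) (not_le.2 hx')
  · obtain ⟨x, hx'⟩ := h2 _ hi2 hi3.2
    exact absurd (hx x) (not_le.2 hx')

theorem IsConvexRay.false_of_seqSublinearAt {f : Plane → ℝ} {c : ℝ → Plane} {b : ℝ → Mink} {T L : ℝ}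
    (hr : IsConvexRay f c b T L) (hf : IsConvexEntireSpacelike f) (hK : CurvatureBoundedBelow f)
    {θ : Real.Angle} {h : ℝ} (hφ : nullSupport f θ = (h : EReal))
    (hs : SeqSublinearAt (nullSupport f) θ)
    (hlim : Tendsto (fun t => minkForm (graphMap f (c t)) (nullVec θ)) (𝓝[<] T) (𝓝 h)) : False := by
  obtain ⟨σ, M, hσ, hseq⟩ := hs.exists_null_planes hφ
  refine hr.false_of_null_planes hf hK (p := θ.cos) (q := θ.sin) (h := h)
    (Real.Angle.cos_sq_add_sin_sq θ) hσ (fun x => ?_) ?_ hseq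
  · linarith [le_of_nullSupport_lt hφ.le x]
  · have h1 := (tendsto_const_nhds (x := h)).sub hlim
    rw [sub_self] at h1
    refine h1.congr fun t => ?_
    rw [minkForm_graphMap_nullVec]; ring

/-- There is no ray on a surface of curvature bounded below whose null support function is
sequentially sublinear wherever it is finite. -/
theorem IsConvexRay.false_of_forall_seqSublinearAt {f : Plane → ℝ} {c : ℝ → Plane} {b : ℝ → Mink}
    {T L : ℝ} (hr : IsConvexRay f c b T L) (hf : IsConvexEntireSpacelike f)
    (hK : CurvatureBoundedBelow f)
    (hs : ∀ θ, nullSupport f θ ≠ ⊤ → SeqSublinearAt (nullSupport f) θ) : False := by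
  obtain ⟨p, q, h, hpq, hle, hlim⟩ := hr.exists_asymptotic hf
  obtain ⟨θ, rfl, rfl⟩ := Real.Angle.exists_cos_sin hpq
  have hlim' : Tendsto (fun t => minkForm (graphMap f (c t)) (nullVec θ)) (𝓝[<] T) (𝓝 h) := by
    have h1 := (tendsto_const_nhds (x := h)).sub hlim
    rw [sub_zero] at h1
    refine h1.congr fun t => ?_
    rw [minkForm_graphMap_nullVec]; ring
  have hφ : nullSupport f θ = (h : EReal) := by
    apply le_antisymm
    · refine iSup_le fun x => ?_
      rw [minkForm_graphMap_nullVec]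
      exact EReal.coe_le_coe_iff.2 (by linarith [hle x])
    · exact le_of_tendsto' ((continuous_coe_real_ereal.tendsto h).comp hlim') fun t =>
        le_iSup (fun p : Plane => ((minkForm (graphMap f p) (nullVec θ) : ℝ) : EReal)) (c t)
  exact hr.false_of_seqSublinearAt hf hK hφ (hs θ (by rw [hφ]; exact EReal.coe_ne_top h)) hlim'

/-! ### Proper geodesics are convex rays. -/

theorem le_sub_sub_mul_of_deriv_monotone {u u' : ℝ → ℝ} {T : ℝ}
    (h : ∀ t ∈ Ico 0 T, HasDerivWithinAt u (u' t) (Ico 0 T) t) (hm : MonotoneOn u' (Ico 0 T)) :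
    ∀ s ∈ Ico 0 T, ∀ t ∈ Ico 0 T, 0 ≤ u t - u s - (t - s) * u' s := by
  have hat : ∀ t ∈ Ioo 0 T, HasDerivAt u (u' t) t := fun t ht =>
    (h t ⟨ht.1.le, ht.2⟩).hasDerivAt (Ico_mem_nhds ht.1 ht.2)
  have hcont : ContinuousOn u (Ico 0 T) := fun t ht => (h t ht).continuousWithinAt
  intro s hs t ht
  rcases lt_trichotomy s t with hst | rfl | hst
  · obtain ⟨ξ, hξ, hξ'⟩ := exists_hasDerivAt_eq_slope u u' hst
      (hcont.mono fun x hx => ⟨hs.1.trans hx.1, hx.2.trans_lt ht.2⟩)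
      (fun x hx => hat x ⟨hs.1.trans_lt hx.1, hx.2.trans ht.2⟩)
    rw [eq_div_iff (sub_pos.2 hst).ne'] at hξ'
    have h1 := hm hs ⟨hs.1.trans hξ.1.le, hξ.2.trans ht.2⟩ hξ.1.le
    nlinarith [mul_nonneg (sub_pos.2 hst).le (sub_nonneg.2 h1)]
  · simp
  · obtain ⟨ξ, hξ, hξ'⟩ := exists_hasDerivAt_eq_slope u u' hst
      (hcont.mono fun x hx => ⟨ht.1.trans hx.1, hx.2.trans_lt hs.2⟩)
      (fun x hx => hat x ⟨ht.1.trans_lt hx.1, hx.2.trans hs.2⟩)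
    rw [eq_div_iff (sub_pos.2 hst).ne'] at hξ'
    have h1 := hm ⟨ht.1.trans hξ.1.le, hξ.2.trans hs.2⟩ hs hξ.2.le
    nlinarith [mul_nonneg (sub_pos.2 hst).le (sub_nonneg.2 h1)]

theorem monotoneOn_Ico_of_hasDerivWithinAt {u u' : ℝ → ℝ} {T : ℝ}
    (h : ∀ t ∈ Ico 0 T, HasDerivWithinAt u (u' t) (Ico 0 T) t) (h0 : ∀ t ∈ Ioo 0 T, 0 ≤ u' t) :
    MonotoneOn u (Ico 0 T) := by
  refine monotoneOn_of_hasDerivWithinAt_nonneg (f' := u') (convex_Ico 0 T)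
    (fun t ht => (h t ht).continuousWithinAt) ?_ ?_
  · intro t ht
    exact (h t (interior_subset ht)).mono interior_subset
  · intro t ht
    rw [interior_Ico] at ht
    exact h0 t ht

theorem hasDerivWithinAt_mink_apply {X : ℝ → Mink} {v : Mink} {I : Set ℝ} {t : ℝ}
    (h : HasDerivWithinAt X v I t) (i : Fin 3) : HasDerivWithinAt (fun s => X s i) (v i) I t :=
  (EuclideanSpace.proj i : Mink →L[ℝ] ℝ).hasFDerivAt.comp_hasDerivWithinAt t h

/-- A proper geodesic on a half-open bounded interval is a ray. -/
theorem IsGeodesicOn.exists_isConvexRay {f : Plane → ℝ} (hf : IsConvexEntireSpacelike f) {T : ℝ}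
    (hT : 0 < T) {c : ℝ → Plane} (hg : IsGeodesicOn f c (Ico 0 T))
    (hc : Tendsto c (𝓝[<] T) (cocompact Plane)) : ∃ b L, IsConvexRay f c b T L := by
  obtain ⟨v, a, hva⟩ := hg
  have hX := fun t ht => (hva t ht).1
  have hv := fun t ht => (hva t ht).2.1
  have horth := fun t ht => (hva t ht).2.2
  have hXi : ∀ t ∈ Ico 0 T, ∀ i : Fin 3,
      HasDerivWithinAt (fun s => graphMap f (c s) i) (v t i) (Ico 0 T) t :=
    fun t ht i => hasDerivWithinAt_mink_apply (hX t ht) i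
  have hvi : ∀ t ∈ Ico 0 T, ∀ i : Fin 3, HasDerivWithinAt (fun s => v s i) (a t i) (Ico 0 T) t :=
    fun t ht i => hasDerivWithinAt_mink_apply (hv t ht) i
  have hcd : ∀ t ∈ Ico 0 T, HasDerivWithinAt c (!₂[v t 0, v t 1]) (Ico 0 T) t := fun t ht => by
    rw [hasDerivWithinAt_iff_hasFDerivWithinAt, hasFDerivWithinAt_euclidean]
    intro i
    fin_cases i
    · exact (hXi t ht 0).hasFDerivWithinAt.congr_fderiv (by ext; simp)
    · exact (hXi t ht 1).hasFDerivWithinAt.congr_fderiv (by ext; simp)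
  have htan : ∀ t ∈ Ico 0 T, v t = tangentVec f (c t) (!₂[v t 0, v t 1]) := fun t ht => by
    have h1 := ((hasFDerivAt_graphMap (hf.differentiable (c t))).differentiableAt.hasFDerivAt).comp_hasDerivWithinAt
      t (hcd t ht)
    have hu : UniqueDiffWithinAt ℝ (Ico 0 T) t := (uniqueDiffOn_Ico 0 T) t ht
    exact hu.eq_deriv _ (hX t ht) h1
  have hnonneg : ∀ t ∈ Ico 0 T, 0 ≤ minkForm (v t) (v t) := fun t ht => by
    rw [htan t ht]
    by_cases h0 : (!₂[v t 0, v t 1] : Plane) = 0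
    · rw [h0]; simp [tangentVec, minkForm]
    · exact (hf.spacelike (c t) _ h0).le
  have hconst : ∀ t ∈ Ico 0 T, minkForm (v t) (v t) = minkForm (v 0) (v 0) := fun t ht => by
    have hd : ∀ s ∈ Ico 0 T, HasDerivWithinAt (fun s => minkForm (v s) (v s)) 0 (Ico 0 T) s := fun s hs => by
      have h1 := (((hvi s hs 0).mul (hvi s hs 0)).add ((hvi s hs 1).mul (hvi s hs 1))).sub
        ((hvi s hs 2).mul (hvi s hs 2))
      refine h1.congr_deriv ?_
      have h2 := horth s hs (!₂[v s 0, v s 1])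
      rw [← htan s hs] at h2
      simp only [minkForm] at h2
      linarith
    have := (convex_Ico 0 T).norm_image_sub_le_of_norm_hasDerivWithin_le (C := 0) hd
      (fun _ _ => by simp) ⟨le_rfl, hT⟩ ht
    rw [zero_mul] at this
    exact sub_eq_zero.1 (norm_le_zero_iff.1 this)
  -- The acceleration is a multiple of the normal `(∇f, 1)`, so its causal character is decided by
  -- the sign of its last component.
  have hnormal : ∀ t ∈ Ico 0 T, a t 0 = a t 2 * gradient f (c t) 0 ∧
      a t 1 = a t 2 * gradient f (c t) 1 := fun t ht => by
    have h0 := horth t ht (EuclideanSpace.single 0 1)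
    have h1 := horth t ht (EuclideanSpace.single 1 1)
    rw [tangentVec_eq (hf.differentiable _), fderiv_apply_eq_gradient] at h0 h1
    simp [minkForm] at h0 h1
    constructor <;> linarith
  have hfuture : ∀ t ∈ Ioo 0 T, a t ∈ futureCone := fun t ht => by
    have ht' : t ∈ Ico 0 T := ⟨ht.1.le, ht.2⟩
    obtain ⟨h0, h1⟩ := hnormal t ht'
    have hgn := hf.norm_gradient_lt (c t)
    have hg2 : ‖gradient f (c t)‖ ^ 2 < 1 := by nlinarith [norm_nonneg (gradient f (c t))]
    rw [Plane.norm_sq] at hg2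
    obtain ⟨g0, hg0⟩ : ∃ g0, g0 = gradient f (c t) 0 := ⟨_, rfl⟩
    obtain ⟨g1, hg1⟩ : ∃ g1, g1 = gradient f (c t) 1 := ⟨_, rfl⟩
    rw [← hg0] at h0 hg2
    rw [← hg1] at h1 hg2
    have hpos : 0 ≤ a t 2 := by
      -- By convexity the height of the curve above the tangent plane at `c t` is minimal at time
      -- `t`, so its second derivative, `(1 - |∇f|²)` times the time component of the acceleration,
      -- is nonnegative.
      have hmin : IsLocalMin (fun s => graphMap f (c s) 2 - g0 * graphMap f (c s) 0 -
          g1 * graphMap f (c s) 1) t := by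
        refine Eventually.of_forall fun s => ?_
        have h2 := hf.fderiv_le_sub (c t) (c s)
        rw [fderiv_apply_eq_gradient, ← hg0, ← hg1] at h2
        simp [graphMap] at h2 ⊢
        linarith
      have hd1 : ∀ᶠ s in 𝓝 t, HasDerivAt (fun s => graphMap f (c s) 2 - g0 * graphMap f (c s) 0 -
          g1 * graphMap f (c s) 1) (v s 2 - g0 * v s 0 - g1 * v s 1) s := by
        filter_upwards [Ioo_mem_nhds ht.1 ht.2] with s hs
        have hs' : s ∈ Ico 0 T := ⟨hs.1.le, hs.2⟩
        have hn := Ico_mem_nhds hs.1 hs.2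
        exact (((hXi s hs' 2).hasDerivAt hn).sub (((hXi s hs' 0).hasDerivAt hn).const_mul g0)).sub
          (((hXi s hs' 1).hasDerivAt hn).const_mul g1)
      have hd2 : HasDerivAt (fun s => v s 2 - g0 * v s 0 - g1 * v s 1)
          (a t 2 - g0 * a t 0 - g1 * a t 1) t := by
        have hn := Ico_mem_nhds ht.1 ht.2
        exact (((hvi t ht' 2).hasDerivAt hn).sub (((hvi t ht' 0).hasDerivAt hn).const_mul g0)).sub
          (((hvi t ht' 1).hasDerivAt hn).const_mul g1)
      have h3 := hmin.second_deriv_nonneg hd1 hd2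
      rw [h0, h1] at h3
      have h4 : 0 ≤ a t 2 * (1 - (g0 ^ 2 + g1 ^ 2)) := by linarith
      exact nonneg_of_mul_nonneg_left h4 (by linarith)
    refine mem_futureCone_of_sq_le ?_ hpos
    rw [h0, h1]
    nlinarith [mul_nonneg (sq_nonneg (a t 2)) (sub_nonneg.2 hg2.le)]
  refine ⟨v, √(minkForm (v 0) (v 0)), hT, Real.sqrt_nonneg _, fun s hs t ht p q hpq => ?_, hnonneg,
    fun t ht => ?_, ?_⟩
  · have hd : ∀ t ∈ Ico 0 T, HasDerivWithinAt
        (fun s => graphMap f (c s) 2 - (p * graphMap f (c s) 0 + q * graphMap f (c s) 1))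
        (v t 2 - (p * v t 0 + q * v t 1)) (Ico 0 T) t := fun t ht =>
      (hXi t ht 2).sub (((hXi t ht 0).const_mul p).add ((hXi t ht 1).const_mul q))
    have hd' : ∀ t ∈ Ico 0 T, HasDerivWithinAt (fun s => v s 2 - (p * v s 0 + q * v s 1))
        (a t 2 - (p * a t 0 + q * a t 1)) (Ico 0 T) t := fun t ht =>
      (hvi t ht 2).sub (((hvi t ht 0).const_mul p).add ((hvi t ht 1).const_mul q))
    have h1 := le_sub_sub_mul_of_deriv_monotone hd (monotoneOn_Ico_of_hasDerivWithinAt hd'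
      (fun t ht => by linarith [hfuture t ht p q hpq])) s hs t ht
    simp only [PiLp.sub_apply, PiLp.smul_apply, smul_eq_mul]
    linarith
  · rw [hconst t ht, Real.sq_sqrt (hnonneg 0 ⟨le_rfl, hT⟩)]
  · rintro ⟨R, hR⟩
    have h1 : ∀ᶠ t in 𝓝[<] T, c t ∈ (Metric.closedBall (0 : Plane) R)ᶜ :=
      hc (isCompact_closedBall _ _).compl_mem_cocompact
    obtain ⟨t, ht1, ht2⟩ := (h1.and (Ioo_mem_nhdsLT hT)).exists
    exact ht1 (by simpa using hR t ⟨ht2.1.le, ht2.2⟩)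

theorem completeAt_of_seqSublinearAt {f : Plane → ℝ} (hf : IsConvexEntireSpacelike f)
    (hK : CurvatureBoundedBelow f) {θ : Real.Angle} (hs : SeqSublinearAt (nullSupport f) θ) :
    CompleteAt f θ := by
  rintro ⟨h, hφ, T, hT, c, hg, hc, hlim⟩
  obtain ⟨b, L, hr⟩ := hg.exists_isConvexRay hf hT hc
  exact hr.false_of_seqSublinearAt hf hK hφ hs hlim

/-! ### Chords and the vertices of energy-minimizing polygons. -/

/-- The Minkowski square of the chord of the graph of `f` between two points. -/
def chordSq (f : Plane → ℝ) (x y : Plane) : ℝ := ‖y - x‖ ^ 2 - (f y - f x) ^ 2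

theorem minkForm_graphMap_sub (f : Plane → ℝ) (x y : Plane) :
    minkForm (graphMap f y - graphMap f x) (graphMap f y - graphMap f x) = chordSq f x y := by
  rw [chordSq, Plane.norm_sq]
  simp [minkForm, graphMap]; ring

/-- Speed is nearly constant. Summing the variations, any two values differ by at most `4 C max · ∑
m`, which is at most `max / 2` when `n ≥ 8 C Λ`. Hence the maximum is at most twice the minimum, and
the minimum is at most the average, `Λ / n²`. -/
theorem le_div_sq_of_sq_variation {m : ℕ → ℝ} {n : ℕ} {C Λ : ℝ} (hn : 0 < n) (hC : 0 ≤ C)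
    (h0 : ∀ i < n, 0 ≤ m i)
    (hvar : ∀ i, i + 1 < n → |m (i + 1) - m i| ≤ C * (m i + m (i + 1)) ^ 2)
    (hsum : n * ∑ i ∈ Finset.range n, m i ≤ Λ) (hlarge : 8 * C * Λ ≤ n) {i : ℕ} (hi : i < n) :
    (n : ℝ) ^ 2 * m i ≤ 2 * Λ := by
  have hn' : (0 : ℝ) < n := by exact_mod_cast hn
  have hne : (Finset.range n).Nonempty := ⟨i, Finset.mem_range.2 hi⟩
  obtain ⟨k, hk, hmax⟩ := Finset.exists_max_image (Finset.range n) m hne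
  obtain ⟨j, hj, hmin⟩ := Finset.exists_min_image (Finset.range n) m hne
  have hS : ∑ i ∈ Finset.range n, m i ≤ Λ / n := by rw [le_div_iff₀' hn']; exact hsum
  have hMx0 : 0 ≤ m k := h0 k (Finset.mem_range.1 hk)
  have hjle : n * m j ≤ Λ / n := by
    refine le_trans ?_ hS
    have := Finset.card_nsmul_le_sum (Finset.range n) m (m j) hmin
    simpa using this
  have hdiff : |m k - m j| ≤ 4 * C * m k * (Λ / n) := by
    have hgen : ∀ a b : ℕ, a ≤ b → b < n → |m a - m b| ≤ 4 * C * m k * (Λ / n) := by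
      intro a b hab hb
      have h1 := dist_le_Ico_sum_dist m hab
      rw [Real.dist_eq] at h1
      refine h1.trans ?_
      have hmem : ∀ i ∈ Finset.Ico a b, i + 1 < n := fun i hi => by
        rw [Finset.mem_Ico] at hi; omega
      calc ∑ i ∈ Finset.Ico a b, dist (m i) (m (i + 1))
          ≤ ∑ i ∈ Finset.Ico a b, 2 * C * m k * (m i + m (i + 1)) := by
            refine Finset.sum_le_sum fun i hi => ?_
            have hi' := hmem i hi
            rw [Real.dist_eq, abs_sub_comm]
            refine (hvar i hi').trans ?_
            have e1 := hmax i (Finset.mem_range.2 (by omega))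
            have e2 := hmax (i + 1) (Finset.mem_range.2 hi')
            have e3 := h0 i (by omega)
            have e4 := h0 (i + 1) hi'
            calc C * (m i + m (i + 1)) ^ 2 = C * ((m i + m (i + 1)) * (m i + m (i + 1))) := by ring
              _ ≤ C * ((2 * m k) * (m i + m (i + 1))) := by
                  gcongr; linarith
              _ = _ := by ring
        _ = 2 * C * m k * (∑ i ∈ Finset.Ico a b, m i + ∑ i ∈ Finset.Ico a b, m (i + 1)) := by
            rw [← Finset.mul_sum, Finset.sum_add_distrib]
        _ ≤ 2 * C * m k * (Λ / n + Λ / n) := by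
            have e1 : ∑ i ∈ Finset.Ico a b, m i ≤ ∑ i ∈ Finset.range n, m i :=
              Finset.sum_le_sum_of_subset_of_nonneg
                (fun i hi => Finset.mem_range.2 (by have := hmem i hi; omega))
                (fun i hi _ => h0 i (Finset.mem_range.1 hi))
            have e2 : ∑ i ∈ Finset.Ico a b, m (i + 1) ≤ ∑ i ∈ Finset.range n, m i := by
              rw [Finset.sum_Ico_add' m a b 1]
              exact Finset.sum_le_sum_of_subset_of_nonneg
                (fun i hi => Finset.mem_range.2 (by rw [Finset.mem_Ico] at hi; omega))
                (fun i hi _ => h0 i (Finset.mem_range.1 hi))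
            gcongr
            · exact e1.trans hS
            · exact e2.trans hS
        _ = _ := by ring
    rcases le_total k j with h | h
    · exact hgen k j h (Finset.mem_range.1 hj)
    · rw [abs_sub_comm]; exact hgen j k h (Finset.mem_range.1 hk)
  have hhalf : 4 * C * m k * (Λ / n) ≤ m k / 2 := by
    have : 8 * C * Λ / n ≤ 1 := by rw [div_le_one hn']; exact hlarge
    calc 4 * C * m k * (Λ / n) = m k / 2 * (8 * C * Λ / n) := by ring
      _ ≤ m k / 2 * 1 := by gcongr
      _ = _ := mul_one _
  have h1 := (abs_le.1 hdiff).2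
  have h2 : m k ≤ 2 * m j := by linarith
  have h3 := hmax i (Finset.mem_range.2 hi)
  have h4 : (n : ℝ) ^ 2 * m j ≤ Λ := by
    rw [le_div_iff₀ hn'] at hjle; linarith
  nlinarith [mul_le_mul_of_nonneg_left (h3.trans h2) (sq_nonneg (n : ℝ))]

theorem mem_futureCone_coords {w : Mink} {x : Plane} (h0 : w 0 = x 0) (h1 : w 1 = x 1)
    (h : ‖x‖ ≤ w 2) : w ∈ futureCone := by
  refine mem_futureCone_of_sq_le ?_ ((norm_nonneg x).trans h)
  rw [h0, h1, ← Plane.norm_sq]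
  gcongr

namespace IsConvexEntireSpacelike

variable {f : Plane → ℝ} (hf : IsConvexEntireSpacelike f)

include hf

theorem chordSq_nonneg (x y : Plane) : 0 ≤ chordSq f x y := by
  rw [← minkForm_graphMap_sub]; exact minkForm_sub_nonneg hf y x

theorem continuous_chordSq : Continuous fun z : Plane × Plane => chordSq f z.1 z.2 := by
  have := hf.continuous
  unfold chordSq
  fun_prop

theorem hasDerivAt_chordSq_add (A B x w : Plane) :
    HasDerivAt (fun t : ℝ => chordSq f A (x + t • w) + chordSq f (x + t • w) B)
      (2 * (fderiv ℝ f x w * (f A + f B - 2 * f x) - inner ℝ (A + B - (2 : ℝ) • x) w)) 0 := by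
  have hline : HasDerivAt (fun t : ℝ => x + t • w) w 0 := by
    simpa using ((hasDerivAt_id (0:ℝ)).smul_const w).const_add x
  have hφ : HasDerivAt (fun t : ℝ => f (x + t • w)) (fderiv ℝ f x w) 0 := by
    have h0 : HasFDerivAt f (fderiv ℝ f x) (x + (0:ℝ) • w) := by
      simpa using (hf.differentiable x).hasFDerivAt
    exact h0.comp_hasDerivAt (0:ℝ) hline
  have h1 : HasDerivAt (fun t : ℝ => ‖x + t • w - A‖ ^ 2) (2 * inner ℝ (x - A) w) 0 := by
    have := (hline.sub_const A).norm_sq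
    simpa using this
  have h2 : HasDerivAt (fun t : ℝ => ‖B - (x + t • w)‖ ^ 2) (2 * inner ℝ (B - x) (-w)) 0 := by
    have := (hline.const_sub B).norm_sq
    simpa using this
  have h3 := (h1.sub ((hφ.sub_const (f A)).pow 2)).add (h2.sub ((hφ.const_sub (f B)).pow 2))
  refine h3.congr_deriv ?_
  simp only [zero_smul, add_zero, inner_sub_left, inner_add_left, inner_smul_left, inner_neg_right,
    conj_trivial]
  push_cast
  ring

/-- At a point of a convex set minimizing the sum of squared chords to two points of that set, the
second difference is future causal. -/
theorem second_diff_mem_futureCone {K : Set Plane} (hK : Convex ℝ K) {A B x : Plane} (hA : A ∈ K)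
    (hB : B ∈ K) (hx : x ∈ K)
    (hmin : ∀ y ∈ K, chordSq f A x + chordSq f x B ≤ chordSq f A y + chordSq f y B) :
    graphMap f A + graphMap f B - (2 : ℝ) • graphMap f x ∈ futureCone := by
  obtain ⟨w, hw⟩ : ∃ w, w = A + B - (2 : ℝ) • x := ⟨_, rfl⟩
  obtain ⟨d, hd⟩ : ∃ d, d = fderiv ℝ f x w := ⟨_, rfl⟩
  obtain ⟨S, hS⟩ : ∃ S, S = f A + f B - 2 * f x := ⟨_, rfl⟩
  have hder := hf.hasDerivAt_chordSq_add A B x w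
  rw [← hd, ← hS, ← hw, real_inner_self_eq_norm_sq] at hder
  -- Moving `x` towards the midpoint of `A` and `B` stays in `K`, so `x` need not be an interior
  -- point. Convexity of `f` then gives `d ≤ S`, and `‖w‖² ≤ d S` with `|d| ≤ ‖w‖` yields `‖w‖ ≤ S`.
  have hpos : 0 ≤ 2 * (d * S - ‖w‖ ^ 2) := by
    have h1 := hder.tendsto_slope_zero_right
    refine ge_of_tendsto h1 ?_
    filter_upwards [Ioo_mem_nhdsGT (show (0:ℝ) < 1 / 2 by norm_num)] with t ht
    have hmem : x + t • w ∈ K := by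
      have h2 : x + t • w = (1 - 2 * t) • x + (2 * t) • ((1 / 2 : ℝ) • A + (1 / 2 : ℝ) • B) := by
        rw [hw]; module
      rw [h2]
      exact hK hx (hK hA hB (by norm_num) (by norm_num) (by norm_num))
        (by linarith [ht.2]) (by linarith [ht.1]) (by ring)
    have := hmin _ hmem
    simp only [zero_add, zero_smul, add_zero, smul_eq_mul]
    exact mul_nonneg (inv_nonneg.2 ht.1.le) (by linarith)
  have hSd : d ≤ S := by
    have h1 := hf.fderiv_le_sub x A
    have h2 := hf.fderiv_le_sub x B
    have h3 : d = fderiv ℝ f x (A - x) + fderiv ℝ f x (B - x) := by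
      rw [hd, ← map_add, hw]; congr 1; module
    rw [hS]; linarith
  have hdw : |d| ≤ ‖w‖ := by rw [hd]; exact hf.abs_fderiv_le x w
  have hwS : ‖w‖ ≤ S := by
    rcases le_or_gt 0 d with h | h
    · rw [abs_of_nonneg h] at hdw
      by_contra! h1
      nlinarith [norm_nonneg w]
    · exfalso
      have hw0 : w ≠ 0 := by
        rintro rfl; rw [map_zero] at hd; linarith
      have h1 := hf.fderiv_sq_lt (p := x) hw0
      rw [← hd] at h1
      nlinarith
  refine mem_futureCone_coords (x := w) ?_ ?_ ?_
  · simp [graphMap, hw]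
  · simp [graphMap, hw]
  · rw [hS] at hwS; simpa [graphMap] using hwS

/-- At an interior minimum the squared chords to the two neighbours differ by a quantity that is
quadratic in them. -/
theorem abs_chordSq_sub_le {A B x : Plane} {D ρ : ℝ} (hρ : ρ < 1) (hρ0 : 0 < ρ) (hD : 0 < D)
    (hDA : f A - f x - fderiv ℝ f x (A - x) ≤ D * ‖A - x‖ ^ 2)
    (hDB : f B - f x - fderiv ℝ f x (B - x) ≤ D * ‖B - x‖ ^ 2)
    (hρx : ‖fderiv ℝ f x‖ ≤ ρ) (hρA : |f A - f x| ≤ ρ * ‖A - x‖) (hρB : |f B - f x| ≤ ρ * ‖B - x‖)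
    (hmin : IsLocalMin (fun y => chordSq f A y + chordSq f y B) x) :
    |chordSq f x B - chordSq f A x| ≤
      D ^ 2 / (1 - ρ ^ 2) ^ 3 * (chordSq f A x + chordSq f x B) ^ 2 := by
  obtain ⟨w, hw⟩ : ∃ w, w = A + B - (2 : ℝ) • x := ⟨_, rfl⟩
  obtain ⟨S, hS⟩ : ∃ S, S = f A + f B - 2 * f x := ⟨_, rfl⟩
  -- Stationarity: `w = S ∇f x`, so the second difference is normal to the surface at `x`.
  have hstat : ∀ v : Plane, inner ℝ w v = S * fderiv ℝ f x v := fun v => by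
    have hder := hf.hasDerivAt_chordSq_add A B x v
    rw [← hS, ← hw] at hder
    have h1 : IsLocalMin (fun t : ℝ => chordSq f A (x + t • v) + chordSq f (x + t • v) B) 0 := by
      have h2 : Tendsto (fun t : ℝ => x + t • v) (𝓝 0) (𝓝 x) := by
        have : Continuous (fun t : ℝ => x + t • v) := by fun_prop
        have := this.tendsto 0
        rwa [zero_smul, add_zero] at this
      have h3 := h2.eventually hmin
      filter_upwards [h3] with t ht
      simpa using ht
    have := h1.hasDerivAt_eq_zero hder
    linarith
  obtain ⟨dA, hdA⟩ : ∃ d, d = f A - f x - fderiv ℝ f x (A - x) := ⟨_, rfl⟩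
  obtain ⟨dB, hdB⟩ : ∃ d, d = f B - f x - fderiv ℝ f x (B - x) := ⟨_, rfl⟩
  have hdA0 : 0 ≤ dA := by rw [hdA]; linarith [hf.fderiv_le_sub x A]
  have hdB0 : 0 ≤ dB := by rw [hdB]; linarith [hf.fderiv_le_sub x B]
  have hq : 0 < 1 - ρ ^ 2 := by nlinarith
  have hSd : S = fderiv ℝ f x w + (dA + dB) := by
    have h3 : fderiv ℝ f x w = fderiv ℝ f x (A - x) + fderiv ℝ f x (B - x) := by
      rw [← map_add, hw]; congr 1; module
    rw [hS, h3, hdA, hdB]; ring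
  have hdw : |fderiv ℝ f x w| ≤ ρ * ‖w‖ :=
    ((fderiv ℝ f x).le_opNorm w).trans (mul_le_mul_of_nonneg_right hρx (norm_nonneg _))
  have hww := hstat w
  rw [real_inner_self_eq_norm_sq] at hww
  have hS0 : 0 ≤ S := by
    by_contra! h
    obtain ⟨d, hd⟩ : ∃ d, d = fderiv ℝ f x w := ⟨_, rfl⟩
    rw [← hd] at hdw hSd hww
    have h1 : d < 0 := by linarith
    have h2 : d ^ 2 ≤ (ρ * ‖w‖) ^ 2 := by
      rw [← sq_abs]; exact pow_le_pow_left₀ (abs_nonneg _) hdw 2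
    have h3 : S * d ≤ d * d := mul_le_mul_of_nonpos_right (by linarith) h1.le
    have h4 : ‖w‖ ^ 2 * (1 - ρ ^ 2) ≤ 0 := by
      rw [mul_pow] at h2; linarith
    have h5 : ‖w‖ ^ 2 ≤ 0 := by
      by_contra! h6
      linarith [mul_pos h6 hq]
    have h6 : 0 < d ^ 2 := by have := h1.ne; positivity
    linarith [mul_pow ρ ‖w‖ 2, mul_nonpos_of_nonneg_of_nonpos (sq_nonneg ρ) h5]
  have hwS : ‖w‖ ≤ ρ * S := by
    have h1 : ‖w‖ ^ 2 ≤ (ρ * S) * ‖w‖ := by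
      rw [hww]
      calc S * fderiv ℝ f x w ≤ S * (ρ * ‖w‖) :=
            mul_le_mul_of_nonneg_left ((le_abs_self _).trans hdw) hS0
        _ = _ := by ring
    rcases eq_or_lt_of_le (norm_nonneg w) with h0 | h0
    · rw [← h0]; positivity
    · rw [sq] at h1
      exact le_of_mul_le_mul_right h1 h0
  have hSle : S * (1 - ρ ^ 2) ≤ dA + dB := by
    have h1 : fderiv ℝ f x w ≤ ρ * (ρ * S) :=
      ((le_abs_self _).trans hdw).trans (mul_le_mul_of_nonneg_left hwS hρ0.le)
    nlinarith
  have hdiff : chordSq f x B - chordSq f A x = S * (dA - dB) := by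
    have h1 := hstat (B - A)
    have h2 : inner ℝ w (B - A) = ‖B - x‖ ^ 2 - ‖x - A‖ ^ 2 := by
      have e1 : w = (B - x) - (x - A) := by rw [hw]; module
      have e2 : B - A = (B - x) + (x - A) := by abel
      rw [e1, e2]
      generalize B - x = P
      generalize x - A = Q
      rw [inner_add_right, inner_sub_left, inner_sub_left, real_inner_self_eq_norm_sq,
        real_inner_self_eq_norm_sq, real_inner_comm Q P]
      ring
    have h3 : fderiv ℝ f x (B - A) = (f B - f A) + dA - dB := by
      have e2 : B - A = (B - x) - (A - x) := by abel
      rw [e2, map_sub, hdA, hdB]; ring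
    rw [h2, h3] at h1
    simp only [chordSq]
    rw [hS] at h1 ⊢
    linarith
  have hchord : ∀ y : Plane, |f y - f x| ≤ ρ * ‖y - x‖ →
      (1 - ρ ^ 2) * ‖y - x‖ ^ 2 ≤ ‖y - x‖ ^ 2 - (f y - f x) ^ 2 := fun y hy => by
    have : (f y - f x) ^ 2 ≤ (ρ * ‖y - x‖) ^ 2 := by
      rw [← sq_abs]; exact pow_le_pow_left₀ (abs_nonneg _) hy 2
    linarith [mul_pow ρ ‖y - x‖ 2]
  have hmA := hchord A hρA
  have hmB := hchord B hρB
  obtain ⟨mA, hmAdef⟩ : ∃ m, m = chordSq f A x := ⟨_, rfl⟩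
  obtain ⟨mB, hmBdef⟩ : ∃ m, m = chordSq f x B := ⟨_, rfl⟩
  have hmA' : (1 - ρ ^ 2) * ‖A - x‖ ^ 2 ≤ mA := by
    rw [hmAdef, chordSq, norm_sub_rev x A, ← sub_sq_comm (f A)]; exact hmA
  have hmB' : (1 - ρ ^ 2) * ‖B - x‖ ^ 2 ≤ mB := by
    rw [hmBdef, chordSq]; exact hmB
  have hμ : dA + dB ≤ D / (1 - ρ ^ 2) * (mA + mB) := by
    rw [div_mul_eq_mul_div, le_div_iff₀ hq]
    have h1 : dA + dB ≤ D * (‖A - x‖ ^ 2 + ‖B - x‖ ^ 2) := by linarith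
    calc (dA + dB) * (1 - ρ ^ 2) ≤ D * (‖A - x‖ ^ 2 + ‖B - x‖ ^ 2) * (1 - ρ ^ 2) := by gcongr
      _ = D * ((1 - ρ ^ 2) * ‖A - x‖ ^ 2 + (1 - ρ ^ 2) * ‖B - x‖ ^ 2) := by ring
      _ ≤ _ := by gcongr
  rw [hdiff, abs_mul, abs_of_nonneg hS0, ← hmAdef, ← hmBdef]
  have h1 : |dA - dB| ≤ dA + dB := by rw [abs_le]; constructor <;> linarith
  have h2 : S ≤ (dA + dB) / (1 - ρ ^ 2) := by rw [le_div_iff₀ hq]; exact hSle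
  calc S * |dA - dB| ≤ (dA + dB) / (1 - ρ ^ 2) * (dA + dB) :=
        mul_le_mul h2 h1 (abs_nonneg _) (by positivity)
    _ = (dA + dB) ^ 2 / (1 - ρ ^ 2) := by ring
    _ ≤ (D / (1 - ρ ^ 2) * (mA + mB)) ^ 2 / (1 - ρ ^ 2) := by gcongr
    _ = _ := by field_simp

end IsConvexEntireSpacelike

/-! ### Lengths of curves and inscribed polygons. -/

theorem inner_sub_mul_sq_le {d : Plane →L[ℝ] ℝ} (hd : ∀ v, (d v) ^ 2 ≤ ‖v‖ ^ 2) (u v : Plane) :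
    (inner ℝ u v - d u * d v) ^ 2 ≤ (‖u‖ ^ 2 - (d u) ^ 2) * (‖v‖ ^ 2 - (d v) ^ 2) := by
  have h : ∀ x : ℝ, 0 ≤ (‖v‖ ^ 2 - (d v) ^ 2) * (x * x) + (2 * (inner ℝ u v - d u * d v)) * x +
      (‖u‖ ^ 2 - (d u) ^ 2) := fun x => by
    have h1 := hd (u + x • v)
    rw [norm_add_sq_real, norm_smul, inner_smul_right, map_add, map_smul, smul_eq_mul, mul_pow,
      Real.norm_eq_abs, sq_abs] at h1
    nlinarith
  have := discrim_le_zero h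
  rw [discrim] at this
  nlinarith

/-- For a constant positive semidefinite form a chord is no longer than its arc: integrate the
product of the velocity with the chord and apply Cauchy-Schwarz, `inner_sub_mul_sq_le`. -/
theorem sqrt_norm_sub_sq_le_integral {d : Plane →L[ℝ] ℝ} (hd : ∀ v, (d v) ^ 2 ≤ ‖v‖ ^ 2)
    {c : ℝ → Plane} (hc : ContDiff ℝ 1 c) {s t : ℝ} (hst : s ≤ t) :
    √(‖c t - c s‖ ^ 2 - (d (c t - c s)) ^ 2) ≤
      ∫ r in s..t, √(‖deriv c r‖ ^ 2 - (d (deriv c r)) ^ 2) := by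
  obtain ⟨u, hu⟩ : ∃ u, u = c t - c s := ⟨_, rfl⟩
  rw [← hu]
  have hc' : Continuous (deriv c) := hc.continuous_deriv le_rfl
  have h1 : ∀ r, HasDerivAt (fun r => inner ℝ u (c r) - d u * d (c r))
      (inner ℝ u (deriv c r) - d u * d (deriv c r)) r := fun r => by
    have h2 : HasDerivAt c (deriv c r) r := (hc.differentiable one_ne_zero r).hasDerivAt
    have h3 := (hasDerivAt_const r u).inner ℝ h2
    have h4 := (d.hasFDerivAt.comp_hasDerivAt r h2).const_mul (d u)
    have h5 := h3.sub h4
    rw [inner_zero_left, add_zero] at h5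
    exact h5
  have hcont : Continuous fun r => inner ℝ u (deriv c r) - d u * d (deriv c r) := by fun_prop
  have hcont2 : Continuous fun r => √(‖deriv c r‖ ^ 2 - (d (deriv c r)) ^ 2) := by fun_prop
  have h2 := intervalIntegral.integral_eq_sub_of_hasDerivAt (a := s) (b := t)
    (fun r _ => h1 r) (hcont.intervalIntegrable _ _)
  have h3 : inner ℝ u (c t) - d u * d (c t) - (inner ℝ u (c s) - d u * d (c s)) =
      ‖u‖ ^ 2 - (d u) ^ 2 := by
    have e1 : ‖u‖ ^ 2 = inner ℝ u (c t) - inner ℝ u (c s) := by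
      rw [← inner_sub_right, ← hu, real_inner_self_eq_norm_sq]
    have e2 : d u = d (c t) - d (c s) := by rw [← map_sub, ← hu]
    rw [e1]
    linear_combination d u * e2
  rw [h3] at h2
  have h4 : ‖u‖ ^ 2 - (d u) ^ 2 ≤ √(‖u‖ ^ 2 - (d u) ^ 2) *
      ∫ r in s..t, √(‖deriv c r‖ ^ 2 - (d (deriv c r)) ^ 2) := by
    rw [← h2, ← intervalIntegral.integral_const_mul]
    refine intervalIntegral.integral_mono_on hst (hcont.intervalIntegrable _ _)
      ((hcont2.const_mul _).intervalIntegrable _ _) fun r _ => ?_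
    rw [h2, ← Real.sqrt_mul (sub_nonneg.2 (hd u))]
    exact Real.le_sqrt_of_sq_le (inner_sub_mul_sq_le hd u _)
  rcases eq_or_lt_of_le (Real.sqrt_nonneg (‖u‖ ^ 2 - (d u) ^ 2)) with h0 | h0
  · rw [← h0]
    exact intervalIntegral.integral_nonneg hst fun r _ => Real.sqrt_nonneg _
  · nth_rewrite 1 [← Real.mul_self_sqrt (sub_nonneg.2 (hd u))] at h4
    exact le_of_mul_le_mul_left h4 h0

/-- A continuous nonnegative speed of total length less than `ℓ` can be cut in `n` pieces of length
at most `ℓ / n` and of small duration. -/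
theorem exists_partition {g : ℝ → ℝ} (hg : Continuous g) (hg0 : ∀ t, 0 ≤ g t) {ℓ : ℝ}
    (hℓ : ∫ t in (0:ℝ)..1, g t < ℓ) {η : ℝ} (hη : 0 < η) :
    ∀ᶠ n : ℕ in atTop, ∃ t : ℕ → ℝ, t 0 = 0 ∧ t n = 1 ∧ (∀ i ≤ n, t i ∈ Icc (0:ℝ) 1) ∧
      ∀ i < n, t i ≤ t (i + 1) ∧ t (i + 1) - t i ≤ η ∧ ∫ r in t i..t (i + 1), g r ≤ ℓ / n := by
  obtain ⟨e, he⟩ : ∃ e, e = ℓ - ∫ t in (0:ℝ)..1, g t := ⟨_, rfl⟩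
  have he0 : 0 < e := by rw [he]; linarith
  have hℓ0 : 0 < ℓ := lt_of_le_of_lt
    (intervalIntegral.integral_nonneg zero_le_one fun t _ => hg0 t) hℓ
  -- The slack `e` is spent on a linear term, which makes `G` strictly increasing with `G 1 = ℓ`.
  -- Equal increments of `G` then control arc length and duration at once.
  obtain ⟨G, hG⟩ : ∃ G : ℝ → ℝ, G = fun t => (∫ r in (0:ℝ)..t, g r) + e * t := ⟨_, rfl⟩
  have hint : ∀ a b, IntervalIntegrable g MeasureTheory.volume a b :=
    fun a b => hg.intervalIntegrable a b
  have hGc : Continuous G := by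
    rw [hG]
    exact (intervalIntegral.continuous_primitive hint 0).add (continuous_const.mul continuous_id)
  have hGsub : ∀ a b, G b - G a = (∫ r in a..b, g r) + e * (b - a) := fun a b => by
    rw [hG, ← intervalIntegral.integral_interval_sub_left (hint 0 b) (hint 0 a)]; ring
  have hG0 : G 0 = 0 := by simp [hG]
  have hG1 : G 1 = ℓ := by simp [hG, he]
  filter_upwards [eventually_gt_atTop 0, eventually_ge_atTop ⌈ℓ / (e * η)⌉₊] with n hn hn2
  have hn' : (0:ℝ) < n := by exact_mod_cast hn
  have hex : ∀ i : ℕ, ∃ t : ℝ, i ≤ n → t ∈ Icc (0:ℝ) 1 ∧ G t = ℓ * i / n := fun i => by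
    by_cases hi : i ≤ n
    · have hi' : (i:ℝ) ≤ n := by exact_mod_cast hi
      obtain ⟨t, ht, ht2⟩ := intermediate_value_Icc zero_le_one hGc.continuousOn
        (show ℓ * i / n ∈ Icc (G 0) (G 1) by
          rw [hG0, hG1]
          refine ⟨by positivity, ?_⟩
          rw [div_le_iff₀ hn']; gcongr)
      exact ⟨t, fun _ => ⟨ht, ht2⟩⟩
    · exact ⟨0, fun h => absurd h hi⟩
  choose t ht using hex
  have hmono : ∀ a b, a < b → G a < G b := fun a b hab => by
    have h1 := hGsub a b
    have h2 := intervalIntegral.integral_nonneg (μ := MeasureTheory.volume) hab.le fun r _ => hg0 r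
    nlinarith [mul_pos he0 (sub_pos.2 hab)]
  have hinj : ∀ a b, G a = G b → a = b := fun a b hab => by
    rcases lt_trichotomy a b with h | h | h
    · exact absurd hab (hmono _ _ h).ne
    · exact h
    · exact absurd hab (hmono _ _ h).ne'
  refine ⟨t, hinj _ _ ?_, hinj _ _ ?_, fun i hi => (ht i hi).1, fun i hi => ?_⟩
  · rw [(ht 0 hn.le).2, hG0]; simp
  · rw [(ht n le_rfl).2, hG1]; field_simp
  · have h1 := (ht i hi.le).2
    have h2 := (ht (i + 1) hi).2
    have h3 : t i ≤ t (i + 1) := by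
      by_contra! h
      have := hmono _ _ h
      rw [h1, h2] at this
      push_cast at this
      rw [div_lt_div_iff_of_pos_right hn'] at this
      nlinarith
    have h4 := hGsub (t i) (t (i + 1))
    have h5 := intervalIntegral.integral_nonneg (μ := MeasureTheory.volume) h3 fun r _ => hg0 r
    have h6 : G (t (i + 1)) - G (t i) = ℓ / n := by
      rw [h1, h2]; push_cast; ring
    rw [h6] at h4
    refine ⟨h3, ?_, ?_⟩
    · have h7 : ℓ / (e * η) ≤ n := (Nat.le_ceil _).trans (by exact_mod_cast hn2)
      have h8 : ℓ / n ≤ e * η := by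
        rw [div_le_iff₀ (by positivity)] at h7 ⊢; linarith
      have : e * (t (i + 1) - t i) ≤ e * η := by linarith
      exact le_of_mul_le_mul_left this he0
    · nlinarith [mul_nonneg he0.le (sub_nonneg.2 h3)]

/-! ### Energy-minimizing polygons. -/

theorem le_max_of_convex_sequence {a : ℕ → ℝ} {n : ℕ}
    (h : ∀ j, j + 2 ≤ n → 2 * a (j + 1) ≤ a j + a (j + 2)) {i : ℕ} (hi : i ≤ n) :
    a i ≤ max (a 0) (a n) := by
  obtain ⟨k, hk, hmax⟩ := Finset.exists_max_image (Finset.range (n + 1)) a ⟨0, by simp⟩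
  have hi' := hmax i (by simpa [Nat.lt_succ_iff] using hi)
  have hk' : k ≤ n := by simpa [Nat.lt_succ_iff] using hk
  rcases eq_or_lt_of_le hk' with rfl | hkn
  · exact hi'.trans (le_max_right _ _)
  · have : ∀ j ≤ k, a (k - j) = a k := by
      intro j
      induction j with
      | zero => simp
      | succ j ih =>
        intro hj
        have h1 := ih (by omega)
        obtain ⟨l, hl⟩ : ∃ l, l = k - (j + 1) := ⟨_, rfl⟩
        have h2 : k - j = l + 1 := by omega
        rw [h2] at h1
        rw [← hl]
        have h3 := h l (by omega)
        have h4 := hmax l (by simp; omega)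
        have h5 := hmax (l + 2) (by simp; omega)
        linarith
    have h0 := this k le_rfl
    rw [Nat.sub_self] at h0
    rw [← h0] at hi'
    exact hi'.trans (le_max_left _ _)

theorem sum_update_sub {X : Type*} (F : X → X → ℝ) (P : ℕ → X) (y : X) {j n : ℕ} (hj : j + 2 ≤ n) :
    (∑ i ∈ Finset.range n, F (Function.update P (j + 1) y i) (Function.update P (j + 1) y (i + 1))) -
      ∑ i ∈ Finset.range n, F (P i) (P (i + 1)) =
    (F (P j) y + F y (P (j + 2))) - (F (P j) (P (j + 1)) + F (P (j + 1)) (P (j + 2))) := by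
  rw [← Finset.sum_sub_distrib, Finset.sum_eq_add j (j + 1) (by omega)]
  · rw [Function.update_self, Function.update_of_ne (by omega), Function.update_of_ne (by omega)]
    ring
  · intro i _ hi
    rw [Function.update_of_ne hi.2, Function.update_of_ne (by omega), sub_self]
  · intro h; exact absurd (Finset.mem_range.2 (by omega)) h
  · intro h; exact absurd (Finset.mem_range.2 (by omega)) h

/-- A polygon with vertices in a compact set that minimizes the energy with respect to the variation
of any single vertex. -/
theorem exists_energy_minimizer {X : Type*} [TopologicalSpace X] {F : X → X → ℝ}
    (hF : Continuous fun z : X × X => F z.1 z.2) {K : Set X} (hK : IsCompact K) {n : ℕ} (hn : 0 < n)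
    {Q : ℕ → X} (hQ : ∀ i, Q i ∈ K) :
    ∃ P : ℕ → X, P 0 = Q 0 ∧ P n = Q n ∧ (∀ i, P i ∈ K) ∧
      ∑ i ∈ Finset.range n, F (P i) (P (i + 1)) ≤
        ∑ i ∈ Finset.range n, F (Q i) (Q (i + 1)) ∧
      ∀ j, j + 2 ≤ n → ∀ y ∈ K, F (P j) (P (j + 1)) + F (P (j + 1)) (P (j + 2)) ≤
        F (P j) y + F y (P (j + 2)) := by
  classical
  -- A polygon is a point of a product of compact sets over `ℕ`, pinned at the indices `0` and `n`.
  -- Indices beyond `n` do not affect the energy.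
  obtain ⟨S, hS⟩ : ∃ S : ℕ → Set X,
    S = fun i => if i = 0 then {Q 0} else if i = n then {Q n} else K := ⟨_, rfl⟩
  have hScomp : ∀ i, IsCompact (S i) := fun i => by
    rw [hS]; dsimp only; split_ifs
    · exact isCompact_singleton
    · exact isCompact_singleton
    · exact hK
  have hSK : ∀ i, S i ⊆ K := fun i => by
    rw [hS]; dsimp only; split_ifs
    · exact singleton_subset_iff.2 (hQ _)
    · exact singleton_subset_iff.2 (hQ _)
    · exact subset_rfl
  have hQS : Q ∈ Set.univ.pi S := fun i _ => by
    rw [hS]; dsimp only; split_ifs with h1 h2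
    · rw [h1]; rfl
    · rw [h2]; rfl
    · exact hQ i
  have hcont : Continuous fun P : ℕ → X =>
      ∑ i ∈ Finset.range n, F (P i) (P (i + 1)) :=
    continuous_finsetSum _ fun i _ => by
      have h : Continuous fun P : ℕ → X => (P i, P (i + 1)) :=
        (continuous_apply i).prodMk (continuous_apply (i + 1))
      exact hF.comp h
  obtain ⟨P, hP, hmin⟩ := (isCompact_univ_pi hScomp).exists_isMinOn ⟨Q, hQS⟩ hcont.continuousOn
  have hP0 : P 0 = Q 0 := by
    have := hP 0 (mem_univ _); rw [hS] at this; simpa using this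
  have hPn : P n = Q n := by
    have := hP n (mem_univ _); rw [hS] at this; simpa [hn.ne'] using this
  refine ⟨P, hP0, hPn, fun i => hSK i (hP i (mem_univ _)), hmin hQS, fun j hj y hy => ?_⟩
  have hup : Function.update P (j + 1) y ∈ Set.univ.pi S := fun i _ => by
    by_cases hi : i = j + 1
    · subst hi
      rw [Function.update_self, hS]
      simpa [show j + 1 ≠ n by omega] using hy
    · rw [Function.update_of_ne hi]; exact hP i (mem_univ _)
  have h1 := hmin hup
  have h2 := sum_update_sub (F) P y hj
  have h3 : ∑ i ∈ Finset.range n, F (P i) (P (i + 1)) ≤ _ := h1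
  linarith

/-- A polygon inscribed in the graph of `f` with `n` edges, whose edge vectors increase in the causal
order and have Minkowski length at most `L / n`. -/
structure IsConvexPolygon (f : Plane → ℝ) (P : ℕ → Plane) (n : ℕ) (L : ℝ) : Prop where
  pos : 0 < n
  cone : ∀ j, j + 2 ≤ n →
    graphMap f (P j) + graphMap f (P (j + 2)) - (2 : ℝ) • graphMap f (P (j + 1)) ∈ futureCone
  speed : ∀ i < n, (n : ℝ) ^ 2 * chordSq f (P i) (P (i + 1)) ≤ L ^ 2

namespace IsConvexEntireSpacelike

variable {f : Plane → ℝ} (hf : IsConvexEntireSpacelike f)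

include hf

theorem firstForm_self (x v : Plane) : firstForm f x v v = ‖v‖ ^ 2 - (fderiv ℝ f x v) ^ 2 := by
  rw [firstForm_eq (hf.differentiable x), Plane.norm_sq]; ring

theorem fderiv_sq_le (x v : Plane) : (fderiv ℝ f x v) ^ 2 ≤ ‖v‖ ^ 2 := by
  rw [← sq_abs]; exact pow_le_pow_left₀ (abs_nonneg _) (hf.abs_fderiv_le x v) 2

theorem continuous_speed {c : ℝ → Plane} (hc : ContDiff ℝ 1 c) :
    Continuous fun t => √(firstForm f (c t) (deriv c t) (deriv c t)) := by
  have h1 : Continuous (deriv c) := hc.continuous_deriv le_rfl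
  have h2 : Continuous fun t => fderiv ℝ f (c t) (deriv c t) :=
    (hf.continuous_fderiv.comp hc.continuous).clm_apply h1
  simp only [hf.firstForm_self]
  fun_prop

/-- Short chords of a curve on the surface are at most twice as long as the arc. -/
theorem exists_chordSq_le_integral {c : ℝ → Plane} (hc : ContDiff ℝ 1 c) :
    ∃ η : ℝ, 0 < η ∧ ∀ s ∈ Icc (0:ℝ) 1, ∀ t ∈ Icc (0:ℝ) 1, s ≤ t → t - s ≤ η →
      chordSq f (c s) (c t) ≤
        (2 * ∫ r in s..t, √(firstForm f (c r) (deriv c r) (deriv c r))) ^ 2 := by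
  obtain ⟨B, hB⟩ := (isCompact_Icc.image hc.continuous :
    IsCompact (c '' Icc (0:ℝ) 1)).isBounded.subset_closedBall (0 : Plane)
  obtain ⟨ρ, hρ0, hρ1, hρ, -⟩ := hf.exists_abs_sub_le (isCompact_closedBall (0 : Plane) B)
    (convex_closedBall _ _)
  have hq : 0 < 1 - ρ ^ 2 := by nlinarith
  have huc := (isCompact_closedBall (0 : Plane) B).uniformContinuousOn_of_continuous
    hf.continuous_fderiv.continuousOn
  obtain ⟨δ, hδ, hδ2⟩ := Metric.uniformContinuousOn_iff.1 huc ((1 - ρ ^ 2) / 2) (by positivity)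
  have huc2 := (isCompact_Icc (a := (0:ℝ)) (b := 1)).uniformContinuousOn_of_continuous
    hc.continuous.continuousOn
  obtain ⟨η, hη, hη2⟩ := Metric.uniformContinuousOn_iff.1 huc2 δ hδ
  -- On the ball the first fundamental form is at least `(1 - ρ²) ‖v‖²`, so a change of slope of at
  -- most `(1 - ρ²) / 2` costs at most a factor `2`. It is used twice: from an intermediate point of
  -- the chord to `c s`, and from `c s` to the points of the arc.
  have hcomp : ∀ x ∈ Metric.closedBall (0 : Plane) B, ∀ y ∈ Metric.closedBall (0 : Plane) B,
      dist x y < δ → ∀ v, ‖v‖ ^ 2 - (fderiv ℝ f x v) ^ 2 ≤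
        2 * (‖v‖ ^ 2 - (fderiv ℝ f y v) ^ 2) := by
    intro x hx y hy hxy v
    have h1 := hδ2 x hx y hy hxy
    rw [dist_eq_norm] at h1
    have h2 : |fderiv ℝ f x v - fderiv ℝ f y v| ≤ (1 - ρ ^ 2) / 2 * ‖v‖ := by
      have := (fderiv ℝ f x - fderiv ℝ f y).le_of_opNorm_le h1.le v
      simpa using this
    have h3 := hf.abs_fderiv_le x v
    have h4 := hf.abs_fderiv_le y v
    have h5 : |fderiv ℝ f y v| ≤ ρ * ‖v‖ := (fderiv ℝ f y).le_of_opNorm_le (hρ y hy) v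
    have h6 : (fderiv ℝ f y v) ^ 2 - (fderiv ℝ f x v) ^ 2 ≤ (1 - ρ ^ 2) * ‖v‖ ^ 2 := by
      have e : (fderiv ℝ f y v) ^ 2 - (fderiv ℝ f x v) ^ 2 =
        (fderiv ℝ f x v - fderiv ℝ f y v) * -(fderiv ℝ f x v + fderiv ℝ f y v) := by ring
      rw [e]
      refine (le_abs_self _).trans ?_
      rw [abs_mul, abs_neg]
      calc _ ≤ (1 - ρ ^ 2) / 2 * ‖v‖ * (‖v‖ + ‖v‖) := by
            gcongr
            exact (abs_add_le _ _).trans (add_le_add h3 h4)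
        _ = _ := by ring
    have h7 : (fderiv ℝ f y v) ^ 2 ≤ (ρ * ‖v‖) ^ 2 := by
      rw [← sq_abs]; exact pow_le_pow_left₀ (abs_nonneg _) h5 2
    rw [mul_pow] at h7
    linarith
  refine ⟨η / 2, by positivity, fun s hs t ht hst hts => ?_⟩
  have hmem : ∀ r ∈ Icc (0:ℝ) 1, c r ∈ Metric.closedBall (0 : Plane) B :=
    fun r hr => hB (mem_image_of_mem c hr)
  have hnear : ∀ r ∈ Icc s t, dist (c s) (c r) < δ := fun r hr => by
    refine hη2 s hs r ⟨hs.1.trans hr.1, hr.2.trans ht.2⟩ ?_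
    rw [Real.dist_eq, abs_sub_comm, abs_of_nonneg (by linarith [hr.1])]
    linarith [hr.2]
  obtain ⟨z, hz, hzeq⟩ := hf.exists_fderiv_eq_sub (c s) (c t)
  have hzK : z ∈ Metric.closedBall (0 : Plane) B :=
    (convex_closedBall (0 : Plane) B).segment_subset (hmem s hs) (hmem t ht) hz
  have hzd : dist z (c s) < δ := by
    have h1 : segment ℝ (c s) (c t) ⊆ Metric.ball (c s) δ :=
      (convex_ball (c s) δ).segment_subset (Metric.mem_ball_self hδ)
        (by rw [Metric.mem_ball, dist_comm]; exact hnear t ⟨hst, le_rfl⟩)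
    exact h1 hz
  have h1 : chordSq f (c s) (c t) ≤
      2 * (‖c t - c s‖ ^ 2 - (fderiv ℝ f (c s) (c t - c s)) ^ 2) := by
    rw [chordSq, hzeq]; exact hcomp z hzK _ (hmem s hs) hzd _
  have h2 := sqrt_norm_sub_sq_le_integral (hf.fderiv_sq_le (c s)) hc hst
  have h3 : ∫ r in s..t, √(‖deriv c r‖ ^ 2 - (fderiv ℝ f (c s) (deriv c r)) ^ 2) ≤
      √2 * ∫ r in s..t, √(firstForm f (c r) (deriv c r) (deriv c r)) := by
    have hc' : Continuous (deriv c) := hc.continuous_deriv le_rfl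
    rw [← intervalIntegral.integral_const_mul]
    refine intervalIntegral.integral_mono_on hst (Continuous.intervalIntegrable (by fun_prop) _ _)
      (((hf.continuous_speed hc).const_mul _).intervalIntegrable _ _) fun r hr => ?_
    rw [← Real.sqrt_mul (by norm_num), hf.firstForm_self]
    exact Real.sqrt_le_sqrt (hcomp _ (hmem s hs) _
      (hmem r ⟨hs.1.trans hr.1, hr.2.trans ht.2⟩) (hnear r hr) _)
  have h4 := Real.sqrt_le_iff.1 (h2.trans h3)
  calc chordSq f (c s) (c t) ≤ _ := h1
    _ ≤ 2 * (√2 * ∫ r in s..t, √(firstForm f (c r) (deriv c r) (deriv c r))) ^ 2 := by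
        gcongr; exact h4.2
    _ = _ := by
        rw [mul_pow, Real.sq_sqrt (by norm_num)]; ring

theorem eventually_exists_inscribed_polygon {c : ℝ → Plane} (hc : ContDiff ℝ 1 c) {ℓ : ℝ}
    (hℓ : curveLength f c < ℓ) :
    ∀ᶠ n : ℕ in atTop, ∃ Q : ℕ → Plane, Q 0 = c 0 ∧ Q n = c 1 ∧ (∀ i, Q i ∈ c '' Icc 0 1) ∧
      n * ∑ i ∈ Finset.range n, chordSq f (Q i) (Q (i + 1)) ≤ (2 * ℓ) ^ 2 := by
  obtain ⟨η, hη, h⟩ := hf.exists_chordSq_le_integral hc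
  filter_upwards [exists_partition (hf.continuous_speed hc) (fun _ => Real.sqrt_nonneg _) hℓ hη,
    eventually_gt_atTop 0] with n hn hn0
  obtain ⟨t, ht0, ht1, htmem, ht⟩ := hn
  have hn' : (0:ℝ) < n := by exact_mod_cast hn0
  -- Freezing the index at `n` keeps every vertex on the curve, as the energy minimization requires.
  refine ⟨fun i => c (t (min i n)), by simp [ht0], by simp [ht1],
    fun i => mem_image_of_mem c (htmem _ (min_le_right _ _)), ?_⟩
  have hle : ∀ i ∈ Finset.range n, chordSq f (c (t (min i n))) (c (t (min (i + 1) n))) ≤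
      (2 * (ℓ / n)) ^ 2 := fun i hi => by
    rw [Finset.mem_range] at hi
    rw [min_eq_left hi.le, min_eq_left (show i + 1 ≤ n from hi)]
    obtain ⟨h1, h2, h3⟩ := ht i hi
    refine (h _ (htmem i hi.le) _ (htmem _ hi) h1 h2).trans ?_
    have := intervalIntegral.integral_nonneg (μ := MeasureTheory.volume) h1
      (fun r _ => Real.sqrt_nonneg (firstForm f (c r) (deriv c r) (deriv c r)))
    gcongr
  have h1 := Finset.sum_le_card_nsmul _ _ _ hle
  rw [Finset.card_range, nsmul_eq_mul] at h1
  calc _ ≤ (n:ℝ) * (n * (2 * (ℓ / n)) ^ 2) := by gcongr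
    _ = _ := by field_simp

/-- A curve of length less than `ℓ` can be replaced by a polygon which is convex in the causal sense,
has bounded speed, and has short edges. -/
theorem exists_polygon {α : Plane} (hα : ‖α‖ ≤ 1)
    (hprop : ∀ R : ℝ, IsCompact {x | f x - inner ℝ α x ≤ R}) {c : ℝ → Plane}
    (hc : ContDiff ℝ 1 c) {ℓ : ℝ} (hℓ : curveLength f c < ℓ) {ε : ℝ} (hε : 0 < ε) :
    ∃ (n : ℕ) (P : ℕ → Plane), IsConvexPolygon f P n (4 * ℓ) ∧ 1 ≤ n * ε ∧ P 0 = c 0 ∧ P n = c 1 ∧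
      (∀ i < n, ‖P (i + 1) - P i‖ ≤ ε) ∧
      ∀ i ≤ n, f (P i) - inner ℝ α (P i) ≤
        max (f (c 0) - inner ℝ α (c 0)) (f (c 1) - inner ℝ α (c 1)) := by
  obtain ⟨τ, hτ⟩ : ∃ τ : Plane → ℝ, τ = fun x => f x - inner ℝ α x := ⟨_, rfl⟩
  have hτc : Continuous τ := by
    have := hf.continuous
    rw [hτ]; fun_prop
  obtain ⟨R, hR⟩ := ((isCompact_Icc (a := (0:ℝ)) (b := 1)).image
    (hτc.comp hc.continuous)).bddAbove
  have hcR : ∀ t ∈ Icc (0:ℝ) 1, τ (c t) ≤ R := fun t ht => hR (mem_image_of_mem _ ht)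
  -- The sublevel set is taken one unit above the maximum of `τ` on the curve, so that the vertices
  -- of the minimizer turn out to be interior and their variation is unconstrained.
  obtain ⟨K, hKdef⟩ : ∃ K : Set Plane, K = {x | τ x ≤ R + 1} := ⟨_, rfl⟩
  have hK : IsCompact K := by rw [hKdef, hτ]; exact hprop (R + 1)
  have hKc : Convex ℝ K := by
    rw [hKdef, hτ]
    have h1 : ConvexOn ℝ univ fun x : Plane => f x - inner ℝ α x := by
      refine hf.convex.sub ?_
      exact (innerSL ℝ α).toLinearMap.concaveOn convex_univ
    simpa using h1.convex_le (R + 1)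
  obtain ⟨ρ, hρ0, hρ1, hρ, hρ2⟩ := hf.exists_abs_sub_le hK hKc
  obtain ⟨D, hD0, hD⟩ := hf.exists_sub_le_sq hK hKc
  have hq : 0 < 1 - ρ ^ 2 := by nlinarith
  obtain ⟨C, hC⟩ : ∃ C, C = D ^ 2 / (1 - ρ ^ 2) ^ 3 := ⟨_, rfl⟩
  have hC0 : 0 ≤ C := by rw [hC]; positivity
  have e1 : ∀ᶠ n : ℕ in atTop, 8 * C * (2 * ℓ) ^ 2 ≤ n :=
    (tendsto_natCast_atTop_atTop (R := ℝ)).eventually_ge_atTop _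
  have e2 : ∀ᶠ n : ℕ in atTop, 1 / ε ≤ n :=
    (tendsto_natCast_atTop_atTop (R := ℝ)).eventually_ge_atTop _
  have e3 : ∀ᶠ n : ℕ in atTop, (4 * ℓ) ^ 2 / ((1 - ρ ^ 2) * ε ^ 2) ≤ n :=
    (tendsto_natCast_atTop_atTop (R := ℝ)).eventually_ge_atTop _
  obtain ⟨n, hn1, hn2, hn3, hn, Q, hQ0, hQn, hQmem, hQsum⟩ :=
    (e1.and (e2.and (e3.and ((eventually_gt_atTop 0).and
      (hf.eventually_exists_inscribed_polygon hc hℓ))))).exists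
  have hn' : (0:ℝ) < n := by exact_mod_cast hn
  have hn1' : (1:ℝ) ≤ n := by exact_mod_cast hn
  have hQK : ∀ i, Q i ∈ K := fun i => by
    obtain ⟨t, ht, hte⟩ := hQmem i
    rw [hKdef, ← hte, mem_ofPred_eq]
    linarith [hcR t ht]
  obtain ⟨P, hP0, hPn, hPK, hPsum, hPmin⟩ :=
    exists_energy_minimizer hf.continuous_chordSq hK hn hQK
  have hcone : ∀ j, j + 2 ≤ n →
      graphMap f (P j) + graphMap f (P (j + 2)) - (2 : ℝ) • graphMap f (P (j + 1)) ∈ futureCone :=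
    fun j hj => hf.second_diff_mem_futureCone hKc (hPK _) (hPK _) (hPK _) (hPmin j hj)
  -- As `‖α‖ ≤ 1`, the linear function `z - ⟨α, ·⟩` is nonnegative on the future cone. Along the
  -- polygon `τ` is therefore a convex sequence, bounded by its end values.
  have hτP : ∀ i ≤ n, τ (P i) ≤ max (τ (c 0)) (τ (c 1)) := fun i hi => by
    rw [← hQ0, ← hQn, ← hP0, ← hPn]
    refine le_max_of_convex_sequence (a := fun i => τ (P i)) (fun j hj => ?_) hi
    obtain ⟨w, hw⟩ : ∃ w, w = P j + P (j + 2) - (2:ℝ) • P (j + 1) := ⟨_, rfl⟩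
    obtain ⟨S, hS⟩ : ∃ S, S = f (P j) + f (P (j + 2)) - 2 * f (P (j + 1)) := ⟨_, rfl⟩
    have h1 := futureCone_sq_le (hcone j hj)
    have h2 := futureCone_time_nonneg (hcone j hj)
    have h3 : ‖w‖ ^ 2 ≤ S ^ 2 := by
      rw [Plane.norm_sq, hw, hS]; simpa [graphMap] using h1
    have h4 : 0 ≤ S := by rw [hS]; simpa [graphMap] using h2
    have h5 : ‖w‖ ≤ S := abs_le_of_sq_le_sq' h3 h4 |>.2
    have h6 : inner ℝ α w ≤ S := by
      refine (real_inner_le_norm α w).trans (le_trans ?_ h5)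
      exact mul_le_of_le_one_left (norm_nonneg _) hα
    rw [hw, inner_sub_right, inner_add_right, inner_smul_right, hS] at h6
    rw [hτ]; linarith
  have hτR : ∀ i ≤ n, τ (P i) ≤ R := fun i hi =>
    (hτP i hi).trans (max_le (hcR 0 (by simp)) (hcR 1 (by simp)))
  have hvar : ∀ i, i + 1 < n → |chordSq f (P (i + 1)) (P (i + 2)) - chordSq f (P i) (P (i + 1))| ≤
      C * (chordSq f (P i) (P (i + 1)) + chordSq f (P (i + 1)) (P (i + 2))) ^ 2 := fun i hi => by
    rw [hC]
    have hx := hPK (i + 1)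
    refine hf.abs_chordSq_sub_le hρ1 hρ0 hD0 (hD _ hx _ (hPK i)) (hD _ hx _ (hPK _)) (hρ _ hx)
      (hρ2 _ hx _ (hPK i)) (hρ2 _ hx _ (hPK _)) ?_
    have hnhds : K ∈ 𝓝 (P (i + 1)) := by
      have h1 : {x | τ x < R + 1} ∈ 𝓝 (P (i + 1)) :=
        (isOpen_lt hτc continuous_const).mem_nhds (by
          have := hτR (i + 1) (by omega)
          rw [mem_ofPred_eq]; linarith)
      refine mem_of_superset h1 fun x hx => ?_
      rw [mem_ofPred_eq] at hx
      rw [hKdef, mem_ofPred_eq]; exact hx.le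
    filter_upwards [hnhds] with y hy
    exact hPmin i (by omega) y hy
  have hsum : (n : ℝ) * ∑ i ∈ Finset.range n, chordSq f (P i) (P (i + 1)) ≤ (2 * ℓ) ^ 2 :=
    (mul_le_mul_of_nonneg_left hPsum hn'.le).trans hQsum
  have hspeed : ∀ i < n, (n : ℝ) ^ 2 * chordSq f (P i) (P (i + 1)) ≤ (4 * ℓ) ^ 2 := fun i hi => by
    have := le_div_sq_of_sq_variation (m := fun i => chordSq f (P i) (P (i + 1))) hn hC0
      (fun i _ => hf.chordSq_nonneg _ _) hvar hsum hn1 hi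
    nlinarith [sq_nonneg ℓ]
  refine ⟨n, P, ⟨hn, hcone, hspeed⟩, ?_, hP0.trans hQ0, hPn.trans hQn, fun i hi => ?_, ?_⟩
  · rwa [div_le_iff₀ hε] at hn2
  · have h1 := hspeed i hi
    have h2 : (1 - ρ ^ 2) * ‖P (i + 1) - P i‖ ^ 2 ≤ chordSq f (P i) (P (i + 1)) := by
      have h3 := hρ2 _ (hPK i) _ (hPK (i + 1))
      have h4 : (f (P (i + 1)) - f (P i)) ^ 2 ≤ (ρ * ‖P (i + 1) - P i‖) ^ 2 := by
        rw [← sq_abs]; exact pow_le_pow_left₀ (abs_nonneg _) h3 2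
      rw [mul_pow] at h4
      rw [chordSq]; linarith
    rw [div_le_iff₀ (by positivity)] at hn3
    have h5 : (n:ℝ) * ((n:ℝ) * ((1 - ρ ^ 2) * ‖P (i + 1) - P i‖ ^ 2)) ≤
        n * ((1 - ρ ^ 2) * ε ^ 2) := by
      have := mul_le_mul_of_nonneg_left h2 (sq_nonneg (n:ℝ))
      linarith
    have h6 := le_of_mul_le_mul_left h5 hn'
    have h7 : (1 - ρ ^ 2) * ‖P (i + 1) - P i‖ ^ 2 ≤ (1 - ρ ^ 2) * ε ^ 2 :=
      (le_mul_of_one_le_left (by positivity) hn1').trans h6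
    exact abs_le_of_sq_le_sq' (le_of_mul_le_mul_left h7 hq) hε.le |>.2
  · rw [hτ] at hτP; exact hτP

end IsConvexEntireSpacelike

/-! ### Limits of convex polygons. -/

theorem Ultrafilter.exists_tendsto_of_norm_le {E : Type*} [NormedAddCommGroup E] [ProperSpace E]
    (U : Ultrafilter ℕ) {x : ℕ → E} {R : ℝ} (h : ∀ᶠ m in U, ‖x m‖ ≤ R) :
    ∃ y, Tendsto x U (𝓝 y) := by
  have h1 : Tendsto x U (𝓟 (Metric.closedBall 0 R)) :=
    tendsto_principal.2 (h.mono fun m hm => by simpa using hm)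
  obtain ⟨y, -, hy⟩ := (isCompact_closedBall (0 : E) R).ultrafilter_le_nhds (U.map x) h1
  exact ⟨y, hy⟩

theorem continuous_minkForm_self : Continuous fun w : Mink => minkForm w w := by
  have hc : ∀ i : Fin 3, Continuous (fun w : Mink => w i) := fun i =>
    (EuclideanSpace.proj i : Mink →L[ℝ] ℝ).continuous
  unfold minkForm
  exact (((hc 0).mul (hc 0)).add ((hc 1).mul (hc 1))).sub ((hc 2).mul (hc 2))

theorem minkForm_smul_self (r : ℝ) (w : Mink) : minkForm (r • w) (r • w) = r ^ 2 * minkForm w w := by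
  simp [minkForm]; ring

namespace IsConvexPolygon

variable {f : Plane → ℝ} {P : ℕ → Plane} {n : ℕ} {L : ℝ} (hP : IsConvexPolygon f P n L)

include hP

theorem edge_sub_mem {i j : ℕ} (hij : i ≤ j) (hj : j < n) :
    (graphMap f (P (j + 1)) - graphMap f (P j)) - (graphMap f (P (i + 1)) - graphMap f (P i)) ∈
      futureCone := by
  induction j, hij using Nat.le_induction with
  | base => simpa using futureCone_zero
  | succ k hk ih =>
    have h1 := futureCone_add (ih (by omega)) (hP.cone k (by omega))
    convert h1 using 1
    module

/-- The discrete subgradient inequality: edge vectors increase in the causal order, so summing their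
differences with the `k`-th edge gives a future vector on either side of `k`. -/
theorem support {k j : ℕ} (hk : k < n) (hj : j ≤ n) :
    graphMap f (P j) - graphMap f (P k) -
      ((j : ℝ) - k) • (graphMap f (P (k + 1)) - graphMap f (P k)) ∈ futureCone := by
  rcases le_total k j with h | h
  · induction j, h using Nat.le_induction with
    | base => simpa using futureCone_zero
    | succ i hi ih =>
      have h1 := futureCone_add (ih (by omega)) (hP.edge_sub_mem hi hj)
      convert h1 using 1
      push_cast; module
  · obtain ⟨d, rfl⟩ := Nat.exists_eq_add_of_le h
    induction d generalizing j with
    | zero => simpa using futureCone_zero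
    | succ d ih =>
      have e : j + (d + 1) = j + 1 + d := by omega
      have h1 := futureCone_add (ih (j := j + 1) (by omega) (by omega) (by omega))
        (hP.edge_sub_mem (i := j) (j := j + 1 + d) (by omega) (by omega))
      rw [e]
      convert h1 using 1
      push_cast; module

end IsConvexPolygon

namespace IsConvexEntireSpacelike

variable {f : Plane → ℝ} (hf : IsConvexEntireSpacelike f)

include hf

/-- On a compact convex set slopes are at most `ρ < 1`, so a squared chord is at least `(1 - ρ²)`
times the squared Euclidean distance. The factor `N` is the number of edges in the applications. -/
theorem exists_norm_sub_le_of_chordSq {K : Set Plane} (hK : IsCompact K) (hc : Convex ℝ K) :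
    ∃ κ : ℝ, 0 < κ ∧ ∀ x ∈ K, ∀ y ∈ K, ∀ N : ℝ, 0 ≤ N → ∀ L : ℝ, 0 ≤ L →
      N ^ 2 * chordSq f x y ≤ L ^ 2 → N * ‖y - x‖ ≤ κ * L := by
  obtain ⟨ρ, hρ0, hρ1, -, hρ⟩ := hf.exists_abs_sub_le hK hc
  have hq : 0 < 1 - ρ ^ 2 := by nlinarith
  refine ⟨(√(1 - ρ ^ 2))⁻¹, by positivity, fun x hx y hy N hN L hL h => ?_⟩
  rw [inv_mul_eq_div, le_div_iff₀ (by positivity)]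
  refine abs_le_of_sq_le_sq' ?_ hL |>.2
  have h4 : (f y - f x) ^ 2 ≤ (ρ * ‖y - x‖) ^ 2 := by
    rw [← sq_abs]; exact pow_le_pow_left₀ (abs_nonneg _) (hρ x hx y hy) 2
  have h5 : (1 - ρ ^ 2) * ‖y - x‖ ^ 2 ≤ chordSq f x y := by
    rw [mul_pow] at h4; rw [chordSq]; linarith
  calc (N * ‖y - x‖ * √(1 - ρ ^ 2)) ^ 2 = N ^ 2 * ((1 - ρ ^ 2) * ‖y - x‖ ^ 2) := by
        rw [mul_pow, mul_pow, Real.sq_sqrt hq.le]; ring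
    _ ≤ N ^ 2 * chordSq f x y := by gcongr
    _ ≤ _ := h

/-- Polygons of bounded speed stay in a bounded region for a uniform amount of time. -/
theorem exists_time_step {L : ℝ} (hL : 0 < L) (B : ℝ) :
    ∃ δ : ℝ, 0 < δ ∧ ∀ (P : ℕ → Plane) (n : ℕ), IsConvexPolygon f P n L →
      (∀ i < n, ‖P (i + 1) - P i‖ ≤ 1) → ∀ k j : ℕ, k ≤ j → j ≤ n → ‖P k‖ ≤ B →
        (j : ℝ) - k ≤ n * δ → ‖P j‖ ≤ B + 1 := by
  obtain ⟨κ, hκ, h⟩ := hf.exists_norm_sub_le_of_chordSq (isCompact_closedBall (0 : Plane) (B + 2))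
    (convex_closedBall _ _)
  refine ⟨1 / (κ * L), by positivity, fun P n hP hedge k j hkj hjn hk hδ => ?_⟩
  have hn : (0:ℝ) < n := by exact_mod_cast hP.pos
  -- A bootstrap: while the vertex stays in the ball of radius `B + 1`, the next one is in that of
  -- radius `B + 2`, where the bound `κ L / n` on the edge applies.
  have key : ∀ j, k ≤ j → j ≤ n → (j : ℝ) - k ≤ n * (1 / (κ * L)) →
      n * ‖P j - P k‖ ≤ ((j : ℝ) - k) * (κ * L) := by
    intro j hkj
    induction j, hkj using Nat.le_induction with
    | base => simp
    | succ i hi ih =>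
      intro hin hiδ
      push_cast at hiδ
      have h1 := ih (by omega) (by linarith)
      have h2 : n * ‖P i - P k‖ ≤ n * 1 := by
        refine h1.trans ?_
        rw [mul_one_div, le_div_iff₀ (by positivity)] at hiδ
        nlinarith [mul_pos hκ hL]
      have h3 := le_of_mul_le_mul_left h2 hn
      have h4 := hedge i (by omega)
      have h5 : ‖P i‖ ≤ B + 1 := by
        have := norm_le_norm_add_norm_sub' (P i) (P k)
        linarith
      have h6 : ‖P (i + 1)‖ ≤ B + 2 := by
        have := norm_le_norm_add_norm_sub' (P (i + 1)) (P i)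
        linarith
      have h7 := h (P i) (by simp; linarith) (P (i + 1)) (by simpa using h6) n hn.le L hL.le
        (hP.speed i (by omega))
      have h8 : ‖P (i + 1) - P k‖ ≤ ‖P (i + 1) - P i‖ + ‖P i - P k‖ := norm_sub_le_norm_sub_add_norm_sub _ _ _
      push_cast
      nlinarith [mul_le_mul_of_nonneg_left h8 hn.le]
  have h1 := key j hkj hjn hδ
  have h2 : n * ‖P j - P k‖ ≤ n * 1 := by
    refine h1.trans ?_
    rw [mul_one_div, le_div_iff₀ (by positivity)] at hδ
    linarith
  have h3 := le_of_mul_le_mul_left h2 hn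
  have := norm_le_norm_add_norm_sub' (P j) (P k)
  linarith

theorem norm_graphMap_sub_le (x y : Plane) : ‖graphMap f y - graphMap f x‖ ≤ 2 * ‖y - x‖ := by
  refine abs_le_of_sq_le_sq' ?_ (by positivity) |>.2
  have h1 : (f y - f x) ^ 2 ≤ ‖y - x‖ ^ 2 := by
    rw [← sq_abs]; exact pow_le_pow_left₀ (abs_nonneg _) (hf.abs_sub_le x y) 2
  rw [Plane.norm_sq] at h1
  rw [EuclideanSpace.norm_sq_eq, Fin.sum_univ_three, mul_pow, Plane.norm_sq]
  simp only [graphMap, PiLp.sub_apply, Real.norm_eq_abs, sq_abs, Matrix.cons_val] at h1 ⊢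
  nlinarith [sq_nonneg (y 0 - x 0), sq_nonneg (y 1 - x 1)]

/-- Polygons of bounded speed with the same initial point, whose endpoints go to infinity,
subconverge to a convex ray. -/
theorem exists_isConvexRay {L : ℝ} (hL : 0 < L) {p : Plane} {n : ℕ → ℕ} {P : ℕ → ℕ → Plane}
    (hP : ∀ m, IsConvexPolygon f (P m) (n m) L) (hp : ∀ m, P m 0 = p)
    (hend : Tendsto (fun m => P m (n m)) atTop (cocompact Plane))
    (hedge : ∀ m, ∀ i < n m, ‖P m (i + 1) - P m i‖ ≤ 1) (hn : Tendsto n atTop atTop) :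
    ∃ c b T, IsConvexRay f c b T L := by
  -- Along an ultrafilter the vertices at every real time converge simultaneously, with no diagonal
  -- extraction.
  obtain ⟨U, hU⟩ : ∃ U : Ultrafilter ℕ, (U : Filter ℕ) ≤ atTop :=
    ⟨hyperfilter ℕ, Nat.hyperfilter_le_atTop⟩
  have hnR : Tendsto (fun m => (n m : ℝ)) U atTop :=
    (tendsto_natCast_atTop_atTop.comp hn).mono_left hU
  have hn0 : ∀ m, (0:ℝ) < n m := fun m => by exact_mod_cast (hP m).pos
  choose δ hδ0 hδ using fun B => hf.exists_time_step hL B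
  -- The times up to which almost all polygons stay in a common bounded set. The ray lives up to the
  -- supremum of `J`, which is at most `1` because the endpoints escape.
  obtain ⟨J, hJ⟩ : ∃ J : Set ℝ, ∀ t, t ∈ J ↔ 0 ≤ t ∧ ∃ R, ∀ᶠ m in (U : Filter ℕ),
      ∀ k ≤ n m, (k : ℝ) ≤ n m * t → ‖P m k‖ ≤ R :=
    ⟨{t | 0 ≤ t ∧ ∃ R, ∀ᶠ m in (U : Filter ℕ), ∀ k ≤ n m, (k : ℝ) ≤ n m * t → ‖P m k‖ ≤ R},
      fun t => Iff.rfl⟩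
  have hJ0 : (0:ℝ) ∈ J := by
    refine (hJ 0).2 ⟨le_rfl, ‖p‖, Eventually.of_forall fun m k _ hk => ?_⟩
    rw [mul_zero] at hk
    have : k = 0 := by exact_mod_cast le_antisymm hk (Nat.cast_nonneg k)
    rw [this, hp]
  have hJ1 : ∀ t ∈ J, t < 1 := fun t ht => by
    obtain ⟨-, R, hR⟩ := (hJ t).1 ht
    by_contra! h
    have h1 := (((tendsto_norm_cocompact_atTop (E := Plane)).comp hend).mono_left hU).eventually_gt_atTop R
    obtain ⟨m, hm1, hm2⟩ := (hR.and h1).exists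
    have := hm1 (n m) le_rfl (le_mul_of_one_le_right (hn0 m).le h)
    simp only [Function.comp_apply] at hm2
    linarith
  have hJdown : ∀ s t, 0 ≤ s → s ≤ t → t ∈ J → s ∈ J := fun s t hs hst ht => by
    obtain ⟨-, R, hR⟩ := (hJ t).1 ht
    refine (hJ s).2 ⟨hs, R, hR.mono fun m hm k hk hks => hm k hk (hks.trans ?_)⟩
    exact mul_le_mul_of_nonneg_left hst (hn0 m).le
  have hfl : ∀ m, ∀ t ∈ J, ((⌊n m * t⌋₊ : ℕ) : ℝ) ≤ n m * t ∧ ⌊n m * t⌋₊ < n m := fun m t ht => by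
    have h1 : ((⌊n m * t⌋₊ : ℕ) : ℝ) ≤ n m * t :=
      Nat.floor_le (mul_nonneg (hn0 m).le ((hJ t).1 ht).1)
    refine ⟨h1, ?_⟩
    have h2 := mul_lt_mul_of_pos_left (hJ1 t ht) (hn0 m)
    rw [mul_one] at h2
    exact_mod_cast h1.trans_lt h2
  have hstep : ∀ s ∈ J, ∀ B, (∀ᶠ m in (U : Filter ℕ), ‖P m ⌊n m * s⌋₊‖ ≤ B) → s + δ B / 2 ∈ J := by
    intro s hs B hB
    obtain ⟨hs0, R, hR⟩ := (hJ s).1 hs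
    refine (hJ _).2 ⟨by have := hδ0 B; positivity, max R (B + 1), ?_⟩
    filter_upwards [hB, hR, hnR.eventually_ge_atTop (2 / δ B)] with m hm1 hm2 hm3 k hk hks
    rcases le_or_gt (k : ℝ) (n m * s) with h | h
    · exact (hm2 k hk h).trans (le_max_left _ _)
    · refine (hδ B (P m) (n m) (hP m) (hedge m) ⌊n m * s⌋₊ k ?_ hk hm1 ?_).trans (le_max_right _ _)
      · exact_mod_cast ((hfl m s hs).1.trans h.le)
      · have h1 := Nat.lt_floor_add_one ((n m : ℝ) * s)
        rw [div_le_iff₀ (hδ0 B)] at hm3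
        nlinarith
  obtain ⟨T, hT⟩ : ∃ T, T = sSup J := ⟨_, rfl⟩
  have hbdd : BddAbove J := ⟨1, fun t ht => (hJ1 t ht).le⟩
  have hleT : ∀ t ∈ J, t ≤ T := fun t ht => by rw [hT]; exact le_csSup hbdd ht
  have hT0 : 0 < T := by
    have h1 := hleT _ (hstep 0 hJ0 ‖p‖ (Eventually.of_forall fun m => by simp [hp]))
    linarith [hδ0 ‖p‖]
  have hTJ : ∀ t ∈ Ico 0 T, t ∈ J := fun t ht => by
    obtain ⟨s, hs, hts⟩ := exists_lt_of_lt_csSup ⟨0, hJ0⟩ (hT ▸ ht.2)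
    exact hJdown t s ht.1 hts.le hs
  have hcex : ∀ t, ∃ y, t ∈ Ico 0 T → Tendsto (fun m => P m ⌊n m * t⌋₊) U (𝓝 y) := fun t => by
    by_cases ht : t ∈ Ico 0 T
    · obtain ⟨-, R, hR⟩ := (hJ t).1 (hTJ t ht)
      obtain ⟨y, hy⟩ := U.exists_tendsto_of_norm_le (x := fun m => P m ⌊n m * t⌋₊) (R := R)
        (hR.mono fun m hm => hm _ (hfl m t (hTJ t ht)).2.le (hfl m t (hTJ t ht)).1)
      exact ⟨y, fun _ => hy⟩
    · exact ⟨0, fun h => absurd h ht⟩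
  choose c hc using hcex
  obtain ⟨a, ha⟩ : ∃ a : ℕ → ℝ → Mink, ∀ m t, a m t = (n m : ℝ) •
    (graphMap f (P m (⌊n m * t⌋₊ + 1)) - graphMap f (P m ⌊n m * t⌋₊)) := ⟨_, fun _ _ => rfl⟩
  have hbex : ∀ t, ∃ y, t ∈ Ico 0 T → Tendsto (fun m => a m t) U (𝓝 y) := fun t => by
    by_cases ht : t ∈ Ico 0 T
    · obtain ⟨-, R, hR⟩ := (hJ t).1 (hTJ t ht)
      obtain ⟨κ, hκ, h⟩ := hf.exists_norm_sub_le_of_chordSq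
        (isCompact_closedBall (0 : Plane) (R + 1)) (convex_closedBall _ _)
      obtain ⟨y, hy⟩ := U.exists_tendsto_of_norm_le (x := fun m => a m t) (R := 2 * (κ * L))
        (hR.mono fun m hm => by
          obtain ⟨h1, h2⟩ := hfl m t (hTJ t ht)
          have h3 := hm _ h2.le h1
          have h4 := hedge m _ h2
          have h5 := norm_le_norm_add_norm_sub' (P m (⌊n m * t⌋₊ + 1)) (P m ⌊n m * t⌋₊)
          have h6 := h _ (by simp; linarith) _ (by simp; linarith) _ (hn0 m).le L hL.le
            ((hP m).speed _ h2)
          have h7 := hf.norm_graphMap_sub_le (P m ⌊n m * t⌋₊) (P m (⌊n m * t⌋₊ + 1))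
          rw [ha, norm_smul, Real.norm_of_nonneg (hn0 m).le]
          linarith [mul_le_mul_of_nonneg_left h7 (hn0 m).le])
      exact ⟨y, fun _ => hy⟩
    · exact ⟨0, fun h => absurd h ht⟩
  choose b hb using hbex
  have hasq : ∀ m t, minkForm (a m t) (a m t) =
      (n m : ℝ) ^ 2 * chordSq f (P m ⌊n m * t⌋₊) (P m (⌊n m * t⌋₊ + 1)) := fun m t => by
    rw [ha, minkForm_smul_self, minkForm_graphMap_sub]
  have hfloor : ∀ t ∈ Ico 0 T, Tendsto (fun m => ((⌊n m * t⌋₊ : ℕ) : ℝ) / n m) U (𝓝 t) :=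
    fun t ht => by
    have := (tendsto_nat_floor_mul_div_atTop ht.1).comp hnR
    simpa [Function.comp_def, mul_comm] using this
  refine ⟨c, b, T, hT0, hL.le, fun s hs t ht => ?_, fun t ht => ?_, fun t ht => ?_, ?_⟩
  · have h1 : Tendsto (fun m => graphMap f (P m ⌊n m * t⌋₊) - graphMap f (P m ⌊n m * s⌋₊) -
        (((⌊n m * t⌋₊ : ℕ) : ℝ) / n m - ((⌊n m * s⌋₊ : ℕ) : ℝ) / n m) • a m s) U
        (𝓝 (graphMap f (c t) - graphMap f (c s) - (t - s) • b s)) :=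
      (((hf.continuous_graphMap.tendsto _).comp (hc t ht)).sub
        ((hf.continuous_graphMap.tendsto _).comp (hc s hs))).sub
        (((hfloor t ht).sub (hfloor s hs)).smul (hb s hs))
    refine isClosed_futureCone.mem_of_tendsto h1 (Eventually.of_forall fun m => ?_)
    have h2 := (hP m).support (hfl m s (hTJ s hs)).2 (hfl m t (hTJ t ht)).2.le
    rw [ha, smul_smul, ← sub_div, div_mul_cancel₀ _ (hn0 m).ne']
    exact h2
  · refine ge_of_tendsto ((continuous_minkForm_self.tendsto _).comp (hb t ht))
      (Eventually.of_forall fun m => ?_)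
    simp only [Function.comp_apply]
    rw [hasq]
    exact mul_nonneg (sq_nonneg _) (hf.chordSq_nonneg _ _)
  · refine le_of_tendsto ((continuous_minkForm_self.tendsto _).comp (hb t ht))
      (Eventually.of_forall fun m => ?_)
    simp only [Function.comp_apply]
    rw [hasq]
    exact (hP m).speed _ (hfl m t (hTJ t ht)).2
  · rintro ⟨R, hR⟩
    -- If the limit curve were bounded by `R`, polygons starting just before `T` would have a
    -- uniform time step `δ (R + 1)` available, which would put a time beyond `T` in `J`.
    obtain ⟨d, hd⟩ : ∃ d, d = δ (R + 1) := ⟨_, rfl⟩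
    have hd0 : 0 < d := by rw [hd]; exact hδ0 _
    obtain ⟨s, hs, hsT⟩ : ∃ s ∈ Ico 0 T, T - d / 4 < s := by
      obtain ⟨s, h1, h2⟩ := exists_between (show max 0 (T - d / 4) < T from
        max_lt hT0 (by linarith))
      exact ⟨s, ⟨(le_max_left _ _).trans h1.le, h2⟩, (le_max_right _ _).trans_lt h1⟩
    have h1 : ∀ᶠ m in (U : Filter ℕ), ‖P m ⌊n m * s⌋₊‖ ≤ R + 1 := by
      have h2 := (hc s hs).norm.eventually_lt_const
        (show ‖c s‖ < R + 1 by linarith [hR s hs])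
      exact h2.mono fun m hm => hm.le
    have h2 := hleT _ (hstep s (hTJ s hs) (R + 1) h1)
    rw [← hd] at h2
    linarith

end IsConvexEntireSpacelike

/-! ### Properness from three null planes, and completeness. -/

theorem det_ne_zero_of_three_unit_vectors {a b c d p q : ℝ} (h1 : a ^ 2 + b ^ 2 = 1)
    (h2 : c ^ 2 + d ^ 2 = 1) (h3 : p ^ 2 + q ^ 2 = 1) (h12 : ¬(a = c ∧ b = d))
    (h13 : ¬(a = p ∧ b = q)) (h23 : ¬(c = p ∧ d = q)) :
    (a - c) * (b - q) - (b - d) * (a - p) ≠ 0 := by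
  have hpos : ∀ x y : ℝ, ¬(x = 0 ∧ y = 0) → 0 < x ^ 2 + y ^ 2 := fun x y h => by
    by_contra! h0
    exact h ⟨by nlinarith [sq_nonneg x, sq_nonneg y], by nlinarith [sq_nonneg x, sq_nonneg y]⟩
  intro h
  obtain ⟨x, hx⟩ : ∃ x, x = a - c := ⟨_, rfl⟩
  obtain ⟨y, hy⟩ : ∃ y, y = b - d := ⟨_, rfl⟩
  obtain ⟨z, hz⟩ : ∃ z, z = a - p := ⟨_, rfl⟩
  obtain ⟨w, hw⟩ : ∃ w, w = b - q := ⟨_, rfl⟩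
  rw [← hx, ← hy, ← hz, ← hw] at h
  have hu := hpos x y fun h0 => h12 ⟨by linarith [h0.1], by linarith [h0.2]⟩
  have hv := hpos z w fun h0 => h13 ⟨by linarith [h0.1], by linarith [h0.2]⟩
  have hu2 : x ^ 2 + y ^ 2 = 2 * (a * x + b * y) := by
    rw [hx, hy]; linear_combination h2 - h1
  have hv2 : z ^ 2 + w ^ 2 = 2 * (a * z + b * w) := by
    rw [hz, hw]; linear_combination h3 - h1
  -- Two parallel chords from the same point of the circle satisfy `|u|² = u · v = |v|²`, hence
  -- coincide.
  have e1 : (x ^ 2 + y ^ 2) * (z ^ 2 + w ^ 2) = (x ^ 2 + y ^ 2) * (x * z + y * w) := by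
    linear_combination (x ^ 2 + y ^ 2) * hv2 - (x * z + y * w) * hu2 +
      2 * (b * x - a * y) * h
  have e2 : (z ^ 2 + w ^ 2) * (x ^ 2 + y ^ 2) = (z ^ 2 + w ^ 2) * (x * z + y * w) := by
    linear_combination (z ^ 2 + w ^ 2) * hu2 - (x * z + y * w) * hv2 -
      2 * (b * z - a * w) * h
  have e3 := mul_left_cancel₀ hu.ne' e1
  have e4 := mul_left_cancel₀ hv.ne' e2
  have e5 := hpos (x - z) (y - w) fun h0 => h23 ⟨by linarith [h0.1], by linarith [h0.2]⟩
  nlinarith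

theorem Real.Angle.eq_of_cos_sin {θ ψ : Real.Angle} (h : θ.cos = ψ.cos ∧ θ.sin = ψ.sin) :
    θ = ψ := by
  induction θ using Real.Angle.induction_on
  induction ψ using Real.Angle.induction_on
  exact Real.Angle.cos_sin_inj h.1 h.2

theorem exists_le_of_nullSupport_ne_top {f : Plane → ℝ} {θ : Real.Angle}
    (h : nullSupport f θ ≠ ⊤) : ∃ a : ℝ, ∀ x : Plane, θ.cos * x 0 + θ.sin * x 1 - f x ≤ a :=
  ⟨_, le_of_nullSupport_lt (EReal.le_coe_toReal h)⟩

theorem intrinsicDist_nonneg (f : Plane → ℝ) (p q : Plane) : 0 ≤ intrinsicDist f p q := by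
  refine Real.sInf_nonneg ?_
  rintro l ⟨c, -, -, -, rfl⟩
  exact intervalIntegral.integral_nonneg zero_le_one fun t _ => Real.sqrt_nonneg _

theorem exists_curve_of_intrinsicDist_lt {f : Plane → ℝ} {p q : Plane} {ℓ : ℝ} (h : intrinsicDist f p q < ℓ) :
    ∃ c : ℝ → Plane, ContDiff ℝ 1 c ∧ c 0 = p ∧ c 1 = q ∧ curveLength f c < ℓ := by
  have hne : {l : ℝ | ∃ c : ℝ → Plane, ContDiff ℝ 1 c ∧ c 0 = p ∧ c 1 = q ∧
      l = curveLength f c}.Nonempty :=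
    ⟨_, fun t : ℝ => p + t • (q - p), by fun_prop, by simp, by simp, rfl⟩
  obtain ⟨l, ⟨c, hc, h0, h1, rfl⟩, hl⟩ := exists_lt_of_csInf_lt hne h
  exact ⟨c, hc, h0, h1, hl⟩

namespace IsConvexEntireSpacelike

variable {f : Plane → ℝ} (hf : IsConvexEntireSpacelike f)

include hf

/-- A surface with three null support planes is properly embedded over a spacelike plane. -/
theorem exists_isCompact_sublevel (h : 3 ≤ {θ : Real.Angle | nullSupport f θ ≠ ⊤}.encard) :
    ∃ α : Plane, ‖α‖ ≤ 1 ∧ ∀ R : ℝ, IsCompact {x | f x - inner ℝ α x ≤ R} := by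
  obtain ⟨S, hS, hS3⟩ := Set.exists_subset_encard_eq h
  obtain ⟨θ₁, θ₂, θ₃, h12, h13, h23, rfl⟩ := Set.encard_eq_three.1 hS3
  obtain ⟨a₁, h₁⟩ := exists_le_of_nullSupport_ne_top (f := f) (θ := θ₁) (hS (by simp))
  obtain ⟨a₂, h₂⟩ := exists_le_of_nullSupport_ne_top (f := f) (θ := θ₂) (hS (by simp))
  obtain ⟨a₃, h₃⟩ := exists_le_of_nullSupport_ne_top (f := f) (θ := θ₃) (hS (by simp))
  have hdet := det_ne_zero_of_three_unit_vectors (Real.Angle.cos_sq_add_sin_sq θ₁)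
    (Real.Angle.cos_sq_add_sin_sq θ₂) (Real.Angle.cos_sq_add_sin_sq θ₃)
    (fun h => h12 (Real.Angle.eq_of_cos_sin h)) (fun h => h13 (Real.Angle.eq_of_cos_sin h))
    (fun h => h23 (Real.Angle.eq_of_cos_sin h))
  -- The mean of the three unit vectors. On a sublevel set of `f - ⟨α, ·⟩` the three null functions
  -- are bounded above with sum bounded below, so each is bounded. Their differences are two
  -- independent linear functions of `x`.
  obtain ⟨α, hα⟩ : ∃ α : Plane, α = !₂[(θ₁.cos + θ₂.cos + θ₃.cos) / 3,
    (θ₁.sin + θ₂.sin + θ₃.sin) / 3] := ⟨_, rfl⟩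
  have hin : ∀ x : Plane, inner ℝ α x = (θ₁.cos + θ₂.cos + θ₃.cos) / 3 * x 0 +
      (θ₁.sin + θ₂.sin + θ₃.sin) / 3 * x 1 := fun x => by
    rw [hα]; simp [PiLp.inner_apply, Fin.sum_univ_two]; ring
  refine ⟨α, ?_, fun R => ?_⟩
  · refine abs_le_of_sq_le_sq' ?_ zero_le_one |>.2
    rw [Plane.norm_sq, hα]
    simp only [Matrix.cons_val_zero, Matrix.cons_val_one]
    nlinarith [Real.Angle.cos_sq_add_sin_sq θ₁, Real.Angle.cos_sq_add_sin_sq θ₂,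
      Real.Angle.cos_sq_add_sin_sq θ₃, sq_nonneg (θ₁.cos - θ₂.cos), sq_nonneg (θ₁.cos - θ₃.cos),
      sq_nonneg (θ₂.cos - θ₃.cos), sq_nonneg (θ₁.sin - θ₂.sin), sq_nonneg (θ₁.sin - θ₃.sin),
      sq_nonneg (θ₂.sin - θ₃.sin)]
  · have hcont := hf.continuous
    refine Metric.isCompact_of_isClosed_isBounded
      (isClosed_le (by fun_prop) continuous_const) ?_
    obtain ⟨C, hC⟩ : ∃ C, C = |R| + |a₁| + |a₂| + |a₃| := ⟨_, rfl⟩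
    obtain ⟨D, hD⟩ : ∃ D, D = |(θ₁.cos - θ₂.cos) * (θ₁.sin - θ₃.sin) -
      (θ₁.sin - θ₂.sin) * (θ₁.cos - θ₃.cos)| := ⟨_, rfl⟩
    have hD0 : 0 < D := by rw [hD]; exact abs_pos.2 hdet
    have hC0 : 0 ≤ C := by rw [hC]; positivity
    refine (Metric.isBounded_closedBall (x := (0 : Plane)) (r := 12 * C / D + 12 * C / D)).subset
      fun x hx => ?_
    rw [mem_ofPred_eq, hin] at hx
    have i1 := h₁ x
    have i2 := h₂ x
    have i3 := h₃ x
    have l0 := le_abs_self R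
    have l1 := le_abs_self a₁
    have l2 := le_abs_self a₂
    have l3 := le_abs_self a₃
    have k1 := abs_nonneg a₁
    have k2 := abs_nonneg a₂
    have k3 := abs_nonneg a₃
    obtain ⟨s, hs⟩ : ∃ s, s = (θ₁.cos - θ₂.cos) * x 0 + (θ₁.sin - θ₂.sin) * x 1 := ⟨_, rfl⟩
    obtain ⟨t, ht⟩ : ∃ t, t = (θ₁.cos - θ₃.cos) * x 0 + (θ₁.sin - θ₃.sin) * x 1 := ⟨_, rfl⟩
    have hs' : |s| ≤ 3 * C := by rw [abs_le]; constructor <;> linarith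
    have ht' : |t| ≤ 3 * C := by rw [abs_le]; constructor <;> linarith
    have hsub : ∀ θ ψ : Real.Angle, |θ.cos - ψ.cos| ≤ 2 ∧ |θ.sin - ψ.sin| ≤ 2 := fun θ ψ => by
      have e1 := abs_le.1 (abs_le_of_sq_le_sq' (a := θ.cos) (b := 1)
        (by nlinarith [Real.Angle.cos_sq_add_sin_sq θ, sq_nonneg θ.sin]) zero_le_one |> abs_le.2)
      have e2 := abs_le.1 (abs_le_of_sq_le_sq' (a := ψ.cos) (b := 1)
        (by nlinarith [Real.Angle.cos_sq_add_sin_sq ψ, sq_nonneg ψ.sin]) zero_le_one |> abs_le.2)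
      have e3 := abs_le.1 (abs_le_of_sq_le_sq' (a := θ.sin) (b := 1)
        (by nlinarith [Real.Angle.cos_sq_add_sin_sq θ, sq_nonneg θ.cos]) zero_le_one |> abs_le.2)
      have e4 := abs_le.1 (abs_le_of_sq_le_sq' (a := ψ.sin) (b := 1)
        (by nlinarith [Real.Angle.cos_sq_add_sin_sq ψ, sq_nonneg ψ.cos]) zero_le_one |> abs_le.2)
      constructor <;> rw [abs_le] <;> constructor <;> linarith
    have hbound : ∀ y P Q : ℝ, |P| ≤ 2 → |Q| ≤ 2 →
        ((θ₁.cos - θ₂.cos) * (θ₁.sin - θ₃.sin) - (θ₁.sin - θ₂.sin) * (θ₁.cos - θ₃.cos)) * y =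
          s * P - t * Q → |y| ≤ 12 * C / D := fun y P Q hP hQ h => by
      rw [le_div_iff₀ hD0, hD, mul_comm, ← abs_mul, h]
      calc |s * P - t * Q| ≤ |s * P| + |t * Q| := abs_sub _ _
        _ = |s| * |P| + |t| * |Q| := by rw [abs_mul, abs_mul]
        _ ≤ 3 * C * 2 + 3 * C * 2 := by gcongr
        _ = _ := by ring
    have b0 := hbound (x 0) (θ₁.sin - θ₃.sin) (θ₁.sin - θ₂.sin) (hsub _ _).2 (hsub _ _).2
      (by rw [hs, ht]; ring)
    have b1 := hbound (x 1) (-(θ₁.cos - θ₃.cos)) (-(θ₁.cos - θ₂.cos))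
      (by rw [abs_neg]; exact (hsub _ _).1) (by rw [abs_neg]; exact (hsub _ _).1)
      (by rw [hs, ht]; ring)
    rw [mem_closedBall_zero_iff]
    refine le_trans ?_ (add_le_add b0 b1)
    refine abs_le_of_sq_le_sq' ?_ (by positivity) |>.2
    rw [Plane.norm_sq, add_sq, sq_abs, sq_abs]
    have := mul_nonneg (abs_nonneg (x 0)) (abs_nonneg (x 1))
    linarith

theorem intrinsicDist_le_norm (p q : Plane) : intrinsicDist f p q ≤ ‖q - p‖ := by
  obtain ⟨c, hc⟩ : ∃ c : ℝ → Plane, c = fun t => p + t • (q - p) := ⟨_, rfl⟩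
  have hcd : ContDiff ℝ 1 c := by rw [hc]; fun_prop
  have hder : ∀ t, deriv c t = q - p := fun t => by
    have h1 : HasDerivAt c (q - p) t := by
      rw [hc]; simpa using ((hasDerivAt_id t).smul_const (q - p)).const_add p
    exact h1.deriv
  have h1 : intrinsicDist f p q ≤ curveLength f c := by
    refine csInf_le ⟨0, ?_⟩ ⟨c, hcd, by simp [hc], by simp [hc], rfl⟩
    rintro l ⟨c, -, -, -, rfl⟩
    exact intervalIntegral.integral_nonneg zero_le_one fun t _ => Real.sqrt_nonneg _
  refine h1.trans ?_
  have h2 : curveLength f c ≤ ∫ _ in (0:ℝ)..1, ‖q - p‖ := by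
    refine intervalIntegral.integral_mono_on zero_le_one
      ((hf.continuous_speed hcd).intervalIntegrable _ _)
      (continuous_const.intervalIntegrable _ _) fun t _ => ?_
    rw [hf.firstForm_self, hder]
    refine Real.sqrt_le_iff.2 ⟨norm_nonneg _, ?_⟩
    linarith [sq_nonneg (fderiv ℝ f (c t) (q - p))]
  simpa using h2

/-- On compact convex sublevel sets, the intrinsic distance controls the Euclidean one. -/
theorem exists_norm_sub_le_intrinsicDist {α : Plane} (hα : ‖α‖ ≤ 1)
    (hprop : ∀ R : ℝ, IsCompact {x | f x - inner ℝ α x ≤ R}) (B : ℝ) :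
    ∃ κ : ℝ, 0 < κ ∧ ∀ p q : Plane, ‖p‖ ≤ B → ‖q‖ ≤ B → ∀ ℓ, intrinsicDist f p q < ℓ →
      ‖q - p‖ ≤ κ * ℓ := by
  have hcont : Continuous fun x : Plane => f x - inner ℝ α x := by
    have := hf.continuous
    fun_prop
  obtain ⟨R, hR⟩ := ((isCompact_closedBall (0 : Plane) B).image hcont).bddAbove
  have hBR : ∀ x : Plane, ‖x‖ ≤ B → f x - inner ℝ α x ≤ R := fun x hx =>
    hR (mem_image_of_mem _ (by simpa using hx))
  have hKc : Convex ℝ {x : Plane | f x - inner ℝ α x ≤ R} := by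
    have h1 : ConvexOn ℝ univ fun x : Plane => f x - inner ℝ α x :=
      hf.convex.sub ((innerSL ℝ α).toLinearMap.concaveOn convex_univ)
    simpa using h1.convex_le R
  obtain ⟨κ, hκ, h⟩ := hf.exists_norm_sub_le_of_chordSq (hprop R) hKc
  refine ⟨κ * 4, by positivity, fun p q hp hq ℓ hℓ => ?_⟩
  have hℓ0 : 0 < ℓ := (intrinsicDist_nonneg f p q).trans_lt hℓ
  obtain ⟨c, hc, rfl, rfl, hcl⟩ := exists_curve_of_intrinsicDist_lt hℓ
  obtain ⟨n, P, hP, -, hP0, hPn, -, hτ⟩ := hf.exists_polygon hα hprop hc hcl one_pos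
  have hn : (0:ℝ) < n := by exact_mod_cast hP.pos
  have hmem : ∀ i ≤ n, P i ∈ {x : Plane | f x - inner ℝ α x ≤ R} := fun i hi =>
    (hτ i hi).trans (max_le (hBR _ hp) (hBR _ hq))
  rw [← hP0, ← hPn, ← dist_eq_norm, dist_comm]
  refine (dist_le_range_sum_dist P n).trans ?_
  -- Unlike the original curve, the polygon stays in the sublevel set, so each of its `n` edges has
  -- Euclidean length at most `4 κ ℓ / n`.
  have h1 : ∀ i ∈ Finset.range n, dist (P i) (P (i + 1)) ≤ κ * (4 * ℓ) / n := fun i hi => by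
    rw [Finset.mem_range] at hi
    rw [le_div_iff₀' hn, dist_comm, dist_eq_norm]
    exact h _ (hmem i hi.le) _ (hmem _ hi) n hn.le _ (by positivity) (hP.speed i hi)
  have h2 := Finset.sum_le_card_nsmul _ _ _ h1
  rw [Finset.card_range, nsmul_eq_mul, mul_div_cancel₀ _ hn.ne'] at h2
  linarith

/-- The substitute for Hopf-Rinow: curves of length less than `1` from `p` with endpoints going to
infinity would yield polygons converging to a convex ray, and no such ray exists. -/
theorem exists_norm_le_of_intrinsicDist_lt (hK : CurvatureBoundedBelow f) {α : Plane} (hα : ‖α‖ ≤ 1)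
    (hprop : ∀ R : ℝ, IsCompact {x | f x - inner ℝ α x ≤ R})
    (hs : ∀ θ, nullSupport f θ ≠ ⊤ → SeqSublinearAt (nullSupport f) θ) (p : Plane) :
    ∃ B : ℝ, ∀ q, intrinsicDist f p q < 1 → ‖q‖ ≤ B := by
  by_contra! hcon
  choose q hq hqn using fun m : ℕ => hcon m
  choose c hc hc0 hc1 hcl using fun m => exists_curve_of_intrinsicDist_lt (hq m)
  -- The tolerance `1 / (m + 1)` forces at least `m` edges, each of Euclidean length at most `1`.
  choose n P hP hn hP0 hP1 hedge _ using fun m : ℕ =>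
    hf.exists_polygon hα hprop (hc m) (hcl m) (Nat.one_div_pos_of_nat (α := ℝ) (n := m))
  have hnm : ∀ m, m ≤ n m := fun m => by
    have h1 := hn m
    rw [mul_one_div, le_div_iff₀ (by positivity)] at h1
    have h2 : (m : ℝ) ≤ n m := by linarith
    exact_mod_cast h2
  have hend : Tendsto (fun m => P m (n m)) atTop (cocompact Plane) := by
    rw [← Metric.cobounded_eq_cocompact, ← comap_norm_atTop, tendsto_comap_iff]
    refine tendsto_atTop_mono (fun m => ?_) tendsto_natCast_atTop_atTop
    simp only [Function.comp_apply]
    rw [hP1, hc1]; exact (hqn m).le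
  obtain ⟨c', b, T, hr⟩ := hf.exists_isConvexRay (by norm_num) hP (fun m => (hP0 m).trans (hc0 m)) hend
    (fun m i hi => (hedge m i hi).trans (by
      rw [div_le_one (by positivity)]; linarith [Nat.cast_nonneg (α := ℝ) m]))
    (tendsto_atTop_mono hnm tendsto_id)
  exact hr.false_of_forall_seqSublinearAt hf hK hs

/-- The tail of an intrinsically Cauchy sequence lies in a unit ball, which is bounded. It is thus
Cauchy in the plane, and its Euclidean limit is also an intrinsic limit because the intrinsic
distance is at most the Euclidean one. -/
theorem isCompleteSurface (hK : CurvatureBoundedBelow f)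
    (h3 : 3 ≤ {θ : Real.Angle | nullSupport f θ ≠ ⊤}.encard)
    (hs : ∀ θ, nullSupport f θ ≠ ⊤ → SeqSublinearAt (nullSupport f) θ) : IsCompleteSurface f := by
  intro u hu
  obtain ⟨α, hα, hprop⟩ := hf.exists_isCompact_sublevel h3
  obtain ⟨N, hN⟩ := hu 1 one_pos
  obtain ⟨B, hB⟩ := hf.exists_norm_le_of_intrinsicDist_lt hK hα hprop hs (u N)
  have hBu : ∀ n, N ≤ n → ‖u n‖ ≤ B := fun n hn => hB _ (hN N n le_rfl hn)
  obtain ⟨κ, hκ, h⟩ := hf.exists_norm_sub_le_intrinsicDist hα hprop B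
  have hcau : CauchySeq u := by
    refine Metric.cauchySeq_iff.2 fun ε hε => ?_
    obtain ⟨M, hM⟩ := hu (ε / (2 * κ)) (by positivity)
    refine ⟨max M N, fun m hm n hn => ?_⟩
    have h1 := h (u m) (u n) (hBu _ (le_of_max_le_right hm)) (hBu _ (le_of_max_le_right hn)) _
      (hM m n (le_of_max_le_left hm) (le_of_max_le_left hn))
    rw [dist_comm, dist_eq_norm]
    have h2 : κ * (ε / (2 * κ)) = ε / 2 := by field_simp
    rw [h2] at h1
    linarith
  obtain ⟨q, hq⟩ := cauchySeq_tendsto_of_complete hcau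
  refine ⟨q, squeeze_zero (fun n => intrinsicDist_nonneg f _ _)
    (fun n => hf.intrinsicDist_le_norm _ _) ?_⟩
  have := (tendsto_const_nhds (x := q)).sub hq
  rw [sub_self] at this
  simpa using this.norm

end IsConvexEntireSpacelike

end

theorem theoremA (φ : Real.Angle → EReal) (hbot : ∀ θ, φ θ ≠ ⊥)
    (hlsc : LowerSemicontinuous φ) (hfin : 3 ≤ {θ : Real.Angle | φ θ ≠ ⊤}.encard) :
    (∀ θ₀ : Real.Angle, φ θ₀ ≠ ⊤ → SeqSublinearAt φ θ₀ →
      ∀ f : Plane → ℝ, IsConvexEntireSpacelike f → CurvatureBoundedBelow f →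
        nullSupport f = φ → CompleteAt f θ₀) ∧
    ((∀ θ₀ : Real.Angle, φ θ₀ ≠ ⊤ → SeqSublinearAt φ θ₀) →
      ∀ f : Plane → ℝ, IsConvexEntireSpacelike f → CurvatureBoundedBelow f →
        nullSupport f = φ → IsCompleteSurface f) := by
  refine ⟨fun θ₀ _ hs f hf hK hφ => ?_, fun hs f hf hK hφ => ?_⟩
  · subst hφ
    exact completeAt_of_seqSublinearAt hf hK hs
  · subst hφ
    exact hf.isCompleteSurface hK hfin hs
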